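/- **Conventions.** A *positive totally ordered aura* is a (commutative) semifield $R$ with a total order such that $0<1$ and such that $x\le z$, $y\le t$ imply $x+y\le z+t$ and $xy\le zt$. It has *tempered growth* if for every nonzero $P\in\mathbb{N}[X]$ and $x\in R$, $x^n\le P(n)$ for all $n\in\mathbb{N}$ implies $x\le 1$. A *seminorm* on a commutative ring $A$ is a map $|.|:A\to R$ to such an $R$ with $|0|=0$, $|1|=1$, $|ab|\le|a||b|$, $|a+b|\le|a|+|b|$; it is *tempered* if $R$ has tempered growth, and *multiplicative* if $|ab|=|a||b|$. Two seminorms are *multiplicatively equivalent* if for all $a,b,c$: $|a|_1|c|_1\le|b|_1\Leftrightarrow|a|_2|c|_2\le|b|_2$. $\mathrm{Speh}^m(A)$ is the set of multiplicative equivalence classes (places) of tempered multiplicative seminorms, and $\mathrm{Spev}(A)\subset\mathrm{Speh}^m(A)$ is the subset of places of Krull valuations. For a seminorm on $A$ let $M_A$ be the set of $a$ with $|a|\in R^\times$ and $|ab|=|a||b|$ for all $b$, let $|.|$ also denote the extension to the localization $A_{M_A}$, and let $B(0,|a|)=\{z:|z|<|a|\}$. The *analytic spectrum* $\mathrm{Speh}^a(A)\subset\mathrm{Speh}^m(A)$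 consists of the places of those seminorms such that for every ring morphism $f:B\to A$ (with $B$ equipped with $|f(.)|$): $f(M_B)\subset M_A$; the balls $B(0,|b|)$, $|b|>0$, define a ring topology on $B_{M_B}$ and the seminorm extends, up to multiplicative equivalence, to its separated completion; and for every $a\in A_{M_A}$ with $|a|>0$ there is $b\in B_{M_B}$ with $|b|>0$ and $B(0,|b|)\subset f^{-1}(B(0,|a|))$. For a field $K$ with a real absolute value and $a\in K$, let $|.|_{2,a}$ be the place of $K[X]$ given by $|\sum_{i\ge i_0}a_i(X-a)^i|_{2,a}=|a_{i_0}|q^{i_0}$ ($a_{i_0}\ne0$), with $q=|X-a|$ positive but smaller than every positive real number, and let $|.|_{2,\infty}$ be given by $|\sum_{i\le n}a_iX^i|_{2,\infty}=|a_n|q^n$ ($a_n\neq 0$), with $q$ greater than every real number. (The values are $0$ and the pairs $rq^i$, $r\in\mathbb{R}_{>0}$, $i\in\mathbb{Z}$, ordered lexicographically.) For $K=\bar{\mathbb{Q}}$ with an extension of the $p$-adic absolute value these are the infinitesimal Huber–Knebusch points with major set $M=\{|\gamma|\in|K^*| : q<|\gamma|\}$ equal to $|K^*|$, respectively to $\emptyset$.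 **Proposition.** Every point of $\mathrm{Speh}^m(\mathbb{Z}[T])$ is of one of the following kinds, according to its restriction to $\mathbb{Z}$. 1. *Points whose restriction to $\mathbb{Z}$ is the trivial norm.* All of them lie in $\mathrm{Speh}^a(\mathbb{Z}[T])$. They are the restrictions of the following places of $\mathbb{Q}[T]$: the trivial seminorms modulo a prime ideal of $\mathbb{Q}[T]$ (in particular the trivial seminorm of $\mathbb{Z}[T]$, equal to $1$ outside $0$), the $P$-adic valuations for irreducible $P\in\mathbb{Q}[T]$, and the degree valuation $|P|=q^{\deg P}$, $q>1$. 2. *$\mathbb{F}_p$-points* ($p$ prime): the restriction to $\mathbb{Z}$ has kernel $(p)$. All of them are in $\mathrm{Spev}(\mathbb{Z}[T])$ and lie in $\mathrm{Speh}^a(\mathbb{Z}[T])$. They are the restrictions of the trivial seminorms modulo a prime ideal of $\mathbb{F}_p[T]$, of the $P$-adic valuations for irreducible $P\in\mathbb{F}_p[T]$, and of the degree valuation of $\mathbb{F}_p[T]$. 3. *$\mathbb{Q}_p$-points* ($p$ prime): the restriction to $\mathbb{Z}$ is the $p$-adic norm. All of them are in $\mathrm{Spev}(\mathbb{Z}[T])$.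 Those that are not in $\mathrm{Speh}^a(\mathbb{Z}[T])$ are exactly the restrictions to $\mathbb{Z}[T]$ of the places $|.|_{2,a}$, $a\in\bar{\mathbb{Q}}$, and $|.|_{2,\infty}$ of $\bar{\mathbb{Q}}[T]$, for the absolute values of $\bar{\mathbb{Q}}$ that extend the $p$-adic one. Restriction along $\mathbb{Z}[T]\to\mathbb{Q}_p[T]$ is a bijection from the set of points of Huber's adic affine line $\mathbb{A}^{1,ad}_{\mathbb{Q}_p}=\bigcup_n\mathrm{Spa}(\mathbb{Q}_p\langle p^nT\rangle,\mathbb{Z}_p\langle p^nT\rangle)$ to the set of the $\mathbb{Q}_p$-points that are in $\mathrm{Speh}^a(\mathbb{Z}[T])$. 4. *$\mathbb{R}$-points*: the restriction to $\mathbb{Z}$ is the usual archimedean norm. Those that are not in $\mathrm{Speh}^a(\mathbb{Z}[T])$ are exactly the restrictions to $\mathbb{Z}[T]$ of the places $|.|_{2,a}$, $a\in\bar{\mathbb{Q}}$, and $|.|_{2,\infty}$ of $\bar{\mathbb{Q}}[T]$, for the absolute values of $\bar{\mathbb{Q}}$ induced by embeddings $\bar{\mathbb{Q}}\to\mathbb{C}$.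 Those in $\mathrm{Speh}^a(\mathbb{Z}[T])$ are exactly the places $P\mapsto|P(z)|$, $z\in\mathbb{C}$, and they are also exactly the $\mathbb{R}$-points that are places of $\mathbb{R}_+$-valued seminorms. -/

import Mathlib

open Polynomial Topology

universe u

namespace Speh

/-! ### Auras, tempered growth, generalized seminorms -/

/-- A positive totally ordered aura: a semifield with a total order that is compatible with
addition and multiplication, and such that `0 < 1`. -/
class IsPosAura (R : Type u) [Semifield R] [LinearOrder R] : Prop where
  add_le_add' : ∀ {x y z t : R}, x ≤ z → y ≤ t → x + y ≤ z + t
  mul_le_mul' : ∀ {x y z t : R}, x ≤ z → y ≤ t → x * y ≤ z * t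
  zero_lt_one' : (0 : R) < 1

/-- Tempered growth: if `P ∈ ℕ[X]` is nonzero and `x ^ n ≤ P(n)` for all `n`, then `x ≤ 1`. -/
def TemperedGrowth (R : Type u) [Semifield R] [LinearOrder R] : Prop :=
  ∀ P : ℕ[X], P ≠ 0 → ∀ x : R, (∀ n : ℕ, x ^ n ≤ ((P.eval n : ℕ) : R)) → x ≤ 1

/-- A generalized seminorm on the ring `A` with values in `R`. -/
structure GenSeminorm (A : Type u) [CommRing A] (R : Type u) [Semifield R] [LinearOrder R] where
  toFun : A → R
  map_zero : toFun 0 = 0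
  map_one : toFun 1 = 1
  map_mul_le : ∀ a b, toFun (a * b) ≤ toFun a * toFun b
  map_add_le : ∀ a b, toFun (a + b) ≤ toFun a + toFun b

/-- `v` is multiplicatively bounded by `w`. -/
def MulBounded {A R S : Type*} [Mul R] [LE R] [Mul S] [LE S] (v : A → R) (w : A → S) : Prop :=
  ∀ a b c, w a * w c ≤ w b → v a * v c ≤ v b

/-- Multiplicative equivalence. -/
def MulEquivalent {A R S : Type*} [Mul R] [LE R] [Mul S] [LE S] (v : A → R) (w : A → S) : Prop :=
  MulBounded v w ∧ MulBounded w v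

namespace GenSeminorm

variable {A B R : Type u} [CommRing A] [CommRing B] [Semifield R] [LinearOrder R]

/-- The seminorm `|f(.)|` on `B`. -/
def comp (v : GenSeminorm A R) (f : B →+* A) : GenSeminorm B R where
  toFun b := v.toFun (f b)
  map_zero := by rw [_root_.map_zero, v.map_zero]
  map_one := by rw [_root_.map_one, v.map_one]
  map_mul_le a b := by rw [map_mul]; exact v.map_mul_le _ _
  map_add_le a b := by rw [map_add]; exact v.map_add_le _ _

/-- The set of multiplicative elements of a seminorm. -/
def multElts (v : GenSeminorm A R) : Submonoid A where
  carrier := {a | IsUnit (v.toFun a) ∧ ∀ b, v.toFun (a * b) = v.toFun a * v.toFun b}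
  one_mem' := ⟨by rw [v.map_one]; exact isUnit_one, fun b => by rw [one_mul, v.map_one, one_mul]⟩
  mul_mem' := by
    rintro a b ⟨ha, ha'⟩ ⟨hb, hb'⟩
    refine ⟨by rw [ha']; exact ha.mul hb, fun c => ?_⟩
    rw [mul_assoc, ha', hb', ha', mul_assoc]

/-- The extension `|a / s| = |a| / |s|` of a seminorm to the localization at its multiplicative
elements. -/
noncomputable def locNorm (v : GenSeminorm A R) (z : Localization v.multElts) : R :=
  Localization.liftOn z (fun a s => v.toFun a / v.toFun s) (by
    intro a c b d h
    obtain ⟨u, hu⟩ := Localization.r_iff_exists.mp h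
    have hb : v.toFun b ≠ 0 := b.2.1.ne_zero
    have hd : v.toFun d ≠ 0 := d.2.1.ne_zero
    have hu0 : v.toFun u ≠ 0 := u.2.1.ne_zero
    have h' := congrArg v.toFun hu
    rw [u.2.2, u.2.2, d.2.2, b.2.2] at h'
    have h'' := mul_left_cancel₀ hu0 h'
    rw [div_eq_div_iff hb hd, mul_comm, h'', mul_comm])

end GenSeminorm

/-! ### Ball topologies and functorial multiplicative completions -/

/-- The open ball `B(x, |a|)`. -/
def ball {A R : Type*} [Sub A] [LT R] (N : A → R) (x a : A) : Set A := {z | N (z - x) < N a}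

/-- The seminorm `N` has tiny balls. -/
structure TinyBalls {A R : Type*} [CommRing A] [Zero R] [LT R] (N : A → R) : Prop where
  add : ∀ a, 0 < N a → ∃ a', 0 < N a' ∧ ∀ x ∈ ball N 0 a', ∀ y ∈ ball N 0 a', x + y ∈ ball N 0 a
  smul : ∀ a, 0 < N a → ∀ x, ∃ c, 0 < N c ∧ ∀ y ∈ ball N 0 c, x * y ∈ ball N 0 a
  mul : ∀ a, 0 < N a → ∃ a', 0 < N a' ∧ ∀ x ∈ ball N 0 a', ∀ y ∈ ball N 0 a', x * y ∈ ball N 0 a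
  neg : ∀ a, 0 < N a → ∃ a', 0 < N a' ∧ ∀ x ∈ ball N 0 a', -x ∈ ball N 0 a

/-- `ι : A → C` is the separated completion of `A` for the ball topology of `N`: the ring `C` is
complete and separated, `ι` has dense image, and `ι` induces on `A` the topology in which the balls
`B(0, |a|)`, `|a| > 0`, form a fundamental system of neighbourhoods of `0`. -/
structure IsSepCompletion {A C R : Type*} [CommRing A] [Zero R] [LT R] (N : A → R)
    [CommRing C] [UniformSpace C] [IsUniformAddGroup C] [IsTopologicalRing C]
    (ι : A →+* C) : Prop where
  complete : CompleteSpace C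
  separated : T2Space C
  dense : DenseRange ι
  nhds_zero : ∀ s : Set A, s ∈ (𝓝 (0 : C)).comap ι ↔ ∃ a, 0 < N a ∧ ball N 0 a ⊆ s

/-- `N` extends, up to multiplicative equivalence (so possibly with values in another positive
totally ordered aura), to a generalized seminorm on the separated completion of `A`. -/
def ExtendsToCompletion {A R : Type u} [CommRing A] [Semifield R] [LinearOrder R]
    (N : A → R) : Prop :=
  ∃ (C : Type u) (_ : CommRing C) (_ : UniformSpace C) (_ : IsUniformAddGroup C)
    (_ : IsTopologicalRing C) (ι : A →+* C), IsSepCompletion N ι ∧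
    ∃ (R' : Type u) (_ : Semifield R') (_ : LinearOrder R') (_ : IsPosAura R')
      (w : GenSeminorm C R'), MulEquivalent (fun a => w.toFun (ι a)) N

/-- `v` has a functorial multiplicative completion. -/
def HasFunctorialMultCompletion {A R : Type u} [CommRing A] [Semifield R] [LinearOrder R]
    (v : GenSeminorm A R) : Prop :=
  ∀ (B : Type u) [CommRing B] (f : B →+* A),
    ∃ h : (v.comp f).multElts ≤ v.multElts.comap f,
      (TinyBalls (v.comp f).locNorm ∧ ExtendsToCompletion (v.comp f).locNorm) ∧
      ∀ a, 0 < v.locNorm a → ∃ b, 0 < (v.comp f).locNorm b ∧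
        ball (v.comp f).locNorm 0 b ⊆
          (IsLocalization.map (Localization v.multElts) f h :
            Localization (v.comp f).multElts → Localization v.multElts) ⁻¹' ball v.locNorm 0 a

/-! ### The multiplicative harmonious spectrum and the analytic spectrum -/

/-- A tempered multiplicative seminorm on `A`. -/
structure TMSeminorm (A : Type u) [CommRing A] where
  R : Type u
  [semifield : Semifield R]
  [linearOrder : LinearOrder R]
  [isPosAura : IsPosAura R]
  tempered : TemperedGrowth R
  norm : GenSeminorm A R
  map_mul : ∀ a b, norm.toFun (a * b) = norm.toFun a * norm.toFun b

attribute [instance] TMSeminorm.semifield TMSeminorm.linearOrder TMSeminorm.isPosAura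

/-- Multiplicative equivalence of tempered multiplicative seminorms. -/
instance tmSetoid (A : Type u) [CommRing A] : Setoid (TMSeminorm A) where
  r v w := MulEquivalent v.norm.toFun w.norm.toFun
  iseqv :=
    { refl := fun _ => ⟨fun _ _ _ h => h, fun _ _ _ h => h⟩
      symm := fun h => ⟨h.2, h.1⟩
      trans := fun h k => ⟨fun a b c m => h.1 a b c (k.1 a b c m),
        fun a b c m => k.2 a b c (h.2 a b c m)⟩ }

/-- The multiplicative harmonious spectrum: multiplicative tempered places of `A`. -/
def SpehM (A : Type u) [CommRing A] : Type (u + 1) := Quotient (tmSetoid A)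

/-- The place of a tempered multiplicative seminorm. -/
def TMSeminorm.place {A : Type u} [CommRing A] (v : TMSeminorm A) : SpehM A := Quotient.mk _ v

/-- The analytic spectrum. -/
def SpehA (A : Type u) [CommRing A] : Set (SpehM A) :=
  {x | ∃ v : TMSeminorm A, v.place = x ∧ HasFunctorialMultCompletion v.norm}

/-- The map `SpehM A → SpehM B` induced by a ring morphism `f : B → A` (restriction). -/
def SpehM.comap {A B : Type u} [CommRing A] [CommRing B] (f : B →+* A) : SpehM A → SpehM B :=
  Quotient.map
    (fun v => { R := v.R, tempered := v.tempered, norm := v.norm.comp f,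
                map_mul := fun a b => by
                  change v.norm.toFun (f (a * b)) = _
                  rw [_root_.map_mul, v.map_mul]; rfl })
    (fun _ _ h => ⟨fun a b c => h.1 (f a) (f b) (f c), fun a b c => h.2 (f a) (f b) (f c)⟩)

/-- The kernel of a place. -/
def SpehM.ker {A : Type u} [CommRing A] : SpehM A → Set A :=
  Quotient.lift (fun v => {a | v.norm.toFun a = 0}) (by
    have key : ∀ v w : TMSeminorm A, MulBounded v.norm.toFun w.norm.toFun → ∀ a,
        w.norm.toFun a = 0 → v.norm.toFun a = 0 := by
      intro v w h a ha
      have h1 := h a 0 1 (by rw [ha, w.norm.map_zero, zero_mul])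
      rw [v.norm.map_zero, v.norm.map_one, mul_one] at h1
      refine le_antisymm h1 ?_
      have := IsPosAura.mul_le_mul' (IsPosAura.zero_lt_one' (R := v.R)).le
        (le_refl (v.norm.toFun a))
      rwa [zero_mul, one_mul] at this
    intro v w h
    ext a
    exact ⟨key w v h.2 a, key v w h.1 a⟩)

/-! ### Real valued seminorms -/

instance : IsPosAura NNReal where
  add_le_add' := add_le_add
  mul_le_mul' := mul_le_mul'
  zero_lt_one' := zero_lt_one

theorem le_one_of_pow_le_poly (P : ℕ[X]) (r : ℝ)
    (h : ∀ n : ℕ, r ^ n ≤ ((P.eval n : ℕ) : ℝ) + 1) : r ≤ 1 := by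
  by_contra! hr
  have h1 : Filter.Tendsto (fun n : ℕ => (((P.eval n : ℕ) : ℝ) + 1) / r ^ n) Filter.atTop
      (𝓝 0) := by
    have e : (fun n : ℕ => (((P.eval n : ℕ) : ℝ) + 1) / r ^ n) = fun n : ℕ =>
        (∑ i ∈ Finset.range (P.natDegree + 1), (P.coeff i : ℝ) * ((n : ℝ) ^ i / r ^ n)) +
          (n : ℝ) ^ 0 / r ^ n := by
      funext n
      rw [Polynomial.eval_eq_sum_range]
      push_cast
      rw [add_div, Finset.sum_div]
      simp [mul_div_assoc]
    rw [e]
    have : (0 : ℝ) = (∑ i ∈ Finset.range (P.natDegree + 1), (P.coeff i : ℝ) * 0) + 0 := by simp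
    rw [this]
    refine Filter.Tendsto.add (tendsto_finsetSum _ fun i _ => Filter.Tendsto.const_mul _ ?_) ?_
    · exact tendsto_pow_const_div_const_pow_of_one_lt i hr
    · exact tendsto_pow_const_div_const_pow_of_one_lt 0 hr
  obtain ⟨n, hn⟩ := (h1.eventually (gt_mem_nhds (zero_lt_one' ℝ))).exists
  rw [div_lt_one (by positivity)] at hn
  exact absurd (h n) (not_le.mpr hn)

theorem temperedGrowth_nnreal : TemperedGrowth NNReal := by
  intro P _ x h
  have := le_one_of_pow_le_poly P (x : ℝ) (fun n => by
    have := NNReal.coe_le_coe.mpr (h n)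
    push_cast at this
    linarith)
  exact_mod_cast this

/-- The place of an `ℝ₊`-valued multiplicative seminorm. -/
noncomputable def realPlace {A : Type} [CommRing A] (v : MulRingSeminorm A) : SpehM A :=
  TMSeminorm.place
    { R := NNReal
      tempered := temperedGrowth_nnreal
      norm :=
        { toFun := fun a => (v a).toNNReal
          map_zero := by simp
          map_one := by simp
          map_mul_le := fun a b => by rw [map_mul, Real.toNNReal_mul (apply_nonneg v a)]
          map_add_le := fun a b => by
            rw [← Real.toNNReal_add (apply_nonneg v a) (apply_nonneg v b)]
            exact Real.toNNReal_le_toNNReal (map_add_le_add v a b) }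
      map_mul := fun a b => by
        change (v (a * b)).toNNReal = (v a).toNNReal * (v b).toNNReal
        rw [_root_.map_mul, Real.toNNReal_mul (apply_nonneg v a)] }

/-- The place of the norm of a normed field. -/
noncomputable def normPlace (K : Type) [NormedField K] : SpehM K :=
  realPlace (NormedField.toMulRingNorm K).toMulRingSeminorm

/-! ### Krull valuations -/

/-- The semifield with a given multiplicative structure and a given addition. -/
abbrev semifieldOfAdd {G : Type u} [CommGroupWithZero G] (add : G → G → G)
    (add_assoc : ∀ a b c, add (add a b) c = add a (add b c))
    (add_comm : ∀ a b, add a b = add b a)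
    (add_zero : ∀ a, add a 0 = a)
    (mul_add : ∀ a b c, a * add b c = add (a * b) (a * c)) : Semifield G :=
  letI : Add G := ⟨add⟩
  { (inferInstance : CommGroupWithZero G) with
    add := add
    add_assoc := add_assoc
    add_comm := add_comm
    zero_add := fun a => (add_comm 0 a).trans (add_zero a)
    add_zero := add_zero
    nsmul := nsmulRec
    left_distrib := mul_add
    right_distrib := fun a b c => by
      change (add a b) * c = add (a * c) (b * c)
      rw [mul_comm, mul_add, mul_comm c a, mul_comm c b]
    nnqsmul := _
    nnqsmul_def := fun _ _ => rfl }

/-- The tropical aura `R_Γ = {0} ∪ Γ`, with addition `max`. -/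
def TropAura (Γ₀ : Type u) : Type u := Γ₀

section TropAura

variable (Γ₀ : Type u) [LinearOrderedCommGroupWithZero Γ₀]

instance : LinearOrder (TropAura Γ₀) := inferInstanceAs (LinearOrder Γ₀)

noncomputable instance : Semifield (TropAura Γ₀) :=
  semifieldOfAdd (G := Γ₀) max max_assoc max_comm (fun _ => max_eq_left zero_le) (fun a b c => by
    rcases le_total b c with h | h
    · rw [max_eq_right h, max_eq_right (mul_le_mul_right h a)]
    · rw [max_eq_left h, max_eq_left (mul_le_mul_right h a)])

theorem TropAura.add_eq_max (a b : TropAura Γ₀) : a + b = max a b := rfl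

instance : IsPosAura (TropAura Γ₀) where
  add_le_add' h k := max_le_max h k
  mul_le_mul' h k := mul_le_mul' (α := Γ₀) h k
  zero_lt_one' := zero_lt_one' Γ₀

theorem temperedGrowth_tropAura : TemperedGrowth (TropAura Γ₀) := by
  intro P _ x h
  have key : ∀ n : ℕ, ((n : ℕ) : TropAura Γ₀) ≤ 1 := by
    intro n
    induction n with
    | zero => rw [Nat.cast_zero]; exact (IsPosAura.zero_lt_one' (R := TropAura Γ₀)).le
    | succ n ih => rw [Nat.cast_succ, TropAura.add_eq_max]; exact max_le ih le_rfl
  have := (h 1).trans (key _)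
  rwa [pow_one] at this

end TropAura

/-- The place of a Krull valuation. -/
noncomputable def krullPlace {A : Type u} [CommRing A] {Γ₀ : Type u}
    [LinearOrderedCommGroupWithZero Γ₀] (v : Valuation A Γ₀) : SpehM A :=
  TMSeminorm.place
    { R := TropAura Γ₀
      tempered := temperedGrowth_tropAura Γ₀
      norm :=
        { toFun := v
          map_zero := v.map_zero
          map_one := v.map_one
          map_mul_le := fun a b => (v.map_mul a b).le
          map_add_le := fun a b => v.map_add a b }
      map_mul := fun a b => v.map_mul a b }

/-- The Krull valuation spectrum, as a subset of the multiplicative harmonious spectrum. -/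
def Spev (A : Type u) [CommRing A] : Set (SpehM A) :=
  {x | ∃ (Γ₀ : Type u) (_ : LinearOrderedCommGroupWithZero Γ₀) (v : Valuation A Γ₀),
    x = krullPlace v}

open Classical in
/-- The place `|.|_{𝔭,0}` of the seminorm which is `0` on the prime ideal `𝔭` and `1` elsewhere. -/
noncomputable def trivialPlace {A : Type} [CommRing A] (𝔭 : Ideal A) [𝔭.IsPrime] : SpehM A :=
  (krullPlace (1 : Valuation (A ⧸ 𝔭) (WithZero (Multiplicative ℤ)))).comap (Ideal.Quotient.mk 𝔭)

open Classical in
/-- The degree place `|P| = q ^ deg P`, `q > 1`, of `k[X]`. -/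
noncomputable def degreePlace (k : Type) [Field k] : SpehM k[X] :=
  krullPlace ((RatFunc.inftyValuation k).comap (algebraMap k[X] (RatFunc k)))

/-- The places of `k[X]` that are trivial modulo a prime ideal, `P`-adic for an irreducible
polynomial `P`, or given by the degree. -/
def trivialLine (k : Type) [Field k] : Set (SpehM k[X]) :=
  {x | (∃ (𝔭 : Ideal k[X]) (_ : 𝔭.IsPrime), x = trivialPlace 𝔭) ∨
    (∃ v : IsDedekindDomain.HeightOneSpectrum k[X], x = krullPlace v.intValuation) ∨
    x = degreePlace k}

/-! ### Infinitesimal neighbourhoods -/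

/-- Positive real numbers. -/
abbrev PosReal : Type := {r : ℝ // 0 < r}

/-- The lexicographic product of the tropical aura `R_{q^ℤ}` and of `ℝ₊`: its elements are `0` and
the pairs `(q ^ i, r)` with `i : ℤ` and `r > 0`, multiplied componentwise and ordered
lexicographically, so that `q`, which is `> 1`, is greater than every real number. -/
def LexAura : Type := WithZero (Multiplicative ℤ ×ₗ PosReal)

namespace LexAura

noncomputable instance : LinearOrderedCommGroupWithZero LexAura :=
  inferInstanceAs (LinearOrderedCommGroupWithZero (WithZero (Multiplicative ℤ ×ₗ PosReal)))

/-- The nonzero element `q ^ i * r`. -/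
noncomputable def mk (i : ℤ) (r : PosReal) : LexAura :=
  ((toLex (Multiplicative.ofAdd i, r) : Multiplicative ℤ ×ₗ PosReal) :
    WithZero (Multiplicative ℤ ×ₗ PosReal))

theorem mk_ne_zero (i : ℤ) (r : PosReal) : mk i r ≠ 0 := WithZero.coe_ne_zero

theorem cases (x : LexAura) : x = 0 ∨ ∃ i r, x = mk i r := by
  induction x using WithZero.recZeroCoe with
  | zero => exact Or.inl rfl
  | coe a => exact Or.inr ⟨Multiplicative.toAdd (ofLex a).1, (ofLex a).2, rfl⟩

theorem mk_le_mk {i j : ℤ} {r s : PosReal} : mk i r ≤ mk j s ↔ i < j ∨ i = j ∧ r ≤ s := by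
  refine WithZero.coe_le_coe.trans (Prod.Lex.toLex_le_toLex.trans ?_)
  simp

theorem mk_mul_mk (i j : ℤ) (r s : PosReal) : mk i r * mk j s = mk (i + j) (r * s) := rfl

theorem one_eq : (1 : LexAura) = mk 0 1 := rfl

theorem mk_inj {i j : ℤ} {r s : PosReal} : mk i r = mk j s ↔ i = j ∧ r = s := by
  constructor
  · intro h
    have h1 := mk_le_mk.mp h.le
    have h2 := mk_le_mk.mp h.ge
    rcases h1 with h1 | h1 <;> rcases h2 with h2 | h2
    · omega
    · omega
    · omega
    · exact ⟨h1.1, le_antisymm h1.2 h2.2⟩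
  · rintro ⟨rfl, rfl⟩; rfl

/-- Addition in the lexicographic product: `0` is neutral, the larger power of `q` wins, and
`(q ^ i, r) + (q ^ i, s) = (q ^ i, r + s)`. -/
noncomputable def add (x y : LexAura) : LexAura :=
  match (x : Option (Multiplicative ℤ ×ₗ PosReal)), (y : Option (Multiplicative ℤ ×ₗ PosReal)) with
  | none, _ => y
  | some _, none => x
  | some a, some b =>
    if (ofLex a).1 < (ofLex b).1 then y
    else if (ofLex b).1 < (ofLex a).1 then x
    else mk (Multiplicative.toAdd (ofLex a).1) ((ofLex a).2 + (ofLex b).2)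

theorem zero_add' (x : LexAura) : add 0 x = x := rfl

theorem add_zero' (x : LexAura) : add x 0 = x := by
  rcases cases x with rfl | ⟨i, r, rfl⟩ <;> rfl

theorem mk_add_mk (i j : ℤ) (r s : PosReal) : add (mk i r) (mk j s) =
    if i < j then mk j s else if j < i then mk i r else mk i (r + s) := rfl

noncomputable instance : Semifield LexAura :=
  semifieldOfAdd (G := LexAura) add
    (by
      intro a b c
      rcases cases a with rfl | ⟨i, r, rfl⟩
      · rfl
      rcases cases b with rfl | ⟨j, s, rfl⟩
      · rfl
      rcases cases c with rfl | ⟨k, t, rfl⟩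
      · rw [add_zero', add_zero']
      rcases lt_trichotomy i j with h | h | h <;> rcases lt_trichotomy j k with h' | h' | h' <;>
        rcases lt_trichotomy i k with h'' | h'' | h'' <;>
        first
          | omega
          | (subst_vars; simp [mk_add_mk, *, not_lt_of_gt, add_assoc]))
    (by
      intro a b
      rcases cases a with rfl | ⟨i, r, rfl⟩
      · rw [zero_add', add_zero']
      rcases cases b with rfl | ⟨j, s, rfl⟩
      · rw [zero_add', add_zero']
      rcases lt_trichotomy i j with h | h | h
      · simp [mk_add_mk, h, not_lt_of_gt h]
      · subst h; simp [mk_add_mk, add_comm]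
      · simp [mk_add_mk, h, not_lt_of_gt h])
    add_zero'
    (by
      intro a b c
      rcases cases a with rfl | ⟨i, r, rfl⟩
      · simp only [zero_mul]; rfl
      rcases cases b with rfl | ⟨j, s, rfl⟩
      · simp only [mul_zero, zero_add']
      rcases cases c with rfl | ⟨k, t, rfl⟩
      · simp only [mul_zero, add_zero']
      rcases lt_trichotomy j k with h | h | h
      · simp [mk_add_mk, mk_mul_mk, h]
      · subst h; simp [mk_add_mk, mk_mul_mk, mul_add]
      · simp [mk_add_mk, mk_mul_mk, h, not_lt_of_gt h])

theorem add_def (x y : LexAura) : x + y = add x y := rfl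

instance : IsPosAura LexAura where
  add_le_add' := by
    have key : ∀ x y z : LexAura, x ≤ z → x + y ≤ z + y := by
      intro x y z h
      simp only [add_def]
      rcases cases y with rfl | ⟨j, s, rfl⟩
      · rwa [add_zero', add_zero']
      rcases cases z with rfl | ⟨k, t, rfl⟩
      · rw [le_zero_iff.mp h]
      rcases cases x with rfl | ⟨i, r, rfl⟩
      · rw [zero_add', mk_add_mk]
        split_ifs with h1 h2
        · exact le_rfl
        · exact mk_le_mk.mpr (Or.inl h2)
        · exact mk_le_mk.mpr (Or.inr ⟨by omega, (lt_add_of_pos_left s.1 t.2).le⟩)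
      rcases mk_le_mk.mp h with h | ⟨rfl, h'⟩
      · rw [mk_add_mk, mk_add_mk]
        split_ifs <;> first
          | omega
          | exact le_rfl
          | exact mk_le_mk.mpr (Or.inl (by omega))
          | exact mk_le_mk.mpr (Or.inr ⟨by omega, (lt_add_of_pos_left s.1 t.2).le⟩)
      · rw [mk_add_mk, mk_add_mk]
        split_ifs
        · exact le_rfl
        · exact mk_le_mk.mpr (Or.inr ⟨rfl, h'⟩)
        · exact mk_le_mk.mpr (Or.inr ⟨rfl, add_le_add (α := ℝ) h' le_rfl⟩)
    intro x y z t h k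
    refine (key x y z h).trans ?_
    rw [add_comm z y, add_comm z t]
    exact key y z t k
  mul_le_mul' h k := mul_le_mul' h k
  zero_lt_one' := zero_lt_one' LexAura

theorem natCast_le (n : ℕ) : ((n : ℕ) : LexAura) ≤ mk 0 ⟨(n : ℝ) + 1, by positivity⟩ := by
  induction n with
  | zero => rw [Nat.cast_zero]; exact zero_le
  | succ n ih =>
    rw [Nat.cast_succ]
    refine (IsPosAura.add_le_add' ih (le_refl 1)).trans ?_
    rw [one_eq, add_def, mk_add_mk]
    simp only [lt_self_iff_false, if_false]
    refine mk_le_mk.mpr (Or.inr ⟨rfl, ?_⟩)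
    rw [← Subtype.coe_le_coe]
    simp

theorem mk_zero_pow (r : PosReal) (n : ℕ) : (mk 0 r) ^ n = mk 0 (r ^ n) := by
  induction n with
  | zero => rw [pow_zero, pow_zero]; rfl
  | succ n ih => rw [pow_succ, ih, mk_mul_mk, pow_succ]; rfl

theorem temperedGrowth : TemperedGrowth LexAura := by
  intro P _ x h
  rcases cases x with rfl | ⟨i, r, rfl⟩
  · exact zero_le
  have h1 := (h 1).trans (natCast_le _)
  rw [pow_one] at h1
  rw [one_eq]
  rcases mk_le_mk.mp h1 with h1 | ⟨rfl, -⟩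
  · exact mk_le_mk.mpr (Or.inl h1)
  refine mk_le_mk.mpr (Or.inr ⟨rfl, ?_⟩)
  refine le_one_of_pow_le_poly P (r : ℝ) (fun n => ?_)
  have h2 := (h n).trans (natCast_le _)
  rw [mk_zero_pow] at h2
  rcases mk_le_mk.mp h2 with h2 | ⟨-, h2⟩
  · omega
  · rw [← Subtype.coe_le_coe] at h2
    simpa using h2

/-- The element `q ^ i * |c|`, which is `0` if `c = 0`. -/
noncomputable def ofAbs {K : Type} [Field K] (abv : AbsoluteValue K ℝ) (i : ℤ) (c : K) : LexAura :=
  open Classical in if h : c = 0 then 0 else mk i ⟨abv c, abv.pos h⟩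

section ofAbs

variable {K : Type} [Field K] (abv : AbsoluteValue K ℝ)

theorem ofAbs_zero (i : ℤ) : ofAbs abv i 0 = 0 := dif_pos rfl

theorem ofAbs_of_ne {c : K} (i : ℤ) (h : c ≠ 0) : ofAbs abv i c = mk i ⟨abv c, abv.pos h⟩ :=
  dif_neg h

theorem ofAbs_mul (i j : ℤ) (c d : K) :
    ofAbs abv (i + j) (c * d) = ofAbs abv i c * ofAbs abv j d := by
  by_cases hc : c = 0
  · rw [hc, zero_mul, ofAbs_zero, ofAbs_zero, zero_mul]
  by_cases hd : d = 0
  · rw [hd, mul_zero, ofAbs_zero, ofAbs_zero, mul_zero]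
  rw [ofAbs_of_ne _ _ hc, ofAbs_of_ne _ _ hd, ofAbs_of_ne _ _ (mul_ne_zero hc hd), mk_mul_mk,
    mk_inj]
  exact ⟨rfl, Subtype.ext (abv.map_mul c d)⟩

/-- Subadditivity at the level of one coefficient. -/
theorem ofAbs_add_le (i : ℤ) (c d : K) :
    ofAbs abv i (c + d) ≤ ofAbs abv i c + ofAbs abv i d := by
  by_cases hc : c = 0
  · rw [hc, zero_add, ofAbs_zero, zero_add]
  by_cases hd : d = 0
  · rw [hd, add_zero, ofAbs_zero, add_zero]
  by_cases h : c + d = 0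
  · rw [h, ofAbs_zero]; exact zero_le
  rw [ofAbs_of_ne _ _ hc, ofAbs_of_ne _ _ hd, ofAbs_of_ne _ _ h, add_def, mk_add_mk]
  simp only [lt_self_iff_false, if_false]
  exact mk_le_mk.mpr (Or.inr ⟨rfl, abv.add_le c d⟩)

theorem ofAbs_le_of_lt {i j : ℤ} (h : i < j) (c : K) {d : K} (hd : d ≠ 0) :
    ofAbs abv i c ≤ ofAbs abv j d := by
  by_cases hc : c = 0
  · rw [hc, ofAbs_zero]; exact zero_le
  rw [ofAbs_of_ne _ _ hc, ofAbs_of_ne _ _ hd]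
  exact mk_le_mk.mpr (Or.inl h)

end ofAbs

end LexAura

open LexAura

section Infinitesimal

variable {K : Type} [Field K] (abv : AbsoluteValue K ℝ)

theorem coeff_le_trailing (f : K[X]) (n : ℕ) :
    ofAbs abv (-(n : ℤ)) (f.coeff n) ≤
      ofAbs abv (-(f.natTrailingDegree : ℤ)) f.trailingCoeff := by
  by_cases hf : f = 0
  · simp [hf, ofAbs_zero]
  rcases lt_trichotomy n f.natTrailingDegree with h | h | h
  · rw [coeff_eq_zero_of_lt_natTrailingDegree h, ofAbs_zero]; exact zero_le
  · rw [h]; exact le_rfl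
  · exact ofAbs_le_of_lt abv (by omega) _ (mt trailingCoeff_eq_zero.mp hf)

theorem coeff_le_leading (f : K[X]) (n : ℕ) :
    ofAbs abv (n : ℤ) (f.coeff n) ≤ ofAbs abv (f.natDegree : ℤ) f.leadingCoeff := by
  by_cases hf : f = 0
  · simp [hf, ofAbs_zero]
  rcases lt_trichotomy f.natDegree n with h | h | h
  · rw [coeff_eq_zero_of_natDegree_lt h, ofAbs_zero]; exact zero_le
  · rw [← h]; exact le_rfl
  · exact ofAbs_le_of_lt abv (by omega) _ (mt leadingCoeff_eq_zero.mp hf)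

/-- The infinitesimal neighbourhood of `0`: a nonzero `f = ∑ aᵢ X ^ i` is sent to
`max |aᵢ| ε ^ i = |aₘ| ε ^ m`, where `ε = q⁻¹` is smaller than every positive real number and `m` is
the smallest index with `aₘ ≠ 0`. -/
noncomputable def zeroNorm : TMSeminorm K[X] where
  R := LexAura
  tempered := temperedGrowth
  norm :=
    { toFun := fun f => ofAbs abv (-(f.natTrailingDegree : ℤ)) f.trailingCoeff
      map_zero := by simp [ofAbs_zero]
      map_one := by
        rw [← C_1, natTrailingDegree_C, trailingCoeff, natTrailingDegree_C, coeff_C_zero,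
          ofAbs_of_ne _ _ one_ne_zero, one_eq, mk_inj]
        exact ⟨by simp, Subtype.ext abv.map_one⟩
      map_mul_le := fun f g => by
        by_cases hf : f = 0
        · simp [hf, ofAbs_zero]
        by_cases hg : g = 0
        · simp [hg, ofAbs_zero]
        rw [natTrailingDegree_mul hf hg, trailingCoeff_mul, ← ofAbs_mul]
        push_cast
        rw [neg_add]
      map_add_le := fun f g => by
        refine le_trans ?_ (IsPosAura.add_le_add'
          (coeff_le_trailing abv f (f + g).natTrailingDegree)
          (coeff_le_trailing abv g (f + g).natTrailingDegree))
        rw [trailingCoeff, coeff_add]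
        exact ofAbs_add_le _ _ _ _ }
  map_mul f g := by
    by_cases hf : f = 0
    · simp [hf, ofAbs_zero]
    by_cases hg : g = 0
    · simp [hg, ofAbs_zero]
    simp only
    rw [natTrailingDegree_mul hf hg, trailingCoeff_mul, ← ofAbs_mul]
    push_cast
    rw [neg_add]

/-- The seminorm `|.|_{2,∞}`: a nonzero `f = ∑ aᵢ X ^ i` of degree `n` is sent to
`max |aᵢ| q ^ i = |aₙ| q ^ n`, where `q` is greater than every real number. -/
noncomputable def inftyNorm : TMSeminorm K[X] where
  R := LexAura
  tempered := temperedGrowth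
  norm :=
    { toFun := fun f => ofAbs abv (f.natDegree : ℤ) f.leadingCoeff
      map_zero := by simp [ofAbs_zero]
      map_one := by
        rw [← C_1, natDegree_C, leadingCoeff_C, ofAbs_of_ne _ _ one_ne_zero, one_eq, mk_inj]
        exact ⟨by simp, Subtype.ext abv.map_one⟩
      map_mul_le := fun f g => by
        by_cases hf : f = 0
        · simp [hf, ofAbs_zero]
        by_cases hg : g = 0
        · simp [hg, ofAbs_zero]
        rw [natDegree_mul hf hg, leadingCoeff_mul, ← ofAbs_mul]
        push_cast
        exact le_rfl
      map_add_le := fun f g => by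
        refine le_trans ?_ (IsPosAura.add_le_add'
          (coeff_le_leading abv f (f + g).natDegree)
          (coeff_le_leading abv g (f + g).natDegree))
        rw [leadingCoeff, coeff_add]
        exact ofAbs_add_le _ _ _ _ }
  map_mul f g := by
    by_cases hf : f = 0
    · simp [hf, ofAbs_zero]
    by_cases hg : g = 0
    · simp [hg, ofAbs_zero]
    simp only
    rw [natDegree_mul hf hg, leadingCoeff_mul, ← ofAbs_mul]
    push_cast
    rfl

/-- The place `|.|_{2,a}` of `K[X]`: if `f = ∑ aᵢ (X - a) ^ i` is nonzero and `m` is the smallest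
index with `aₘ ≠ 0`, then `|f| = |aₘ| ε ^ m` with `ε = |X - a|` smaller than `|γ|` for all `γ ≠ 0`
in `K`. For a non-archimedean `abv` this is the Huber-Knebusch point at `a` with major set `|K*|`. -/
noncomputable def infinitesimalPlace (a : K) : SpehM K[X] :=
  (zeroNorm abv).place.comap (taylorAlgHom a).toRingHom

/-- The place `|.|_{2,∞}` of `K[X]`; here `|X - a|` is greater than `|γ|` for all `a` and `γ` in `K`.
For a non-archimedean `abv` this is the Huber-Knebusch point with empty major set. -/
noncomputable def infinityPlace : SpehM K[X] := (inftyNorm abv).place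

end Infinitesimal

/-! ### Points of the affine line over `ℤ` -/

/-- Restriction of places along `ℤ → ℤ[T]`. -/
noncomputable def restrictInt : SpehM ℤ[X] → SpehM ℤ := SpehM.comap C

/-- Restriction of places along `ℤ[T] → K[T]`. -/
noncomputable def restrictLine (K : Type) [CommRing K] : SpehM K[X] → SpehM ℤ[X] :=
  SpehM.comap (mapRingHom (Int.castRingHom K))

/-- Places whose restriction to `ℤ` is the trivial norm. -/
def trivialPoints : Set (SpehM ℤ[X]) := {x | restrictInt x = trivialPlace (⊥ : Ideal ℤ)}

/-- Places whose restriction to `ℤ` has kernel `(p)`. -/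
def FpPoints (p : ℕ) : Set (SpehM ℤ[X]) :=
  {x | (restrictInt x).ker = (Ideal.span {(p : ℤ)} : Ideal ℤ)}

/-- Places whose restriction to `ℤ` is the `p`-adic norm. -/
def QpPoints (p : ℕ) [Fact p.Prime] : Set (SpehM ℤ[X]) :=
  {x | restrictInt x = (normPlace ℚ_[p]).comap (Int.castRingHom ℚ_[p])}

/-- Places whose restriction to `ℤ` is the usual archimedean norm. -/
def RPoints : Set (SpehM ℤ[X]) :=
  {x | restrictInt x = (normPlace ℝ).comap (Int.castRingHom ℝ)}

/-- The place `P ↦ |P(z)|` of `ℤ[T]`, for a complex number `z`. -/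
noncomputable def complexPoint (z : ℂ) : SpehM ℤ[X] :=
  (normPlace ℂ).comap (aeval z).toRingHom

/-- Absolute values of the algebraic closure of `ℚ` that extend the `p`-adic one. -/
def padicExtensions (p : ℕ) [Fact p.Prime] : Set (AbsoluteValue (AlgebraicClosure ℚ) ℝ) :=
  {w | ∀ r : ℚ, w (algebraMap ℚ (AlgebraicClosure ℚ) r) = padicNorm p r}

/-- Absolute values of the algebraic closure of `ℚ` induced by its embeddings into `ℂ`. -/
def complexAbsoluteValues : Set (AbsoluteValue (AlgebraicClosure ℚ) ℝ) :=
  {w | ∃ σ : AlgebraicClosure ℚ →+* ℂ, ∀ a, w a = ‖σ a‖}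

/-! ### Huber's adic affine line over `ℚ_p` -/

/-- The subring `ℤ_p[p ^ n T]` of `ℚ_p[T]`. -/
noncomputable def discRing (p : ℕ) [Fact p.Prime] (n : ℕ) : Subalgebra ℤ_[p] ℚ_[p][X] :=
  Algebra.adjoin ℤ_[p] {C ((p : ℚ_[p]) ^ n) * X}

/-- The points of the closed disc `|p ^ n T| ≤ 1`, that is, of `Spa` of the Huber pair
`(ℚ_p[T], ℤ_p[p ^ n T])` with ring of definition `ℤ_p[p ^ n T]` and ideal of definition `(p)`; this
pair has the completion `(ℚ_p⟨p ^ n T⟩, ℤ_p⟨p ^ n T⟩)`, hence the same adic spectrum. They are the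
Krull valuations `v` of `ℚ_p[T]` (up to equivalence) that are continuous, which means that for all
`v f / v g ≠ 0` in the value group `{h | v h < v f / v g}` is a neighbourhood of `0`, and are `≤ 1`
on `ℤ_p[p ^ n T]`. -/
def adicDisc (p : ℕ) [Fact p.Prime] (n : ℕ) : Set (SpehM ℚ_[p][X]) :=
  {x | ∃ (Γ₀ : Type) (_ : LinearOrderedCommGroupWithZero Γ₀) (v : Valuation ℚ_[p][X] Γ₀),
    x = krullPlace v ∧
    (∀ f g, v f ≠ 0 → v g ≠ 0 →
      ∃ k : ℕ, ∀ h ∈ discRing p n, v (C ((p : ℚ_[p]) ^ k) * h) < v f / v g) ∧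
    ∀ h ∈ discRing p n, v h ≤ 1}

/-- The points of Huber's adic affine line over `ℚ_p`: the increasing union of the closed discs. -/
def adicAffineLine (p : ℕ) [Fact p.Prime] : Set (SpehM ℚ_[p][X]) := ⋃ n, adicDisc p n

end Speh

namespace Speh

/-! ### Order properties of auras -/

section Aura

variable {R : Type u} [Semifield R] [LinearOrder R] [IsPosAura R]

/-! A place of a multiplicative seminorm is a total preorder on the ring
(`TMSeminorm.place_eq_iff`), and tempered growth lets one take `n`-th roots of inequalities that
hold up to a factor polynomial in `n` (`TemperedGrowth.le_of_pow_le`). With this tool Ostrowski's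
argument works over any aura. Either all integers have value at most 1, and the seminorm is
ultrametric and trivial, of kernel `(p)`, or `p`-adic on `ℤ`; or some integer has value greater than
1, and the natural numbers have their usual order.

Membership in the analytic spectrum is reduced to a condition on values. When some integer has a
value other than 0 and 1, testing the definition on `ℤ → A` shows that fractions of integers are
cofinal and coinitial among the values (`IsCofinal`, `isCofinal_of_mem_SpehA`). Conversely,
cofinality suffices because integers come from every ring `B`, and the completions exist: a
completed valued field in the ultrametric case, a closed subring of `ℂ` in the archimedean case.
Over the trivial norm and over `𝔽_p` the values have rank at most one, and powers of a single
element replace the integers.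

Over the trivial norm and over `𝔽_p` the seminorm extends to `k[X]` for `k = ℚ` or `𝔽_p` and is
trivial on `k`, so it is the degree valuation or is governed by the prime ideal of elements of value
less than 1.

In the archimedean case, if `X` is bounded by an integer, comparison with fractions of integers
produces a real multiplicative seminorm with `|n| = n`, hence, by Gelfand–Mazur, a morphism `g` to
`ℂ`. The seminorm is `|g(.)|` up to infinitesimals, and it is cofinal exactly when there are none. A
nonzero infinitesimal lies in the kernel of `g`, so `g X` is algebraic and its minimal polynomial is
a uniformizer; the order is then lexicographic and determined by `g`. If `X` exceeds all integers,
the leading term decides.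

In the `p`-adic case the valuation is extended to an algebraically closed field containing `ℚ̄`,
where its restriction to `ℚ̄` is a real absolute value. If cofinality fails with `X` bounded, some
polynomial is infinitely small; one of its linear factors `X - a` over `ℚ̄` is then infinitely
small, and the trailing Taylor coefficient at `a` decides. If cofinality holds, the completed
residue field contains `ℚ_p`, which gives a point of the adic line; it is unique because polynomials
over `ℚ_p` are approximated by integral ones. -/

theorem IsPosAura.zero_le (x : R) : 0 ≤ x := by
  simpa using IsPosAura.mul_le_mul' (IsPosAura.zero_lt_one' (R := R)).le (le_refl x)

theorem IsPosAura.mul_lt_mul_left {a b c : R} (ha : 0 < a) (h : b < c) : a * b < a * c := by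
  refine lt_of_not_ge fun h' => not_le_of_gt h ?_
  have := IsPosAura.mul_le_mul' (le_refl a⁻¹) h'
  rwa [inv_mul_cancel_left₀ ha.ne', inv_mul_cancel_left₀ ha.ne'] at this

/-- The multiplicative ordered structure of a positive totally ordered aura. -/
noncomputable instance (priority := 10) IsPosAura.linearOrderedCommGroupWithZero :
    LinearOrderedCommGroupWithZero R :=
  { (inferInstance : Semifield R), (inferInstance : LinearOrder R) with
    bot := 0
    bot_le := IsPosAura.zero_le
    isBot_zero := IsPosAura.zero_le
    mul_lt_mul_of_pos_left := fun _ ha _ _ h => IsPosAura.mul_lt_mul_left ha h }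

theorem IsPosAura.natCast_mono : Monotone (Nat.cast : ℕ → R) := by
  refine monotone_nat_of_le_succ fun n => ?_
  have := IsPosAura.add_le_add' (le_refl (n : R)) (IsPosAura.zero_le (1 : R))
  rwa [add_zero, ← Nat.cast_succ] at this

theorem IsPosAura.sum_le_sum {ι : Type*} (s : Finset ι) {f g : ι → R} (h : ∀ i ∈ s, f i ≤ g i) :
    ∑ i ∈ s, f i ≤ ∑ i ∈ s, g i := by
  classical
  induction s using Finset.induction_on with
  | empty => simp
  | insert a s ha ih =>
    rw [Finset.sum_insert ha, Finset.sum_insert ha]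
    exact IsPosAura.add_le_add' (h a (by simp)) (ih fun i hi => h i (by simp [hi]))

theorem IsPosAura.sum_le_card_mul {ι : Type*} (s : Finset ι) {f : ι → R} {y : R}
    (h : ∀ i ∈ s, f i ≤ y) : ∑ i ∈ s, f i ≤ (s.card : R) * y := by
  refine (IsPosAura.sum_le_sum s h).trans ?_
  rw [Finset.sum_const, nsmul_eq_mul]

/-- The homogeneous form in which tempered growth is used: a factor polynomial in the exponent
disappears on taking roots. -/
theorem TemperedGrowth.le_of_pow_le (hR : TemperedGrowth R) (P : ℕ[X]) {x y : R}
    (h : ∀ n : ℕ, x ^ n ≤ ((P.eval n : ℕ) : R) * y ^ n) : x ≤ y := by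
  rcases eq_or_ne y 0 with rfl | hy
  · simpa using h 1
  -- For `P = 0` the hypothesis at `n = 0` would read `1 ≤ 0`.
  have hP : P ≠ 0 := by
    rintro rfl
    have := h 0
    simp at this
  have := hR P hP (x / y) fun n => by
    rw [div_pow]
    exact (div_le_iff₀ (zero_lt_iff.mpr (pow_ne_zero _ hy))).mpr (h n)
  exact (div_le_one₀ (zero_lt_iff.mpr hy)).mp this

end Aura

/-! ### Multiplicative tempered seminorms as morphisms -/

namespace TMSeminorm

variable {A : Type u} [CommRing A] (v w : TMSeminorm A)

/-- The underlying morphism of multiplicative monoids with zero. -/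
def hom : A →*₀ v.R where
  toFun := v.norm.toFun
  map_zero' := v.norm.map_zero
  map_one' := v.norm.map_one
  map_mul' := v.map_mul

theorem hom_apply (a : A) : v.hom a = v.norm.toFun a := rfl

theorem hom_add_le (a b : A) : v.hom (a + b) ≤ v.hom a + v.hom b := v.norm.map_add_le a b

/-- The value of `-1` squares to 1, and the ordered group of nonzero values has no torsion. -/
theorem hom_neg (a : A) : v.hom (-a) = v.hom a := by
  have h : v.hom (-1) = 1 := by
    have : v.hom (-1) ^ 2 = 1 := by rw [← map_pow]; simp
    simpa using this
  rw [← neg_one_mul, _root_.map_mul, h, one_mul]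

theorem hom_natCast_le (n : ℕ) : v.hom n ≤ n := by
  induction n with
  | zero => simp
  | succ n ih =>
    rw [Nat.cast_succ, Nat.cast_succ]
    exact (v.hom_add_le _ _).trans (IsPosAura.add_le_add' ih (map_one _).le)

theorem hom_sum_le {ι : Type*} (s : Finset ι) (f : ι → A) :
    v.hom (∑ i ∈ s, f i) ≤ ∑ i ∈ s, v.hom (f i) := by
  classical
  induction s using Finset.induction_on with
  | empty => simp
  | insert a s ha ih =>
    rw [Finset.sum_insert ha, Finset.sum_insert ha]
    exact (v.hom_add_le _ _).trans (IsPosAura.add_le_add' le_rfl ih)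

theorem hom_intCast_natAbs (n : ℤ) : v.hom (n : A) = v.hom (n.natAbs : A) := by
  rcases n.natAbs_eq with h | h <;> conv_lhs => rw [h]
  · simp
  · rw [Int.cast_neg, hom_neg]; simp

/-- If `|n| ≤ 1` for all natural numbers `n`, then the seminorm is ultrametric. -/
theorem hom_add_le_max (h : ∀ n : ℕ, v.hom (n : A) ≤ 1) (a b : A) :
    v.hom (a + b) ≤ max (v.hom a) (v.hom b) := by
  -- The binomial expansion of `(a + b) ^ n` has `n + 1` terms, and each is at most `max ^ n`
  -- because binomial coefficients have value at most 1.
  refine v.tempered.le_of_pow_le (X + 1) fun n => ?_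
  rw [← map_pow, add_pow]
  refine (v.hom_sum_le _ _).trans ?_
  have := IsPosAura.sum_le_card_mul (Finset.range (n + 1))
    (f := fun m => v.hom (a ^ m * b ^ (n - m) * (n.choose m : A)))
    (y := max (v.hom a) (v.hom b) ^ n) fun m hm => by
      rw [_root_.map_mul, _root_.map_mul, map_pow, map_pow]
      have hm : m ≤ n := by simpa [Nat.lt_succ_iff] using hm
      calc v.hom a ^ m * v.hom b ^ (n - m) * v.hom (n.choose m : A)
          ≤ max (v.hom a) (v.hom b) ^ m * max (v.hom a) (v.hom b) ^ (n - m) * 1 :=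
            mul_le_mul' (mul_le_mul' (pow_le_pow_left' (le_max_left _ _) _)
              (pow_le_pow_left' (le_max_right _ _) _)) (h _)
        _ = _ := by rw [mul_one, ← pow_add, Nat.add_sub_cancel' hm]
  simpa using this

/-- Archimedean form of the triangle inequality: if `|a| / |c| ≤ |r / d|` and `|b| / |c| ≤ |s / d|`,
then `|a + b| / |c| ≤ |(r + s) / d|`. -/
theorem hom_add_mul_le (hmono : ∀ m n : ℕ, m ≤ n → v.hom (m : A) ≤ v.hom (n : A)) {a b c : A}
    {d r s : ℕ} (ha : v.hom a * v.hom (d : A) ≤ v.hom (r : A) * v.hom c)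
    (hb : v.hom b * v.hom (d : A) ≤ v.hom (s : A) * v.hom c) :
    v.hom (a + b) * v.hom (d : A) ≤ v.hom ((r + s : ℕ) : A) * v.hom c := by
  refine v.tempered.le_of_pow_le (X + 1) fun n => ?_
  rw [← _root_.map_mul, add_mul, ← map_pow, add_pow]
  rw [← _root_.map_mul] at ha hb
  refine (v.hom_sum_le _ _).trans ?_
  have := IsPosAura.sum_le_card_mul (Finset.range (n + 1))
    (f := fun m => v.hom ((a * d) ^ m * (b * d) ^ (n - m) * (n.choose m : A)))
    (y := (v.hom ((r + s : ℕ) : A) * v.hom c) ^ n) fun m hm => by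
      rw [_root_.map_mul, _root_.map_mul, map_pow, map_pow]
      have hm : m ≤ n := by simpa [Nat.lt_succ_iff] using hm
      calc v.hom (a * d) ^ m * v.hom (b * d) ^ (n - m) * v.hom (n.choose m : A)
          ≤ (v.hom (r : A) * v.hom c) ^ m * (v.hom (s : A) * v.hom c) ^ (n - m) *
              v.hom (n.choose m : A) :=
            mul_le_mul' (mul_le_mul' (pow_le_pow_left' ha _) (pow_le_pow_left' hb _)) le_rfl
        -- The binomial coefficient is kept inside the seminorm, so that the integers form one term
        -- of the expansion of `(r + s) ^ n`, which monotonicity bounds by the whole sum.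
        _ = v.hom ((r ^ m * s ^ (n - m) * n.choose m : ℕ) : A) * v.hom c ^ n := by
            conv_rhs => rw [← Nat.add_sub_cancel' hm, pow_add, Nat.add_sub_cancel' hm]
            push_cast
            simp only [_root_.map_mul, map_pow, mul_pow]
            ring
        _ ≤ v.hom (((r + s) ^ n : ℕ) : A) * v.hom c ^ n := by
            refine mul_le_mul' (hmono _ _ ?_) le_rfl
            rw [add_pow]
            exact Finset.single_le_sum (f := fun m => r ^ m * s ^ (n - m) * n.choose m)
              (fun _ _ => Nat.zero_le _) (Finset.mem_range.mpr (by omega))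
        _ = _ := by push_cast; rw [map_pow, mul_pow]
  simpa using this

/-- Multiplicativity absorbs the third element in the definition of multiplicative equivalence. All
later identifications of places go through this form. -/
theorem place_eq_iff : v.place = w.place ↔ ∀ a b, v.hom a ≤ v.hom b ↔ w.hom a ≤ w.hom b := by
  simp only [hom_apply]
  refine Quotient.eq.trans ⟨fun h a b => ⟨fun k => ?_, fun k => ?_⟩, fun h => ⟨?_, ?_⟩⟩
  · have := h.2 a b 1 (by simpa [v.norm.map_one] using k)
    simpa [w.norm.map_one] using this
  · have := h.1 a b 1 (by simpa [w.norm.map_one] using k)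
    simpa [v.norm.map_one] using this
  · intro a b c k
    rw [← v.map_mul]
    rw [← w.map_mul] at k
    exact (h _ _).mpr k
  · intro a b c k
    rw [← w.map_mul]
    rw [← v.map_mul] at k
    exact (h _ _).mp k

theorem exists_place (x : SpehM A) : ∃ v : TMSeminorm A, v.place = x := Quotient.exists_rep x

/-- The restriction of a seminorm along a ring morphism. -/
def comap {B : Type u} [CommRing B] (f : B →+* A) : TMSeminorm B where
  R := v.R
  tempered := v.tempered
  norm := v.norm.comp f
  map_mul := fun a b => by
    change v.norm.toFun (f (a * b)) = _
    rw [_root_.map_mul, v.map_mul]; rfl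

theorem comap_hom {B : Type u} [CommRing B] (f : B →+* A) (b : B) :
    (v.comap f).hom b = v.hom (f b) := rfl

theorem comap_hom_le {B : Type u} [CommRing B] (f : B →+* A) (a b : B) :
    (v.comap f).hom a ≤ (v.comap f).hom b ↔ v.hom (f a) ≤ v.hom (f b) := Iff.rfl

theorem mem_ker_place (a : A) : a ∈ v.place.ker ↔ v.hom a = 0 := Iff.rfl

/-- The Krull valuation given by an ultrametric multiplicative seminorm. -/
def toValuation (h : ∀ n : ℕ, v.hom (n : A) ≤ 1) : Valuation A v.R where
  __ := v.hom
  map_add_le_max' := v.hom_add_le_max h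

theorem toValuation_apply (h : ∀ n : ℕ, v.hom (n : A) ≤ 1) (a : A) :
    v.toValuation h a = v.hom a := rfl

end TMSeminorm

section Krull

variable {A : Type u} [CommRing A] {Γ₀ : Type u} [LinearOrderedCommGroupWithZero Γ₀]

/-- A Krull valuation as a tempered multiplicative seminorm. -/
noncomputable def krullSeminorm (v : Valuation A Γ₀) : TMSeminorm A where
  R := TropAura Γ₀
  tempered := temperedGrowth_tropAura Γ₀
  norm :=
    { toFun := v
      map_zero := v.map_zero
      map_one := v.map_one
      map_mul_le := fun a b => (v.map_mul a b).le
      map_add_le := fun a b => v.map_add a b }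
  map_mul := fun a b => v.map_mul a b

theorem TMSeminorm.place_eq_krullPlace_iff (w : TMSeminorm A) (v : Valuation A Γ₀) :
    w.place = krullPlace v ↔ ∀ a b, w.hom a ≤ w.hom b ↔ v a ≤ v b :=
  w.place_eq_iff (krullSeminorm v)

theorem krullPlace_eq_iff {Γ₁ : Type u} [LinearOrderedCommGroupWithZero Γ₁] (v : Valuation A Γ₀)
    (w : Valuation A Γ₁) : krullPlace v = krullPlace w ↔ ∀ a b, v a ≤ v b ↔ w a ≤ w b :=
  (krullSeminorm v).place_eq_iff (krullSeminorm w)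

theorem TMSeminorm.place_toValuation (v : TMSeminorm A) (h : ∀ n : ℕ, v.hom (n : A) ≤ 1) :
    v.place = krullPlace (v.toValuation h) :=
  (v.place_eq_krullPlace_iff _).mpr fun _ _ => Iff.rfl

end Krull

end Speh

namespace Speh

/-! ### Real valued seminorms and trivial seminorms -/

section RealSeminorm

variable {A : Type} [CommRing A]

/-- An `ℝ₊`-valued multiplicative seminorm as a tempered multiplicative seminorm. -/
noncomputable def realSeminorm (v : MulRingSeminorm A) : TMSeminorm A where
  R := NNReal
  tempered := temperedGrowth_nnreal
  norm :=
    { toFun := fun a => (v a).toNNReal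
      map_zero := by simp
      map_one := by simp
      map_mul_le := fun a b => by rw [map_mul, Real.toNNReal_mul (apply_nonneg v a)]
      map_add_le := fun a b => by
        rw [← Real.toNNReal_add (apply_nonneg v a) (apply_nonneg v b)]
        exact Real.toNNReal_le_toNNReal (map_add_le_add v a b) }
  map_mul := fun a b => by
    change (v (a * b)).toNNReal = (v a).toNNReal * (v b).toNNReal
    rw [_root_.map_mul, Real.toNNReal_mul (apply_nonneg v a)]

theorem realSeminorm_place (v : MulRingSeminorm A) : (realSeminorm v).place = realPlace v := rfl

theorem realSeminorm_hom_le (v : MulRingSeminorm A) (a b : A) :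
    (realSeminorm v).hom a ≤ (realSeminorm v).hom b ↔ v a ≤ v b :=
  Real.toNNReal_le_toNNReal_iff (apply_nonneg v b)

theorem TMSeminorm.place_eq_realPlace_iff (w : TMSeminorm A) (v : MulRingSeminorm A) :
    w.place = realPlace v ↔ ∀ a b, w.hom a ≤ w.hom b ↔ v a ≤ v b := by
  rw [← realSeminorm_place, TMSeminorm.place_eq_iff]
  simp only [realSeminorm_hom_le]

theorem TMSeminorm.place_eq_normPlace_comap_iff {K : Type} [NormedField K] (w : TMSeminorm A)
    (f : A →+* K) :
    w.place = (normPlace K).comap f ↔ ∀ a b, w.hom a ≤ w.hom b ↔ ‖f a‖ ≤ ‖f b‖ := by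
  refine (w.place_eq_iff ((realSeminorm _).comap f)).trans ?_
  simp only [TMSeminorm.comap_hom_le, realSeminorm_hom_le]
  rfl

open Classical in
theorem TMSeminorm.place_eq_trivialPlace_iff (w : TMSeminorm A) (𝔭 : Ideal A) [𝔭.IsPrime] :
    w.place = trivialPlace 𝔭 ↔ ∀ a b, w.hom a ≤ w.hom b ↔ (b ∈ 𝔭 → a ∈ 𝔭) := by
  refine (w.place_eq_krullPlace_iff
    ((1 : Valuation (A ⧸ 𝔭) (WithZero (Multiplicative ℤ))).comap (Ideal.Quotient.mk 𝔭))).trans ?_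
  refine forall₂_congr fun a b => iff_congr Iff.rfl ?_
  simp only [Valuation.comap_apply, Valuation.one_apply_def, Ideal.Quotient.eq_zero_iff_mem]
  by_cases ha : a ∈ 𝔭 <;> by_cases hb : b ∈ 𝔭 <;> simp [ha, hb]

end RealSeminorm

namespace TMSeminorm

variable {A : Type u} [CommRing A] (v : TMSeminorm A)

/-! ### Ostrowski's dichotomy -/

/-- In base `n` the number `N` has at most `L` digits, each of value at most `n`. The induction
splits off the last digit. -/
theorem hom_natCast_le_digits {n : ℕ} (hn : 2 ≤ n) (L N : ℕ) (hN : N < n ^ L) :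
    v.hom (N : A) ≤ ((L * n : ℕ) : v.R) * max 1 (v.hom (n : A)) ^ L := by
  induction L generalizing N with
  | zero =>
    obtain rfl : N = 0 := by simpa using hN
    simp
  | succ L ih =>
    have hq : N / n < n ^ L := by
      rw [Nat.div_lt_iff_lt_mul (by omega)]
      rwa [pow_succ] at hN
    have h1 : ((N : ℕ) : A) = (n : A) * ((N / n : ℕ) : A) + ((N % n : ℕ) : A) := by
      rw [← Nat.cast_mul, ← Nat.cast_add, Nat.div_add_mod]
    rw [h1]
    refine (v.hom_add_le _ _).trans ?_
    rw [_root_.map_mul]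
    have h2 := IsPosAura.mul_le_mul' (le_max_right 1 (v.hom (n : A))) (ih _ hq)
    have h3 : v.hom ((N % n : ℕ) : A) ≤ (n : v.R) * max 1 (v.hom (n : A)) ^ (L + 1) := by
      have h4 : v.hom ((N % n : ℕ) : A) ≤ (n : v.R) * 1 := by
        rw [mul_one]
        exact (v.hom_natCast_le _).trans (IsPosAura.natCast_mono (Nat.mod_lt _ (by omega)).le)
      exact h4.trans (mul_le_mul' le_rfl (one_le_pow_of_one_le' (le_max_left _ _) _))
    refine (IsPosAura.add_le_add' h2 h3).trans (le_of_eq ?_)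
    push_cast
    ring

/-- Ostrowski's comparison: `m ^ (a * k)` has at most `b * k + 1` digits in base `n`, so the digit
bound is polynomial in `k` up to the expected power, and tempered growth removes the polynomial. -/
theorem hom_natCast_pow_le {n : ℕ} (hn : 2 ≤ n) {m a b : ℕ} (h : m ^ a ≤ n ^ b) :
    v.hom (m : A) ^ a ≤ max 1 (v.hom (n : A)) ^ b := by
  -- The first two factors come from the digit bound with `L = b * k + 1`; the last one bounds the
  -- surplus factor `max 1 |n|` caused by the `+ 1`.
  refine v.tempered.le_of_pow_le ((C b * X + 1) * C n * C n) fun k => ?_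
  have h1 : (m ^ a) ^ k < n ^ (b * k + 1) := by
    refine (Nat.pow_le_pow_left h k).trans_lt ?_
    rw [← pow_mul]
    exact Nat.pow_lt_pow_right (by omega) (by omega)
  have h2 := v.hom_natCast_le_digits hn _ _ h1
  push_cast at h2
  rw [map_pow, map_pow, pow_succ] at h2
  have hM : max 1 (v.hom (n : A)) ≤ (n : v.R) :=
    max_le (by simpa using IsPosAura.natCast_mono (R := v.R) (show 1 ≤ n by omega))
      (v.hom_natCast_le n)
  refine (h2.trans (mul_le_mul' le_rfl (mul_le_mul' le_rfl hM))).trans (le_of_eq ?_)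
  simp only [eval_mul, eval_add, eval_C, eval_X, eval_one, ← pow_mul]
  push_cast
  ring

/-- If `|n| > 1` for some natural number `n`, then `|.|` orders the natural numbers as usual. -/
theorem hom_natCast_le_iff_of_one_lt {n₀ : ℕ} (h₀ : 1 < v.hom (n₀ : A)) (m n : ℕ) :
    v.hom (m : A) ≤ v.hom (n : A) ↔ m ≤ n := by
  -- Since `n₀ ≤ m ^ n₀`, a value of `m` at most 1 would force the same for `n₀`.
  have big : ∀ m : ℕ, 2 ≤ m → 1 < v.hom (m : A) := by
    intro m hm
    have h1 := v.hom_natCast_pow_le hm (m := n₀) (a := 1) (b := n₀)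
      (by rw [pow_one]; exact (Nat.lt_pow_self (by omega)).le)
    rw [pow_one] at h1
    by_contra! h2
    rw [max_eq_left h2, one_pow] at h1
    exact not_le_of_gt h₀ h1
  have mono : ∀ m n : ℕ, m ≤ n → v.hom (m : A) ≤ v.hom (n : A) := by
    intro m n h
    rcases Nat.lt_or_ge n 2 with hn | hn
    · interval_cases n <;> interval_cases m <;> simp
    have h1 := v.hom_natCast_pow_le hn (m := m) (a := 1) (b := 1) (by simpa using h)
    rwa [pow_one, pow_one, max_eq_right (big n hn).le] at h1
  refine ⟨fun h => ?_, mono m n⟩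
  by_contra! hlt
  rcases Nat.lt_or_ge n 2 with hn | hn
  · interval_cases n
    · have := mono 1 m (by omega)
      simp only [Nat.cast_zero, Nat.cast_one, map_zero, map_one] at this h
      exact not_le_of_gt zero_lt_one (this.trans h)
    · have := big m (by omega)
      simp only [Nat.cast_one, map_one] at h
      exact not_le_of_gt this h
  -- As `m / n > 1`, some power of it exceeds `n`. Then `|n| ^ (k + 1) ≤ |m| ^ k ≤ |n| ^ k`
  -- contradicts `1 < |n|`.
  obtain ⟨k, hk⟩ : ∃ k : ℕ, n ^ (k + 1) ≤ m ^ k := by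
    have hn0 : (0 : ℝ) < n := by positivity
    have h1 : (1 : ℝ) < (m : ℝ) / n := by
      rw [one_lt_div hn0]; exact_mod_cast hlt
    obtain ⟨k, hk⟩ := pow_unbounded_of_one_lt (n : ℝ) h1
    refine ⟨k, ?_⟩
    rw [div_pow, lt_div_iff₀ (by positivity)] at hk
    have : (n : ℝ) ^ (k + 1) ≤ (m : ℝ) ^ k := by rw [pow_succ, mul_comm]; exact hk.le
    exact_mod_cast this
  have h1 := v.hom_natCast_pow_le (show 2 ≤ m by omega) hk
  rw [max_eq_right (big m (by omega)).le] at h1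
  have h2 := h1.trans (pow_le_pow_left' h k)
  have h3 := big n hn
  have h4 : v.hom (n : A) ^ k * 1 < v.hom (n : A) ^ k * v.hom (n : A) :=
    mul_lt_mul_of_pos_left h3 (zero_lt_iff.mpr (pow_ne_zero _ (zero_lt_one.trans h3).ne'))
  rw [mul_one, ← pow_succ] at h4
  exact not_le_of_gt h4 h2

/-! ### Ultrametric seminorms restricted to the integers -/

/-- In a Bézout relation the term containing `p` has value less than 1; if `m` also did, so would 1.
-/
theorem hom_natCast_eq_one_of_coprime (h : ∀ n : ℕ, v.hom (n : A) ≤ 1) {p m : ℕ}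
    (hp : v.hom (p : A) < 1) (hm : m.Coprime p) : v.hom (m : A) = 1 := by
  refine le_antisymm (h m) ?_
  by_contra! hlt
  have hint : ∀ z : ℤ, v.hom (z : A) ≤ 1 := fun z => by rw [hom_intCast_natAbs]; exact h _
  have h1 : (1 : A) = (m : A) * (m.gcdA p : A) + (p : A) * (m.gcdB p : A) := by
    have := Nat.gcd_eq_gcd_ab m p
    rw [hm] at this
    have := congrArg (Int.cast : ℤ → A) this
    push_cast at this
    exact this
  have h2 := v.hom_add_le_max h ((m : A) * (m.gcdA p : A)) ((p : A) * (m.gcdB p : A))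
  rw [← h1, map_one, _root_.map_mul, _root_.map_mul] at h2
  have h3 : max (v.hom (m : A) * v.hom (m.gcdA p : A)) (v.hom (p : A) * v.hom (m.gcdB p : A)) < 1 :=
    max_lt ((mul_le_of_le_one_right' (hint _)).trans_lt hlt)
      ((mul_le_of_le_one_right' (hint _)).trans_lt hp)
  exact not_le_of_gt h3 h2

theorem exists_prime_hom_lt_one {n : ℕ} (hn : n ≠ 0) (h : v.hom (n : A) < 1) :
    ∃ p : ℕ, p.Prime ∧ v.hom (p : A) < 1 := by
  induction n using induction_on_primes with
  | zero => exact absurd rfl hn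
  | one => simp at h
  | prime_mul p a hp ih =>
    by_cases h1 : v.hom (p : A) < 1
    · exact ⟨p, hp, h1⟩
    · refine ih (by rintro rfl; simp at hn) (lt_of_le_of_lt ?_ h)
      rw [Nat.cast_mul, _root_.map_mul]
      exact le_mul_of_one_le_left' (not_lt.mp h1)

/-- The seminorm induces the `p`-adic valuation on the integers. -/
structure IsPadic (p : ℕ) : Prop where
  ne_zero : v.hom (p : A) ≠ 0
  lt_one : v.hom (p : A) < 1
  natCast_le_one : ∀ n : ℕ, v.hom (n : A) ≤ 1

/-- The seminorm induces the usual order on the natural numbers. -/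
def IsArch : Prop := ∀ m n : ℕ, v.hom (m : A) ≤ v.hom (n : A) ↔ m ≤ n

variable {v}

theorem IsPadic.hom_intCast {p : ℕ} [hp : Fact p.Prime] (h : v.IsPadic p) {n : ℤ} (hn : n ≠ 0) :
    v.hom (n : A) = v.hom (p : A) ^ padicValInt p n := by
  rw [hom_intCast_natAbs, padicValInt]
  have hn' : n.natAbs ≠ 0 := by simpa using hn
  obtain ⟨u, hu⟩ := (pow_padicValNat_dvd (p := p) (n := n.natAbs))
  have hu' : u.Coprime p := by
    refine (Nat.Coprime.symm ((Nat.Prime.coprime_iff_not_dvd hp.out).mpr fun hd => ?_))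
    refine pow_succ_padicValNat_not_dvd (p := p) hn' ?_
    obtain ⟨t, rfl⟩ := hd
    exact ⟨t, by rw [hu]; conv_rhs => rw [← hu]
                 ring⟩
  conv_lhs => rw [hu]
  rw [Nat.cast_mul, Nat.cast_pow, _root_.map_mul, map_pow,
    v.hom_natCast_eq_one_of_coprime h.natCast_le_one h.lt_one hu', mul_one]

theorem IsPadic.hom_intCast_le_iff {p : ℕ} [hp : Fact p.Prime] (h : v.IsPadic p) (m n : ℤ) :
    v.hom (m : A) ≤ v.hom (n : A) ↔ m = 0 ∨ n ≠ 0 ∧ padicValInt p n ≤ padicValInt p m := by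
  have hpos : ∀ {n : ℤ}, n ≠ 0 → v.hom (n : A) ≠ 0 := fun hn => by
    rw [h.hom_intCast hn]; exact pow_ne_zero _ h.ne_zero
  rcases eq_or_ne m 0 with rfl | hm
  · simp
  rcases eq_or_ne n 0 with rfl | hn
  · simp [hm, hpos hm]
  rw [h.hom_intCast hm, h.hom_intCast hn,
    pow_le_pow_iff_right_of_lt_one₀ (zero_lt_iff.mpr h.ne_zero) h.lt_one]
  simp [hm, hn]

theorem IsArch.hom_intCast_le_iff (h : v.IsArch) (m n : ℤ) :
    v.hom (m : A) ≤ v.hom (n : A) ↔ |m| ≤ |n| := by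
  rw [hom_intCast_natAbs, hom_intCast_natAbs _ n, h, Int.abs_eq_natAbs, Int.abs_eq_natAbs,
    Nat.cast_le]

end TMSeminorm

/-! ### Points of the affine line over `ℤ` -/

section Points

variable (v : TMSeminorm ℤ[X])

theorem comap_C_hom_le (m n : ℤ) : (v.comap (C : ℤ →+* ℤ[X])).hom m ≤ (v.comap C).hom n ↔
    v.hom (m : ℤ[X]) ≤ v.hom (n : ℤ[X]) := by
  rw [TMSeminorm.comap_hom_le, eq_intCast, eq_intCast]

theorem place_mem_trivialPoints_iff :
    v.place ∈ trivialPoints ↔ ∀ n : ℕ, n ≠ 0 → v.hom (n : ℤ[X]) = 1 := by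
  refine ((v.comap (C : ℤ →+* ℤ[X])).place_eq_trivialPlace_iff ⊥).trans ?_
  simp only [comap_C_hom_le, Ideal.mem_bot]
  constructor
  · intro h n hn
    refine le_antisymm ?_ ?_
    · simpa using h n 1
    · simpa [hn] using h 1 n
  · intro h a b
    rcases eq_or_ne a 0 with rfl | ha
    · simp
    have ha' : v.hom (a : ℤ[X]) = 1 := by
      rw [TMSeminorm.hom_intCast_natAbs]; exact h _ (by simpa using ha)
    rcases eq_or_ne b 0 with rfl | hb
    · simp [ha, ha']
    have hb' : v.hom (b : ℤ[X]) = 1 := by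
      rw [TMSeminorm.hom_intCast_natAbs]; exact h _ (by simpa using hb)
    simp [ha', hb', hb]

/-- The ideal `(p)` is maximal in `ℤ`, so a proper kernel that contains `p` equals it. -/
theorem place_mem_FpPoints_iff {p : ℕ} (hp : p.Prime) :
    v.place ∈ FpPoints p ↔ v.hom (p : ℤ[X]) = 0 := by
  have h0 : v.place ∈ FpPoints p ↔
      ∀ n : ℤ, v.hom (n : ℤ[X]) = 0 ↔ (p : ℤ) ∣ n := by
    refine Set.ext_iff.trans (forall_congr' fun n => iff_congr ?_ ?_)
    · exact (TMSeminorm.mem_ker_place (v.comap C) n).trans (by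
        rw [← eq_intCast (C : ℤ →+* ℤ[X])]; rfl)
    · exact Ideal.mem_span_singleton
  rw [h0]
  refine ⟨fun h => by simpa using h p, fun h n => ⟨fun hn => ?_, ?_⟩⟩
  · by_contra hd
    have hc : IsCoprime (p : ℤ) n :=
      (Prime.coprime_iff_not_dvd (Nat.prime_iff_prime_int.mp hp)).mpr hd
    obtain ⟨a, b, hab⟩ := hc
    have h1 : (1 : ℤ[X]) = (a : ℤ[X]) * (p : ℤ[X]) + (b : ℤ[X]) * (n : ℤ[X]) := by
      have := congrArg (Int.cast : ℤ → ℤ[X]) hab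
      push_cast at this
      exact this.symm
    have h2 := v.hom_add_le ((a : ℤ[X]) * (p : ℤ[X])) ((b : ℤ[X]) * (n : ℤ[X]))
    rw [← h1, map_one, _root_.map_mul, _root_.map_mul, h, hn] at h2
    simp at h2
  · rintro ⟨t, rfl⟩
    push_cast
    rw [_root_.map_mul, h, zero_mul]

theorem place_mem_QpPoints_iff {p : ℕ} [hp : Fact p.Prime] :
    v.place ∈ QpPoints p ↔ v.IsPadic p := by
  have key : ∀ m n : ℤ, ‖((m : ℤ) : ℚ_[p])‖ ≤ ‖((n : ℤ) : ℚ_[p])‖ ↔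
      m = 0 ∨ n ≠ 0 ∧ padicValInt p n ≤ padicValInt p m := by
    -- The norm of `ℚ_p` itself satisfies `IsPadic`, so its order on the integers is given by the
    -- same formula in terms of `padicValInt`.
    set w : TMSeminorm ℚ_[p] := realSeminorm (NormedField.toMulRingNorm ℚ_[p]).toMulRingSeminorm
    have hle : ∀ a b : ℚ_[p], w.hom a ≤ w.hom b ↔ ‖a‖ ≤ ‖b‖ := fun a b => realSeminorm_hom_le _ a b
    have hw : w.IsPadic p := by
      refine ⟨fun h => ?_, ?_, fun n => ?_⟩
      · have := (hle p 0).mp (by rw [h, map_zero])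
        simp [hp.out.ne_zero] at this
      · rw [← not_le, ← map_one w.hom, hle, norm_one, not_le]
        exact Padic.norm_p_lt_one
      · rw [← map_one w.hom, hle, norm_one]
        exact_mod_cast Padic.norm_int_le_one n
    intro m n
    rw [← hle, hw.hom_intCast_le_iff]
  have h0 : v.place ∈ QpPoints p ↔ ∀ m n : ℤ, v.hom (m : ℤ[X]) ≤ v.hom (n : ℤ[X]) ↔
      m = 0 ∨ n ≠ 0 ∧ padicValInt p n ≤ padicValInt p m := by
    refine ((v.comap (C : ℤ →+* ℤ[X])).place_eq_normPlace_comap_iff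
      (Int.castRingHom ℚ_[p])).trans ?_
    simp only [comap_C_hom_le, eq_intCast, key]
  rw [h0]
  refine ⟨fun h => ⟨fun h1 => ?_, ?_, fun n => ?_⟩, fun h => h.hom_intCast_le_iff⟩
  · have := (h p 0).mp (by simp [h1])
    simp [hp.out.ne_zero] at this
  · by_contra! h1
    have := (h 1 p).mp (by simpa using h1)
    simp [hp.out.ne_zero, padicValInt.self hp.out.one_lt] at this
  · simpa using (h n 1).mpr (by simp)

theorem place_mem_RPoints_iff : v.place ∈ RPoints ↔ v.IsArch := by
  have h0 : v.place ∈ RPoints ↔ ∀ m n : ℤ, v.hom (m : ℤ[X]) ≤ v.hom (n : ℤ[X]) ↔ |m| ≤ |n| := by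
    refine ((v.comap (C : ℤ →+* ℤ[X])).place_eq_normPlace_comap_iff (Int.castRingHom ℝ)).trans ?_
    simp only [comap_C_hom_le, eq_intCast, Real.norm_eq_abs, ← Int.cast_abs, Int.cast_le]
  rw [h0]
  exact ⟨fun h m n => by simpa using h m n, fun h => h.hom_intCast_le_iff⟩

theorem mem_trivial_or_Fp_or_Qp_or_R (x : SpehM ℤ[X]) :
    x ∈ trivialPoints ∨ (∃ p : ℕ, p.Prime ∧ x ∈ FpPoints p) ∨
      (∃ (p : ℕ) (_ : Fact p.Prime), x ∈ QpPoints p) ∨ x ∈ RPoints := by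
  obtain ⟨v, rfl⟩ := TMSeminorm.exists_place x
  by_cases h : ∀ n : ℕ, v.hom (n : ℤ[X]) ≤ 1
  · by_cases h1 : ∀ n : ℕ, n ≠ 0 → v.hom (n : ℤ[X]) = 1
    · exact Or.inl ((place_mem_trivialPoints_iff v).mpr h1)
    push Not at h1
    obtain ⟨n, hn, hn1⟩ := h1
    obtain ⟨p, hp, hp1⟩ := v.exists_prime_hom_lt_one hn (lt_of_le_of_ne (h n) hn1)
    by_cases hp0 : v.hom (p : ℤ[X]) = 0
    · exact Or.inr (Or.inl ⟨p, hp, (place_mem_FpPoints_iff v hp).mpr hp0⟩)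
    · have := Fact.mk hp
      exact Or.inr (Or.inr (Or.inl ⟨p, this, (place_mem_QpPoints_iff v).mpr ⟨hp0, hp1, h⟩⟩))
  · push Not at h
    obtain ⟨n, hn⟩ := h
    exact Or.inr (Or.inr (Or.inr ((place_mem_RPoints_iff v).mpr
      fun a b => v.hom_natCast_le_iff_of_one_lt hn a b)))

end Points

end Speh

namespace Speh

/-! ### Extension to the localization -/

namespace TMSeminorm

variable {A : Type u} [CommRing A] (v : TMSeminorm A)

theorem mem_multElts {a : A} : a ∈ v.norm.multElts ↔ v.hom a ≠ 0 :=
  ⟨fun h => h.1.ne_zero, fun h => ⟨isUnit_iff_ne_zero.mpr h, v.map_mul a⟩⟩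

theorem hom_multElts_ne_zero (s : v.norm.multElts) : v.hom s ≠ 0 := v.mem_multElts.mp s.2

theorem locNorm_mk (a : A) (s : v.norm.multElts) :
    v.norm.locNorm (Localization.mk a s) = v.hom a / v.hom s := rfl

/-- The extension of a multiplicative seminorm to the localization at its multiplicative
elements. -/
noncomputable def loc : TMSeminorm (Localization v.norm.multElts) where
  R := v.R
  tempered := v.tempered
  norm :=
    { toFun := v.norm.locNorm
      map_zero := by
        rw [← Localization.mk_zero 1, locNorm_mk, map_zero, zero_div]
      map_one := by
        rw [← Localization.mk_one, locNorm_mk, map_one, OneMemClass.coe_one, map_one, div_one]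
      map_mul_le := fun x y => by
        induction x using Localization.induction_on with | _ x
        induction y using Localization.induction_on with | _ y
        rw [Localization.mk_mul, locNorm_mk, locNorm_mk, locNorm_mk, _root_.map_mul,
          Submonoid.coe_mul, _root_.map_mul, div_mul_div_comm]
      map_add_le := fun x y => by
        induction x using Localization.induction_on with | _ x
        induction y using Localization.induction_on with | _ y
        obtain ⟨a, s⟩ := x
        obtain ⟨b, t⟩ := y
        have hs := v.hom_multElts_ne_zero s
        have ht := v.hom_multElts_ne_zero t
        rw [Localization.add_mk, locNorm_mk, locNorm_mk, locNorm_mk, Submonoid.coe_mul,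
          _root_.map_mul, div_add_div _ _ hs ht]
        refine (div_le_div_of_nonneg_right (v.hom_add_le _ _) (IsPosAura.zero_le _)).trans
          (le_of_eq ?_)
        congr 1
        rw [_root_.map_mul, _root_.map_mul]
        ring }
  map_mul := fun x y => by
    induction x using Localization.induction_on with | _ x
    induction y using Localization.induction_on with | _ y
    simp only
    rw [Localization.mk_mul, locNorm_mk, locNorm_mk, locNorm_mk, _root_.map_mul,
          Submonoid.coe_mul, _root_.map_mul, div_mul_div_comm]

theorem loc_hom_mk (a : A) (s : v.norm.multElts) :
    v.loc.hom (Localization.mk a s) = v.hom a / v.hom s := rfl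

theorem loc_isUnit {x : Localization v.norm.multElts} (hx : v.loc.hom x ≠ 0) : IsUnit x := by
  induction x using Localization.induction_on with | _ x
  obtain ⟨a, s⟩ := x
  have ha : v.hom a ≠ 0 := fun h => hx (by rw [loc_hom_mk, h]; exact zero_div _)
  rw [isUnit_iff_exists_inv]
  refine ⟨Localization.mk s ⟨a, v.mem_multElts.mpr ha⟩, ?_⟩
  rw [Localization.mk_mul, ← Localization.mk_one, Localization.mk_eq_mk_iff,
    Localization.r_iff_exists]
  exact ⟨1, by simp [mul_comm]⟩

theorem mem_ball_zero {a x : A} : x ∈ ball v.norm.toFun 0 a ↔ v.hom x < v.hom a := by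
  change v.hom (x - 0) < v.hom a ↔ _
  rw [sub_zero]

/-- Balls are tiny as soon as each ball contains the sum of a smaller ball with itself. -/
theorem tinyBalls (hu : ∀ a, v.hom a ≠ 0 → IsUnit a)
    (h : ∀ a, 0 < v.hom a → ∃ a', 0 < v.hom a' ∧
      ∀ x y, v.hom x < v.hom a' → v.hom y < v.hom a' → v.hom (x + y) < v.hom a) :
    TinyBalls v.norm.toFun where
  add a ha := by
    obtain ⟨a', h1, h2⟩ := h a ha
    refine ⟨a', h1, fun x hx y hy => ?_⟩
    rw [mem_ball_zero] at *
    exact h2 x y hx hy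
  smul a ha x := by
    by_cases hx : v.hom x = 0
    · refine ⟨a, ha, fun y _ => ?_⟩
      rw [mem_ball_zero, _root_.map_mul, hx, zero_mul]
      exact ha
    · obtain ⟨u, rfl⟩ := hu x hx
      have h1 : v.hom (u : A) * v.hom (↑u⁻¹ * a) = v.hom a := by
        rw [← _root_.map_mul, Units.mul_inv_cancel_left]
      refine ⟨↑u⁻¹ * a, zero_lt_iff.mpr fun h0 => ha.ne' ?_, fun y hy => ?_⟩
      · change v.hom (↑u⁻¹ * a) = 0 at h0
        change v.hom a = 0
        rw [← h1, h0, mul_zero]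
      · rw [mem_ball_zero] at *
        rw [_root_.map_mul, ← h1]
        exact mul_lt_mul_of_pos_left hy (zero_lt_iff.mpr hx)
  mul a ha := by
    by_cases h1 : v.hom a < 1
    · refine ⟨a, ha, fun x hx y hy => ?_⟩
      rw [mem_ball_zero] at *
      rw [_root_.map_mul]
      exact (mul_le_of_le_one_right' (hy.trans h1).le).trans_lt hx
    · refine ⟨1, by rw [v.norm.map_one]; exact IsPosAura.zero_lt_one', fun x hx y hy => ?_⟩
      rw [mem_ball_zero] at *
      rw [map_one] at hx hy
      rw [_root_.map_mul]
      exact ((mul_le_of_le_one_right' hy.le).trans_lt hx).trans_le (not_lt.mp h1)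
  neg a ha := ⟨a, ha, fun x hx => by
    rw [mem_ball_zero] at *
    rwa [hom_neg]⟩

theorem tinyBalls_of_ultrametric (h : ∀ n : ℕ, v.hom (n : A) ≤ 1)
    (hu : ∀ a, v.hom a ≠ 0 → IsUnit a) : TinyBalls v.norm.toFun :=
  v.tinyBalls hu fun a ha =>
    ⟨a, ha, fun x y hx hy => (v.hom_add_le_max h x y).trans_lt (max_lt hx hy)⟩

end TMSeminorm

/-! ### Extension of Krull valuations to the completion -/

/-- Every radius in the value group of the field is the value of an element, so neighbourhoods can
be tested on balls whose radii are values, as in `IsSepCompletion`. -/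
theorem valued_mem_nhds_zero_iff {K Γ₀ : Type*} [Field K] [LinearOrderedCommGroupWithZero Γ₀]
    [Valued K Γ₀] (s : Set K) :
    s ∈ 𝓝 (0 : K) ↔ ∃ y : K, (Valued.v y : Γ₀) ≠ 0 ∧ {x | (Valued.v x : Γ₀) < Valued.v y} ⊆ s := by
  rw [Valued.mem_nhds_zero]
  constructor
  · rintro ⟨γ, h⟩
    obtain ⟨y, hy⟩ := MonoidWithZeroHom.ValueGroup₀.restrict₀_surjective (.ofClass (Valued.v : Valuation K Γ₀)) γ.1
    rw [← Valuation.restrict_def] at hy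
    refine ⟨y, fun h0 => γ.ne_zero ?_, fun x hx => h ?_⟩
    · rw [← hy, Valuation.restrict_eq_zero_iff, h0]
    · rw [Set.mem_ofPred_eq, ← hy, Valuation.restrict_lt_iff]
      exact hx
  · rintro ⟨y, hy, h⟩
    refine ⟨Units.mk0 (Valued.v.restrict y) (by rwa [Ne, Valuation.restrict_eq_zero_iff]),
      fun x hx => h ?_⟩
    rw [Set.mem_ofPred_eq, Units.val_mk0, Valuation.restrict_lt_iff] at hx
    exact hx

namespace TMSeminorm

variable {A : Type u} [CommRing A] (v : TMSeminorm A)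

/-- Elements of nonzero value are units, so the support is a maximal ideal. The separated completion
of `A` is the completion of the valued field `A / supp`, to which the valuation extends. -/
theorem extendsToCompletion_of_ultrametric (h : ∀ n : ℕ, v.hom (n : A) ≤ 1)
    (hu : ∀ a, v.hom a ≠ 0 → IsUnit a) : ExtendsToCompletion v.norm.toFun := by
  set N : Valuation A v.R := v.toValuation h with hN
  have hmax : N.supp.IsMaximal := by
    refine Ideal.isMaximal_iff.mpr ⟨fun h1 => ?_, fun J x _ hx hxJ => ?_⟩
    · rw [Valuation.mem_supp_iff, map_one] at h1
      exact one_ne_zero h1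
    · rw [Valuation.mem_supp_iff] at hx
      rw [← Ideal.eq_top_iff_one]
      exact Ideal.eq_top_of_isUnit_mem _ hxJ (hu x hx)
  let _ : Field (A ⧸ N.supp) := Ideal.Quotient.field N.supp
  let _ : Valued (A ⧸ N.supp) v.R := Valued.mk' (N.onQuot le_rfl)
  have hv : ∀ a : A, (Valued.v (Ideal.Quotient.mk N.supp a) : v.R) = v.hom a := fun a => rfl
  -- Only multiplicative equivalence is at stake, so the addition of `v.R` may be replaced by `max`.
  refine ⟨UniformSpace.Completion (A ⧸ N.supp), inferInstance, inferInstance, inferInstance,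
    inferInstance, UniformSpace.Completion.coeRingHom.comp (Ideal.Quotient.mk N.supp),
    ⟨inferInstance, inferInstance, ?_, ?_⟩, TropAura v.R, inferInstance, inferInstance,
    inferInstance, (krullSeminorm Valued.extensionValuation).norm, ?_⟩
  · exact UniformSpace.Completion.denseRange_coe.comp Ideal.Quotient.mk_surjective.denseRange
      (UniformSpace.Completion.continuous_coe _)
  · intro s
    have h0 : (𝓝 (0 : UniformSpace.Completion (A ⧸ N.supp))).comap
        (UniformSpace.Completion.coeRingHom.comp (Ideal.Quotient.mk N.supp)) =
        (𝓝 (0 : A ⧸ N.supp)).comap (Ideal.Quotient.mk N.supp) := by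
      have := (UniformSpace.Completion.isUniformInducing_coe
        (A ⧸ N.supp)).isInducing.nhds_eq_comap 0
      rw [this, Filter.comap_comap]
      rfl
    rw [h0, Filter.mem_comap]
    constructor
    · rintro ⟨t, ht, hts⟩
      obtain ⟨y, hy, hyt⟩ := (valued_mem_nhds_zero_iff t).mp ht
      obtain ⟨a, rfl⟩ := Ideal.Quotient.mk_surjective y
      refine ⟨a, zero_lt_iff.mpr hy, fun x hx => hts (hyt ?_)⟩
      exact v.mem_ball_zero.mp hx
    · rintro ⟨a, ha, has⟩
      refine ⟨{x | (Valued.v x : v.R) < Valued.v (Ideal.Quotient.mk N.supp a)},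
        (valued_mem_nhds_zero_iff _).mpr ⟨_, ha.ne', subset_rfl⟩, fun x hx => has ?_⟩
      exact v.mem_ball_zero.mpr hx
  · have key : ∀ a : A, (krullSeminorm Valued.extensionValuation).norm.toFun
        (UniformSpace.Completion.coeRingHom (Ideal.Quotient.mk N.supp a)) = v.norm.toFun a :=
      fun a => Valued.extensionValuation_apply_coe (Ideal.Quotient.mk N.supp a)
    exact ⟨fun a b c => by simp only [RingHom.comp_apply, key]; exact id,
      fun a b c => by simp only [RingHom.comp_apply, key]; exact id⟩

end TMSeminorm
end Speh

namespace Speh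

namespace TMSeminorm

theorem mem_ball_locNorm {A : Type u} [CommRing A] (v : TMSeminorm A)
    {a x : Localization v.norm.multElts} :
    x ∈ ball v.norm.locNorm 0 a ↔ v.loc.hom x < v.loc.hom a := v.loc.mem_ball_zero

/-! ### A criterion for points of the analytic spectrum -/

/-- For a multiplicative seminorm the multiplicative elements are those of nonzero value, so
compatibility with `f` is automatic, and the comparison of balls can be stated with numerators and
denominators. -/
theorem hasFunctorialMultCompletion {A : Type u} [CommRing A] (v : TMSeminorm A)
    (h1 : ∀ (B : Type u) [CommRing B] (f : B →+* A),
      TinyBalls (v.comap f).loc.norm.toFun ∧ ExtendsToCompletion (v.comap f).loc.norm.toFun)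
    (h2 : ∀ (B : Type u) [CommRing B] (f : B →+* A) (a s : A), v.hom a ≠ 0 → v.hom s ≠ 0 →
      ∃ b t : B, v.hom (f b) ≠ 0 ∧ v.hom (f t) ≠ 0 ∧ ∀ c u : B, v.hom (f u) ≠ 0 →
        v.hom (f c) / v.hom (f u) < v.hom (f b) / v.hom (f t) →
        v.hom (f c) / v.hom (f u) < v.hom a / v.hom s) :
    HasFunctorialMultCompletion v.norm := by
  intro B _ f
  have hle : (v.norm.comp f).multElts ≤ v.norm.multElts.comap f := fun b hb =>
    v.mem_multElts.mpr ((v.comap f).mem_multElts.mp hb)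
  refine ⟨hle, h1 B f, fun a ha => ?_⟩
  induction a using Localization.induction_on with | _ a
  obtain ⟨a, s⟩ := a
  have hs := v.hom_multElts_ne_zero s
  have ha' : v.hom a ≠ 0 := fun h0 => ha.ne' (by
    change v.hom a / v.hom s = 0
    rw [h0, zero_div])
  obtain ⟨b, t, hb, ht, h⟩ := h2 B f a s ha' hs
  refine ⟨Localization.mk b ⟨t, (v.comap f).mem_multElts.mpr ht⟩,
    zero_lt_iff.mpr (div_ne_zero hb ht), fun x hx => ?_⟩
  induction x using Localization.induction_on with | _ x
  obtain ⟨c, u⟩ := x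
  have hx' : v.hom (f c) / v.hom (f u) < v.hom (f b) / v.hom (f t) :=
    (v.comap f).loc.mem_ball_zero.mp hx
  have hu := (v.comap f).hom_multElts_ne_zero u
  rw [Set.mem_preimage, mem_ball_locNorm, Localization.mk_eq_mk', IsLocalization.map_mk', ← Localization.mk_eq_mk']
  exact h c u hu hx'

/-- The values of the integers are cofinal and coinitial in the values of the fractions. -/
def IsCofinal {A : Type u} [CommRing A] (v : TMSeminorm A) : Prop :=
  ∀ a, v.hom a ≠ 0 →
    (∃ n m : ℤ, v.hom (n : A) ≠ 0 ∧ v.hom (n : A) * v.hom a ≤ v.hom (m : A)) ∧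
    (∃ n m : ℤ, v.hom (n : A) ≠ 0 ∧ v.hom (n : A) ≤ v.hom (m : A) * v.hom a)

theorem IsCofinal.congr {A : Type u} [CommRing A] {v w : TMSeminorm A} (h : v.place = w.place)
    (hv : v.IsCofinal) : w.IsCofinal := by
  rw [place_eq_iff] at h
  have h0 : ∀ a, v.hom a = 0 ↔ w.hom a = 0 := fun a => by
    have := h a 0
    rwa [map_zero, map_zero, le_zero_iff, le_zero_iff] at this
  intro a ha
  have := hv a (by rwa [Ne, h0])
  simpa only [← _root_.map_mul, h, h0, Ne] using this

/-- Every ring `B` contains the images of the integers, so a fraction of integers not exceeding `|a|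
/ |s|` serves as radius whatever `B` is. It is the product of a lower bound for `|a|` and one for `1
/ |s|`. -/
theorem IsCofinal.exists_ball {A : Type u} [CommRing A] {v : TMSeminorm A} (hv : v.IsCofinal)
    (B : Type u) [CommRing B] (f : B →+* A) (a s : A) (ha : v.hom a ≠ 0) (hs : v.hom s ≠ 0) :
    ∃ b t : B, v.hom (f b) ≠ 0 ∧ v.hom (f t) ≠ 0 ∧ ∀ c u : B, v.hom (f u) ≠ 0 →
        v.hom (f c) / v.hom (f u) < v.hom (f b) / v.hom (f t) →
        v.hom (f c) / v.hom (f u) < v.hom a / v.hom s := by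
  obtain ⟨n₁, m₁, hn₁, h₁⟩ := (hv a ha).2
  obtain ⟨n₂, m₂, hn₂, h₂⟩ := (hv s hs).1
  have hm₁ : v.hom (m₁ : A) ≠ 0 := fun h0 => hn₁ (by simpa [h0] using h₁)
  have hm₂ : v.hom (m₂ : A) ≠ 0 := fun h0 => by
    rw [h0, le_zero_iff] at h₂
    exact mul_ne_zero hn₂ hs h₂
  refine ⟨(n₁ * n₂ : ℤ), (m₁ * m₂ : ℤ), ?_, ?_, fun c u _ h => h.trans_le ?_⟩
  · rw [map_intCast, Int.cast_mul, _root_.map_mul]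
    exact mul_ne_zero hn₁ hn₂
  · rw [map_intCast, Int.cast_mul, _root_.map_mul]
    exact mul_ne_zero hm₁ hm₂
  · rw [map_intCast f, map_intCast f, Int.cast_mul, Int.cast_mul, _root_.map_mul, _root_.map_mul,
      div_le_div_iff₀ (zero_lt_iff.mpr (mul_ne_zero hm₁ hm₂)) (zero_lt_iff.mpr hs)]
    calc v.hom (n₁ : A) * v.hom (n₂ : A) * v.hom s
        = v.hom (n₁ : A) * (v.hom (n₂ : A) * v.hom s) := mul_assoc _ _ _
      _ ≤ (v.hom (m₁ : A) * v.hom a) * v.hom (m₂ : A) := mul_le_mul' h₁ h₂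
      _ = _ := by ring

theorem loc_natCast_le_one {A : Type u} [CommRing A] {v : TMSeminorm A}
    (h : ∀ n : ℕ, v.hom (n : A) ≤ 1) (n : ℕ) : v.loc.hom n ≤ 1 := by
  have : (n : Localization v.norm.multElts) = Localization.mk (n : A) 1 := by
    rw [Localization.mk_one_eq_algebraMap, map_natCast]
  rw [this, loc_hom_mk, OneMemClass.coe_one, map_one, div_one]
  exact h n

theorem tinyBalls_extends_of_ultrametric {A : Type u} [CommRing A] {v : TMSeminorm A}
    (h : ∀ n : ℕ, v.hom (n : A) ≤ 1) (B : Type u) [CommRing B] (f : B →+* A) :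
    TinyBalls (v.comap f).loc.norm.toFun ∧ ExtendsToCompletion (v.comap f).loc.norm.toFun := by
  have h' : ∀ n : ℕ, (v.comap f).hom (n : B) ≤ 1 := fun n => by
    rw [comap_hom, map_natCast]; exact h n
  exact ⟨tinyBalls_of_ultrametric _ (loc_natCast_le_one h') fun a ha => loc_isUnit _ ha,
    extendsToCompletion_of_ultrametric _ (loc_natCast_le_one h') fun a ha => loc_isUnit _ ha⟩

theorem mem_SpehA_of_isCofinal {A : Type u} [CommRing A] {v : TMSeminorm A}
    (h : ∀ n : ℕ, v.hom (n : A) ≤ 1) (hc : v.IsCofinal) : v.place ∈ SpehA A :=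
  ⟨v, rfl, v.hasFunctorialMultCompletion (tinyBalls_extends_of_ultrametric h)
    fun B _ f => hc.exists_ball B f⟩

/-- The hypothesis `ha` says that the values have rank at most one: as soon as `|f(.)|` takes a
value other than 0 and 1 on `B`, its powers or those of its inverse supply arbitrarily small radii.
-/
theorem mem_SpehA_of_archimedean {A : Type u} [CommRing A] {v : TMSeminorm A}
    (h : ∀ n : ℕ, v.hom (n : A) ≤ 1)
    (ha : ∀ x y : v.R, x ≠ 0 → y < 1 → ∃ n : ℕ, y ^ n < x) : v.place ∈ SpehA A := by
  refine ⟨v, rfl, v.hasFunctorialMultCompletion (tinyBalls_extends_of_ultrametric h)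
    fun B _ f a s hva hvs => ?_⟩
  have key : ∀ b t : B, v.hom (f b) ≠ 0 → v.hom (f t) ≠ 0 → v.hom (f b) < v.hom (f t) →
      ∃ b t : B, v.hom (f b) ≠ 0 ∧ v.hom (f t) ≠ 0 ∧ ∀ c u : B, v.hom (f u) ≠ 0 →
        v.hom (f c) / v.hom (f u) < v.hom (f b) / v.hom (f t) →
        v.hom (f c) / v.hom (f u) < v.hom a / v.hom s := by
    intro b t hb ht hbt
    obtain ⟨n, hn⟩ := ha (v.hom a / v.hom s) (v.hom (f b) / v.hom (f t)) (div_ne_zero hva hvs)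
      ((div_lt_one₀ (zero_lt_iff.mpr ht)).mpr hbt)
    refine ⟨b ^ n, t ^ n, ?_, ?_, fun c u _ hcu => hcu.trans ?_⟩
    · rw [map_pow, map_pow]; exact pow_ne_zero _ hb
    · rw [map_pow, map_pow]; exact pow_ne_zero _ ht
    · rwa [map_pow, map_pow, map_pow, map_pow, ← div_pow]
  by_cases hB : ∃ b : B, v.hom (f b) ≠ 0 ∧ v.hom (f b) ≠ 1
  · obtain ⟨b, hb, hb1⟩ := hB
    have h1 : v.hom (f 1) = 1 := by rw [map_one, map_one]
    rcases lt_or_gt_of_ne hb1 with hlt | hlt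
    · exact key b 1 hb (by rw [h1]; exact one_ne_zero) (by rwa [h1])
    · exact key 1 b (by rw [h1]; exact one_ne_zero) hb (by rwa [h1])
  -- Now `|f(.)|` takes only the values 0 and 1, and the open ball of radius 1 is its kernel.
  · push Not at hB
    refine ⟨1, 1, by rw [map_one, map_one]; exact one_ne_zero,
      by rw [map_one, map_one]; exact one_ne_zero, fun c u hu hcu => ?_⟩
    rw [map_one, map_one, hB u hu, div_one, div_one] at hcu
    have hc : v.hom (f c) = 0 := by
      by_contra h0
      exact hcu.ne (hB c h0)
    rw [hc, zero_div]
    exact zero_lt_iff.mpr (div_ne_zero hva hvs)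

/-- The definition of the analytic spectrum is tested on `ℤ → A` alone. The integer `c` is needed to
pass from a ball to a nonzero element inside it. -/
theorem isCofinal_of_mem_SpehA {A : Type} [CommRing A] {v : TMSeminorm A}
    (hv : v.place ∈ SpehA A) {c : ℤ} (hc0 : v.hom (c : A) ≠ 0) (hc1 : v.hom (c : A) ≠ 1) :
    v.IsCofinal := by
  obtain ⟨w, hw, hf⟩ := hv
  refine IsCofinal.congr hw ?_
  -- Membership in `SpehA` concerns some representative `w` of the place, to which the condition on
  -- `c` has to be transported.
  obtain ⟨c, hc0, hc1⟩ : ∃ c : ℤ, w.hom (c : A) ≠ 0 ∧ w.hom (c : A) ≠ 1 := by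
    rw [place_eq_iff] at hw
    refine ⟨c, fun h0 => hc0 ?_, fun h1 => hc1 ?_⟩
    · simpa using (hw c 0).mp (by rw [h0]; exact zero_le)
    · refine le_antisymm ?_ ?_
      · simpa using (hw c 1).mp (by rw [h1, map_one])
      · simpa using (hw 1 c).mp (by rw [h1, map_one])
  clear! v
  obtain ⟨hle, -, h⟩ := hf ℤ (Int.castRingHom A)
  have key : ∀ (a : A) (s : w.norm.multElts), w.hom a ≠ 0 → ∃ n m : ℤ, w.hom (n : A) ≠ 0 ∧
      w.hom (m : A) ≠ 0 ∧ w.hom (n : A) / w.hom (m : A) < w.hom a / w.hom s := by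
    intro a s ha
    obtain ⟨b, hb, hsub⟩ := h (Localization.mk a s)
      (zero_lt_iff.mpr (div_ne_zero ha (w.hom_multElts_ne_zero s)))
    induction b using Localization.induction_on with | _ b
    obtain ⟨n, m⟩ := b
    have hm : w.hom ((m : ℤ) : A) ≠ 0 :=
      (w.comap (Int.castRingHom A)).hom_multElts_ne_zero m
    have hn : w.hom (n : A) ≠ 0 := fun h0 => hb.ne' (by
      change w.hom (n : A) / w.hom ((m : ℤ) : A) = 0
      rw [h0, zero_div])
    have step : ∀ (n' : ℤ) (m' : (w.norm.comp (Int.castRingHom A)).multElts),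
        w.hom (n' : A) / w.hom ((m' : ℤ) : A) < w.hom (n : A) / w.hom ((m : ℤ) : A) →
        w.hom (n' : A) / w.hom ((m' : ℤ) : A) < w.hom a / w.hom s := by
      intro n' m' hlt
      have h1 : Localization.mk n' m' ∈ ball (w.norm.comp (Int.castRingHom A)).locNorm 0
          (Localization.mk n m) := (w.comap (Int.castRingHom A)).loc.mem_ball_zero.mpr hlt
      have h2 := hsub h1
      rw [Set.mem_preimage, mem_ball_locNorm, Localization.mk_eq_mk', IsLocalization.map_mk', ← Localization.mk_eq_mk'] at h2
      exact h2
    have hnm : 0 < w.hom (n : A) / w.hom ((m : ℤ) : A) := zero_lt_iff.mpr (div_ne_zero hn hm)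
    -- The radius `n / m` is multiplied or divided by `c`, whichever makes it smaller, to land
    -- strictly inside the ball.
    rcases lt_or_gt_of_ne hc1 with hlt | hlt
    · refine ⟨n * c, m, ?_, hm, step _ _ ?_⟩
      · rw [Int.cast_mul, _root_.map_mul]; exact mul_ne_zero hn hc0
      · rw [Int.cast_mul, _root_.map_mul, mul_div_right_comm]
        exact mul_lt_of_lt_one_right hnm hlt
    · have hmc : w.hom ((m * c : ℤ) : A) ≠ 0 := by
        rw [Int.cast_mul, _root_.map_mul]; exact mul_ne_zero hm hc0
      refine ⟨n, m * c, hn, hmc,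
        step n ⟨m * c, (w.comap (Int.castRingHom A)).mem_multElts.mpr hmc⟩ ?_⟩
      rw [Int.cast_mul, _root_.map_mul, ← div_div]
      exact (div_lt_iff₀ (zero_lt_one.trans hlt)).mpr (lt_mul_of_one_lt_right hnm hlt)
  intro a ha
  constructor
  -- A fraction of integers below `1 / |a|` is an upper bound for `|a|` after inversion.
  · obtain ⟨n, m, hn, hm, hlt⟩ := key 1 ⟨a, w.mem_multElts.mpr ha⟩ (by rw [map_one]; exact one_ne_zero)
    refine ⟨n, m, hn, ?_⟩
    rw [map_one, div_lt_div_iff₀ (zero_lt_iff.mpr hm) (zero_lt_iff.mpr ha), one_mul] at hlt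
    exact hlt.le
  · obtain ⟨n, m, hn, hm, hlt⟩ := key a 1 ha
    refine ⟨n, m, hn, ?_⟩
    rw [OneMemClass.coe_one, map_one, div_one, div_lt_iff₀ (zero_lt_iff.mpr hm), mul_comm] at hlt
    exact hlt.le

end TMSeminorm

end Speh

namespace Speh

namespace TMSeminorm

/-- The element `e` plays the role of `1/2`: shrinking the radius by it compensates for the factor
`1 + 1` in the triangle inequality. -/
theorem tinyBalls_of_half {A : Type u} [CommRing A] (v : TMSeminorm A)
    (hu : ∀ a, v.hom a ≠ 0 → IsUnit a) {e : A} (he : v.hom e ≠ 0) (h1 : v.hom e + v.hom e ≤ 1) :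
    TinyBalls v.norm.toFun := by
  refine v.tinyBalls hu fun a ha => ⟨e * a, ?_, fun x y hx hy => ?_⟩
  · rw [_root_.map_mul]; exact zero_lt_iff.mpr (mul_ne_zero he ha.ne')
  have two_pos : (0 : v.R) < 1 + 1 :=
    (IsPosAura.zero_lt_one' (R := v.R)).trans_le (by
      simpa using IsPosAura.add_le_add' (le_refl (1 : v.R)) (IsPosAura.zero_le (1 : v.R)))
  have h2 : (1 + 1) * v.hom (e * a) ≤ v.hom a := by
    rw [_root_.map_mul, ← mul_assoc, add_mul, one_mul]
    exact mul_le_of_le_one_left' h1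
  refine lt_of_lt_of_le ?_ h2
  refine lt_of_le_of_lt ((v.hom_add_le x y).trans ?_)
    (mul_lt_mul_of_pos_left (max_lt hx hy) two_pos)
  rw [add_mul, one_mul]
  exact IsPosAura.add_le_add' (le_max_left _ _) (le_max_right _ _)

end TMSeminorm

/-! ### Complex points are analytic -/

section Complex

/-- The seminorm `|g(.)|` for a ring morphism `g` to the complex numbers. -/
noncomputable def complexSeminorm {A : Type} [CommRing A] (g : A →+* ℂ) : TMSeminorm A :=
  (realSeminorm (NormedField.toMulRingNorm ℂ).toMulRingSeminorm).comap g

theorem complexSeminorm_place {A : Type} [CommRing A] (g : A →+* ℂ) :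
    (complexSeminorm g).place = (normPlace ℂ).comap g := rfl

theorem complexSeminorm_hom_le {A : Type} [CommRing A] (g : A →+* ℂ) (a b : A) :
    (complexSeminorm g).hom a ≤ (complexSeminorm g).hom b ↔ ‖g a‖ ≤ ‖g b‖ :=
  realSeminorm_hom_le _ (g a) (g b)

variable {A : Type} [CommRing A] (g : A →+* ℂ)

theorem complexSeminorm_hom (a : A) : (complexSeminorm g).hom a = (‖g a‖.toNNReal : NNReal) := rfl

theorem complexSeminorm_hom_ne_zero (a : A) : (complexSeminorm g).hom a ≠ 0 ↔ g a ≠ 0 := by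
  rw [complexSeminorm_hom]
  refine Iff.trans (not_congr (Real.toNNReal_eq_zero)) ?_
  simp

theorem complexSeminorm_isUnit (s : (complexSeminorm g).norm.multElts) : IsUnit (g s) :=
  isUnit_iff_ne_zero.mpr ((complexSeminorm_hom_ne_zero g s).mp
    ((complexSeminorm g).hom_multElts_ne_zero s))

/-- The extension of `g` to the localization at the elements outside of its kernel. -/
noncomputable def complexLift : Localization (complexSeminorm g).norm.multElts →+* ℂ :=
  IsLocalization.lift (complexSeminorm_isUnit g)

theorem complexLift_mk (a : A) (s : (complexSeminorm g).norm.multElts) :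
    complexLift g (Localization.mk a s) = g a / g s := by
  rw [complexLift, Localization.mk_eq_mk', IsLocalization.lift_mk'_spec,
    mul_div_cancel₀ _ (complexSeminorm_isUnit g s).ne_zero]

theorem complexSeminorm_loc_hom (x : Localization (complexSeminorm g).norm.multElts) :
    (complexSeminorm g).loc.hom x = (‖complexLift g x‖.toNNReal : NNReal) := by
  induction x using Localization.induction_on with | _ x
  obtain ⟨a, s⟩ := x
  rw [complexLift_mk, norm_div, Real.toNNReal_div (norm_nonneg _)]
  rfl

theorem complexSeminorm_tinyBalls : TinyBalls (complexSeminorm g).loc.norm.toFun := by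
  have h2 : (2 : A) ∈ (complexSeminorm g).norm.multElts :=
    (complexSeminorm g).mem_multElts.mpr ((complexSeminorm_hom_ne_zero g 2).mpr (by
      rw [map_ofNat]; exact two_ne_zero))
  have h3 : complexLift g (Localization.mk 1 ⟨2, h2⟩) = 1 / 2 := by
    rw [complexLift_mk, map_one, map_ofNat]
  have h4 : (complexSeminorm g).loc.hom (Localization.mk 1 ⟨2, h2⟩) = (1 / 2 : NNReal) := by
    rw [complexSeminorm_loc_hom, h3]
    refine NNReal.eq ?_
    simp
  refine TMSeminorm.tinyBalls_of_half _ (fun a ha => TMSeminorm.loc_isUnit _ ha)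
    (e := Localization.mk 1 ⟨2, h2⟩) ?_ ?_
  · rw [h4]
    exact (by norm_num : (1 / 2 : NNReal) ≠ 0)
  · rw [h4]
    exact (add_halves (1 : NNReal)).le

/-- The separated completion is the closure in `ℂ` of the image of the localization. It is a closed
subring, hence complete, and carries the restricted norm. -/
theorem complexSeminorm_extends : ExtendsToCompletion (complexSeminorm g).loc.norm.toFun := by
  let S : Subring ℂ := (complexLift g).range.topologicalClosure
  have hS : IsClosed (S : Set ℂ) := Subring.isClosed_topologicalClosure _
  let ι : Localization (complexSeminorm g).norm.multElts →+* S :=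
    (complexLift g).codRestrict S fun x =>
      Subring.le_topologicalClosure _ (RingHom.mem_range_self _ x)
  have hι : ∀ x, ((ι x : S) : ℂ) = complexLift g x := fun x => rfl
  have hball : ∀ x a, x ∈ ball (complexSeminorm g).loc.norm.toFun 0 a ↔
      ‖complexLift g x‖ < ‖complexLift g a‖ := by
    intro x a
    rw [TMSeminorm.mem_ball_zero, complexSeminorm_loc_hom, complexSeminorm_loc_hom]
    exact Real.toNNReal_lt_toNNReal_iff_of_nonneg (norm_nonneg _)
  have hpos : ∀ a, 0 < (complexSeminorm g).loc.norm.toFun a ↔ 0 < ‖complexLift g a‖ := by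
    intro a
    change 0 < (complexSeminorm g).loc.hom a ↔ _
    rw [complexSeminorm_loc_hom]
    exact Real.toNNReal_pos
  refine ⟨S, inferInstance, inferInstance, S.toAddSubgroup.isUniformAddGroup, inferInstance, ι,
    ⟨hS.completeSpace_coe, inferInstance, ?_, ?_⟩, NNReal, inferInstance, inferInstance,
    inferInstance, (complexSeminorm S.subtype).norm, ?_⟩
  · rintro ⟨x, hx⟩
    rw [closure_subtype, ← Set.range_comp]
    exact hx
  · intro s
    have h0 : (𝓝 (0 : S)).comap ι = (𝓝 (0 : ℂ)).comap (complexLift g) := by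
      rw [nhds_subtype_eq_comap, Filter.comap_comap]
      rfl
    rw [h0, (Metric.nhds_basis_ball.comap (complexLift g)).mem_iff]
    constructor
    · rintro ⟨ε, hε, h⟩
      -- The admissible radii are the values of the localization; they become arbitrarily small
      -- because they include all `1 / (n + 1)`.
      obtain ⟨n, hn⟩ := exists_nat_one_div_lt hε
      have hmem : ((n + 1 : ℕ) : A) ∈ (complexSeminorm g).norm.multElts :=
        (complexSeminorm g).mem_multElts.mpr ((complexSeminorm_hom_ne_zero g _).mpr (by
          rw [map_natCast]; exact Nat.cast_ne_zero.mpr n.succ_ne_zero))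
      have h3 : complexLift g (Localization.mk 1 ⟨_, hmem⟩) = 1 / ((n : ℂ) + 1) := by
        rw [complexLift_mk, map_one, map_natCast, Nat.cast_succ]
      have h4 : ‖(1 : ℂ) / ((n : ℂ) + 1)‖ = 1 / ((n : ℝ) + 1) := by
        rw [norm_div, norm_one]
        norm_cast
      refine ⟨Localization.mk 1 ⟨_, hmem⟩, ?_, fun x hx => h ?_⟩
      · rw [hpos, h3, h4]; positivity
      · rw [hball, h3, h4] at hx
        simpa using hx.trans hn
    · rintro ⟨a, ha, h⟩
      refine ⟨‖complexLift g a‖, (hpos a).mp ha, fun x hx => h ((hball x a).mpr ?_)⟩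
      simpa using hx
  · have key : ∀ x, (complexSeminorm S.subtype).norm.toFun (ι x) =
        (complexSeminorm g).loc.norm.toFun x := fun x => (complexSeminorm_loc_hom g x).symm
    exact ⟨fun a b c => by simp only [key]; exact id, fun a b c => by simp only [key]; exact id⟩

theorem complexSeminorm_isCofinal : (complexSeminorm g).IsCofinal := by
  intro a ha
  rw [complexSeminorm_hom_ne_zero] at ha
  have ha' : 0 < ‖g a‖ := norm_pos_iff.mpr ha
  constructor
  · obtain ⟨m, hm⟩ := exists_nat_ge ‖g a‖
    refine ⟨1, m, ?_, ?_⟩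
    · rw [complexSeminorm_hom_ne_zero]; simp
    · rw [← _root_.map_mul, complexSeminorm_hom_le]; simpa using hm
  · obtain ⟨m, hm⟩ := exists_nat_ge (1 / ‖g a‖)
    refine ⟨1, m, ?_, ?_⟩
    · rw [complexSeminorm_hom_ne_zero]; simp
    · rw [← _root_.map_mul, complexSeminorm_hom_le]
      rw [div_le_iff₀ ha'] at hm
      simpa using hm

theorem normPlace_complex_comap_mem_SpehA : (normPlace ℂ).comap g ∈ SpehA A :=
  ⟨complexSeminorm g, rfl, (complexSeminorm g).hasFunctorialMultCompletion
    (fun _ _ f => ⟨complexSeminorm_tinyBalls (g.comp f), complexSeminorm_extends (g.comp f)⟩)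
    fun B _ f => (complexSeminorm_isCofinal g).exists_ball B f⟩

end Complex

end Speh

namespace Speh

/-! ### Extension of a seminorm to a ring of fractions of a quotient -/

namespace TMSeminorm

section Extend

variable {A B : Type u} [CommRing A] [CommRing B] (v : TMSeminorm A) (φ : A →+* B)
  (hker : ∀ a, φ a = 0 → v.hom a = 0) (hfrac : ∀ F, ∃ a s, v.hom s ≠ 0 ∧ φ s * F = φ a)

include hker in
theorem hom_eq_of_map_eq {a b : A} (h : φ a = φ b) : v.hom a = v.hom b := by
  have key : ∀ a b : A, φ a = φ b → v.hom a ≤ v.hom b := fun a b h => by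
    have h1 := v.hom_add_le (a - b) b
    rwa [sub_add_cancel, hker (a - b) (by rw [map_sub, h, sub_self]), zero_add] at h1
  exact le_antisymm (key a b h) (key b a h.symm)

include hker in
theorem div_eq_div_of_map_eq {F : B} {a s b t : A} (hs : v.hom s ≠ 0) (ht : v.hom t ≠ 0)
    (h1 : φ s * F = φ a) (h2 : φ t * F = φ b) : v.hom a / v.hom s = v.hom b / v.hom t := by
  rw [div_eq_div_iff hs ht, ← _root_.map_mul, ← _root_.map_mul]
  refine v.hom_eq_of_map_eq φ hker ?_
  rw [_root_.map_mul, _root_.map_mul, ← h1, ← h2]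
  ring

omit v in
theorem fraction_mul {F G : B} {a s b t : A} (h1 : φ s * F = φ a) (h2 : φ t * G = φ b) :
    φ (s * t) * (F * G) = φ (a * b) := by
  rw [_root_.map_mul, _root_.map_mul, ← h1, ← h2]; ring

omit v in
theorem fraction_add {F G : B} {a s b t : A} (h1 : φ s * F = φ a) (h2 : φ t * G = φ b) :
    φ (s * t) * (F + G) = φ (a * t + s * b) := by
  rw [_root_.map_add, _root_.map_mul, _root_.map_mul, _root_.map_mul, ← h1, ← h2]; ring

/-- The extension of a multiplicative seminorm along `φ : A → B`, when the kernel of `φ` has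
seminorm `0` and all elements of `B` are fractions of elements of `A`. -/
noncomputable def extend : TMSeminorm B where
  R := v.R
  tempered := v.tempered
  norm :=
    { toFun := fun F => v.hom (hfrac F).choose / v.hom (hfrac F).choose_spec.choose
      map_zero := by
        have h := (hfrac 0).choose_spec.choose_spec
        rw [v.div_eq_div_of_map_eq φ hker h.1 (t := 1) (b := 0) (by simp) h.2 (by simp)]
        simp
      map_one := by
        have h := (hfrac 1).choose_spec.choose_spec
        rw [v.div_eq_div_of_map_eq φ hker h.1 (t := 1) (b := 1) (by simp) h.2 (by simp)]
        simp
      map_mul_le := fun F G => by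
        have hF := (hfrac F).choose_spec.choose_spec
        have hG := (hfrac G).choose_spec.choose_spec
        have hFG := (hfrac (F * G)).choose_spec.choose_spec
        rw [div_mul_div_comm, ← _root_.map_mul, ← _root_.map_mul]
        refine le_of_eq (v.div_eq_div_of_map_eq φ hker hFG.1 ?_ hFG.2 ?_)
        · rw [_root_.map_mul]; exact mul_ne_zero hF.1 hG.1
        · exact fraction_mul φ hF.2 hG.2
      map_add_le := fun F G => by
        have hF := (hfrac F).choose_spec.choose_spec
        have hG := (hfrac G).choose_spec.choose_spec
        have hFG := (hfrac (F + G)).choose_spec.choose_spec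
        rw [div_add_div _ _ hF.1 hG.1, ← _root_.map_mul, ← _root_.map_mul, ← _root_.map_mul]
        set a := (hfrac F).choose
        set s := (hfrac F).choose_spec.choose
        set b := (hfrac G).choose
        set t := (hfrac G).choose_spec.choose
        rw [v.div_eq_div_of_map_eq φ hker hFG.1 (t := s * t) (b := a * t + s * b) ?_ hFG.2 ?_]
        · exact div_le_div_of_nonneg_right (v.hom_add_le _ _) (IsPosAura.zero_le _)
        · rw [_root_.map_mul]; exact mul_ne_zero hF.1 hG.1
        · exact fraction_add φ hF.2 hG.2 }
  map_mul := fun F G => by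
    have hF := (hfrac F).choose_spec.choose_spec
    have hG := (hfrac G).choose_spec.choose_spec
    have hFG := (hfrac (F * G)).choose_spec.choose_spec
    simp only
    rw [div_mul_div_comm, ← _root_.map_mul, ← _root_.map_mul]
    refine v.div_eq_div_of_map_eq φ hker hFG.1 ?_ hFG.2 ?_
    · rw [_root_.map_mul]; exact mul_ne_zero hF.1 hG.1
    · exact fraction_mul φ hF.2 hG.2

theorem extend_hom (a : A) : (v.extend φ hker hfrac).hom (φ a) = v.hom a := by
  have h := (hfrac (φ a)).choose_spec.choose_spec
  have := v.div_eq_div_of_map_eq φ hker h.1 (t := 1) (b := a) (by simp) h.2 (by simp)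
  rw [map_one, div_one] at this
  exact this

theorem place_extend : (v.extend φ hker hfrac).place.comap φ = v.place := by
  refine ((v.extend φ hker hfrac).comap φ).place_eq_iff v |>.mpr fun a b => ?_
  rw [comap_hom_le, extend_hom, extend_hom]
  rfl

end Extend

end TMSeminorm

/-! ### Valuations of `k[X]` that are trivial on `k` -/

section TrivialLine

variable {k : Type} [Field k]

open Classical in
theorem degreeValuation_apply {P : k[X]} (hP : P ≠ 0) :
    (RatFunc.inftyValuation k).comap (algebraMap k[X] (RatFunc k)) P =
      WithZero.exp (P.natDegree : ℤ) :=
  RatFunc.inftyValuation.polynomial k hP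

/-- If `|X| > 1`, the leading term dominates and the value depends on the degree only. Otherwise all
values are at most 1, and the elements of value less than 1 form a prime ideal, generated by some
`π`. The valuation is trivial modulo `π` or `π`-adic according to whether `|π|` vanishes. -/
theorem krullPlace_mem_trivialLine {Γ₀ : Type} [LinearOrderedCommGroupWithZero Γ₀]
    (N : Valuation k[X] Γ₀) (hN : ∀ c : k, c ≠ 0 → N (C c) = 1) : krullPlace N ∈ trivialLine k := by
  classical
  by_cases hX : 1 < N X
  · refine Or.inr (Or.inr ((krullPlace_eq_iff _ _).mpr fun a b => ?_))
    have htriv : N.IsTrivialOn k := ⟨fun c hc => hN c hc⟩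
    have hdeg : ∀ P : k[X], P ≠ 0 → N P = N X ^ P.natDegree := fun P hP => by
      have := valuation_aeval_eq_valuation_X_pow_natDegree_of_one_lt_valuation_X
        (v := N) (X : k[X]) hX hP
      rwa [aeval_X_left_apply] at this
    rcases eq_or_ne a 0 with rfl | ha
    · simp
    rcases eq_or_ne b 0 with rfl | hb
    · rw [map_zero, map_zero, le_zero_iff, le_zero_iff, hdeg a ha, degreeValuation_apply ha]
      simp [(zero_lt_one.trans hX).ne']
    rw [hdeg a ha, hdeg b hb, degreeValuation_apply ha, degreeValuation_apply hb,
      pow_le_pow_iff_right₀ hX, WithZero.exp_le_exp, Nat.cast_le]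
  · have hle : ∀ P : k[X], N P ≤ 1 := fun P => by
      rw [P.as_sum_range_C_mul_X_pow]
      refine N.map_sum_le fun i _ => ?_
      rw [map_mul, map_pow]
      refine mul_le_one' ?_ (pow_le_one' (not_lt.mp hX) _)
      by_cases hc : P.coeff i = 0
      · simp [hc]
      · exact (hN _ hc).le
    let 𝔪 : Ideal k[X] :=
      { carrier := {P | N P < 1}
        add_mem' := fun {a b} ha hb => (N.map_add a b).trans_lt (max_lt ha hb)
        zero_mem' := by simp
        smul_mem' := fun c a ha => by
          change N (c * a) < 1
          rw [map_mul]
          exact (mul_le_of_le_one_left' (hle c)).trans_lt ha }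
    have hmem : ∀ P, P ∈ 𝔪 ↔ N P < 1 := fun P => Iff.rfl
    have hone : ∀ P, P ∉ 𝔪 → N P = 1 := fun P hP => le_antisymm (hle P) (not_lt.mp hP)
    have hprime : 𝔪.IsPrime := by
      refine ⟨fun h => ?_, fun {a b} hab => ?_⟩
      · have := (hmem 1).mp (h ▸ Submodule.mem_top)
        simp at this
      · by_contra! h
        rw [hmem, map_mul, hone a h.1, hone b h.2, one_mul] at hab
        exact lt_irrefl _ hab
    obtain ⟨π, hπ⟩ := (IsPrincipalIdealRing.principal 𝔪).principal
    have hdvd : ∀ P, P ∈ 𝔪 ↔ π ∣ P := fun P => by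
      rw [hπ]; exact Ideal.mem_span_singleton
    -- The zero ideal, that is the trivial norm of `k[X]`, falls under the first case with `π = 0`.
    by_cases hN0 : N π = 0
    · refine Or.inl ⟨𝔪, hprime, ((krullSeminorm N).place_eq_trivialPlace_iff 𝔪).mpr fun a b => ?_⟩
      change N a ≤ N b ↔ _
      have hzero : ∀ P, P ∈ 𝔪 → N P = 0 := fun P hP => by
        obtain ⟨Q, rfl⟩ := (hdvd P).mp hP
        rw [map_mul, hN0, zero_mul]
      by_cases ha : a ∈ 𝔪
      · simp [ha, hzero a ha]
      by_cases hb : b ∈ 𝔪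
      · simp [ha, hb, hzero b hb, hone a ha]
      · simp [hb, hone a ha, hone b hb]
    · have hπ0 : π ≠ 0 := by rintro rfl; simp at hN0
      have hbot : 𝔪 ≠ ⊥ := fun h => hπ0 (by
        have := (hdvd π).mpr dvd_rfl
        rwa [h, Ideal.mem_bot] at this)
      let w : IsDedekindDomain.HeightOneSpectrum k[X] := ⟨𝔪, hprime, hbot⟩
      refine Or.inr (Or.inl ⟨w, (krullPlace_eq_iff _ _).mpr fun a b => ?_⟩)
      have hNπ : N π < 1 := (hdvd π).mpr dvd_rfl
      have hwπ : w.intValuation π = WithZero.exp (-1 : ℤ) := w.intValuation_singleton hπ0 hπ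
      have hfact : ∀ P : k[X], P ≠ 0 → ∃ n : ℕ,
          N P = N π ^ n ∧ w.intValuation P = w.intValuation π ^ n := fun P hP => by
        have hπu : ¬IsUnit π := fun hu => hprime.ne_top
          (Ideal.eq_top_of_isUnit_mem _ ((hdvd π).mpr dvd_rfl) hu)
        obtain ⟨n, Q, hQ, rfl⟩ := WfDvdMonoid.max_power_factor hP (irreducible_iff_prime.mpr
          (by
            have := (Ideal.span_singleton_prime hπ0).mp (by
              have := hprime; rwa [hπ] at this)
            exact this))
        refine ⟨n, ?_, ?_⟩
        · rw [map_mul, map_pow, hone Q (by rwa [hdvd]), mul_one]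
        · rw [map_mul, map_pow, (w.intValuation_eq_one_iff_mem_primeCompl Q).mpr
            (show Q ∉ 𝔪 by rwa [hdvd]), mul_one]
      rcases eq_or_ne a 0 with rfl | ha
      · simp
      obtain ⟨m, hm, hm'⟩ := hfact a ha
      rcases eq_or_ne b 0 with rfl | hb
      · simp only [map_zero, le_zero_iff, hm, hm', hwπ]
        simp [hN0]
      obtain ⟨n, hn, hn'⟩ := hfact b hb
      rw [hm, hn, hm', hn', pow_le_pow_iff_right_of_lt_one₀ (zero_lt_iff.mpr hN0) hNπ,
        pow_le_pow_iff_right_of_lt_one₀ (by rw [hwπ]; simp) (by rw [hwπ]; decide)]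

/-- A uniform description of the three kinds of places. Values in `ℤ` with a zero adjoined have rank
at most one, which is what `mem_SpehA_of_archimedean` requires. -/
theorem exists_valuation_of_mem_trivialLine {x : SpehM k[X]} (hx : x ∈ trivialLine k) :
    ∃ N : Valuation k[X] (WithZero (Multiplicative ℤ)), x = krullPlace N ∧
      ∀ c : k, c ≠ 0 → N (C c) = 1 := by
  have unit : ∀ N : Valuation k[X] (WithZero (Multiplicative ℤ)), (∀ P, N P ≤ 1) →
      ∀ c : k, c ≠ 0 → N (C c) = 1 := fun N hN c hc => by
    refine le_antisymm (hN _) ?_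
    have h1 : N (C c) * N (C c⁻¹) = 1 := by
      rw [← map_mul, ← C_mul, mul_inv_cancel₀ hc, C_1, map_one]
    rw [← h1]
    exact mul_le_of_le_one_right' (hN _)
  rcases hx with ⟨𝔭, h𝔭, rfl⟩ | ⟨w, rfl⟩ | rfl
  · classical
    refine ⟨(1 : Valuation (k[X] ⧸ 𝔭) (WithZero (Multiplicative ℤ))).comap
      (Ideal.Quotient.mk 𝔭), rfl, unit _ fun P => ?_⟩
    rw [Valuation.comap_apply]
    exact Valuation.one_apply_le_one _
  · exact ⟨_, rfl, unit _ w.intValuation_le_one⟩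
  · classical
    refine ⟨_, rfl, fun c hc => ?_⟩
    rw [degreeValuation_apply (C_ne_zero.mpr hc), natDegree_C, Nat.cast_zero, WithZero.exp_zero]

theorem restrictLine_trivialLine_subset_SpehA :
    restrictLine k '' trivialLine k ⊆ SpehA ℤ[X] := by
  rintro _ ⟨x, hx, rfl⟩
  obtain ⟨N, rfl, hN⟩ := exists_valuation_of_mem_trivialLine hx
  have h := TMSeminorm.mem_SpehA_of_archimedean
    (v := krullSeminorm (N.comap (mapRingHom (Int.castRingHom k)))) ?_ ?_
  · exact h
  · intro n
    change N (mapRingHom (Int.castRingHom k) n) ≤ 1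
    rw [map_natCast, ← map_natCast (C : k →+* k[X])]
    by_cases hn : (n : k) = 0
    · rw [hn, map_zero, map_zero]; exact zero_le
    · exact (hN _ hn).le
  · intro x y hx hy
    obtain ⟨n, hn⟩ := exists_pow_lt₀ (G := WithZero (Multiplicative ℤ)) (a := y) hy (Units.mk0 x hx)
    exact ⟨n, hn⟩

theorem restrictLine_trivialLine_subset_Spev :
    restrictLine k '' trivialLine k ⊆ Spev ℤ[X] := by
  rintro _ ⟨x, hx, rfl⟩
  obtain ⟨N, rfl, hN⟩ := exists_valuation_of_mem_trivialLine hx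
  exact ⟨_, _, N.comap (mapRingHom (Int.castRingHom k)), rfl⟩

end TrivialLine

theorem natCast_le_one_of_trivial {v : TMSeminorm ℤ[X]}
    (h : ∀ n : ℕ, n ≠ 0 → v.hom (n : ℤ[X]) = 1) (n : ℕ) : v.hom (n : ℤ[X]) ≤ 1 := by
  rcases eq_or_ne n 0 with rfl | hn
  · simp
  · exact (h n hn).le

theorem exists_integer_multiple (F : ℚ[X]) : ∃ (P : ℤ[X]) (d : ℤ), d ≠ 0 ∧
    mapRingHom (Int.castRingHom ℚ) (d : ℤ[X]) * F = mapRingHom (Int.castRingHom ℚ) P := by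
  obtain ⟨d, hd0, hd⟩ := IsLocalization.integerNormalization_spec (nonZeroDivisors ℤ) F
  refine ⟨IsLocalization.integerNormalization (nonZeroDivisors ℤ) F, d,
    nonZeroDivisors.ne_zero hd0, ?_⟩
  have h2 : map (algebraMap ℤ ℚ) (IsLocalization.integerNormalization (nonZeroDivisors ℤ) F) =
    mapRingHom (Int.castRingHom ℚ) (IsLocalization.integerNormalization (nonZeroDivisors ℤ) F) := rfl
  rw [← h2, hd, map_intCast]
  simp [zsmul_eq_mul]

/-- All nonzero integers have value 1, so denominators can be cleared: the seminorm extends to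
`ℚ[X]`, is ultrametric there and trivial on `ℚ`. -/
theorem trivialPoints_eq : trivialPoints = restrictLine ℚ '' trivialLine ℚ := by
  ext x
  constructor
  · intro hx
    obtain ⟨v, rfl⟩ := TMSeminorm.exists_place x
    rw [place_mem_trivialPoints_iff] at hx
    have hint : ∀ d : ℤ, d ≠ 0 → v.hom (d : ℤ[X]) = 1 := fun d hd => by
      rw [TMSeminorm.hom_intCast_natAbs]; exact hx _ (by simpa using hd)
    have hker : ∀ a, mapRingHom (Int.castRingHom ℚ) a = 0 → v.hom a = 0 := fun a ha => by
      have : a = 0 := map_injective (Int.castRingHom ℚ) Int.cast_injective (by simpa using ha)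
      rw [this, map_zero]
    have hfrac : ∀ F : ℚ[X], ∃ a s, v.hom s ≠ 0 ∧
        mapRingHom (Int.castRingHom ℚ) s * F = mapRingHom (Int.castRingHom ℚ) a := fun F => by
      obtain ⟨P, d, hd, h⟩ := exists_integer_multiple F
      exact ⟨P, d, by rw [hint d hd]; exact one_ne_zero, h⟩
    set w := v.extend _ hker hfrac with hw
    have hwn : ∀ n : ℤ, w.hom (n : ℚ[X]) = v.hom (n : ℤ[X]) := fun n => by
      rw [← v.extend_hom _ hker hfrac, map_intCast (mapRingHom (Int.castRingHom ℚ))]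
    have hw1 : ∀ n : ℕ, w.hom (n : ℚ[X]) ≤ 1 := fun n => by
      have := hwn n
      rw [Int.cast_natCast, Int.cast_natCast] at this
      rw [this]
      exact natCast_le_one_of_trivial hx n
    refine ⟨w.place, ?_, v.place_extend _ hker hfrac⟩
    rw [w.place_toValuation hw1]
    refine krullPlace_mem_trivialLine _ fun c hc => ?_
    rw [TMSeminorm.toValuation_apply]
    have h1 : w.hom (C c) * w.hom (c.den : ℤ) = w.hom (c.num : ℚ[X]) := by
      rw [← _root_.map_mul]
      congr 1
      rw [← map_intCast (C : ℚ →+* ℚ[X]), ← map_intCast (C : ℚ →+* ℚ[X]), ← C_mul]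
      congr 1
      exact_mod_cast Rat.mul_den_eq_num c
    rw [hwn, hwn, hint _ (by exact_mod_cast c.den_ne_zero), hint _ (Rat.num_ne_zero.mpr hc)] at h1
    exact (mul_one _).symm.trans h1
  · rintro ⟨y, hy, rfl⟩
    obtain ⟨N, rfl, hN⟩ := exists_valuation_of_mem_trivialLine hy
    refine (place_mem_trivialPoints_iff ((krullSeminorm N).comap _)).mpr fun n hn => ?_
    change N (mapRingHom (Int.castRingHom ℚ) n) = 1
    rw [map_natCast, ← map_natCast (C : ℚ →+* ℚ[X])]
    exact hN _ (Nat.cast_ne_zero.mpr hn)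

theorem FpPoints_eq (p : ℕ) [hp : Fact p.Prime] :
    FpPoints p = restrictLine (ZMod p) '' trivialLine (ZMod p) := by
  ext x
  constructor
  · intro hx
    obtain ⟨v, rfl⟩ := TMSeminorm.exists_place x
    rw [place_mem_FpPoints_iff v hp.out] at hx
    have hker : ∀ a, mapRingHom (Int.castRingHom (ZMod p)) a = 0 → v.hom a = 0 := fun a ha => by
      have h1 : C (p : ℤ) ∣ a := by
        rw [C_dvd_iff_dvd_coeff]
        intro i
        rw [← ZMod.intCast_zmod_eq_zero_iff_dvd]
        have := congrArg (fun q => q.coeff i) ha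
        simpa using this
      obtain ⟨b, rfl⟩ := h1
      rw [_root_.map_mul, map_natCast, hx, zero_mul]
    have hfrac : ∀ F : (ZMod p)[X], ∃ a s, v.hom s ≠ 0 ∧
        mapRingHom (Int.castRingHom (ZMod p)) s * F = mapRingHom (Int.castRingHom (ZMod p)) a :=
      fun F => by
      obtain ⟨P, hP⟩ := map_surjective (Int.castRingHom (ZMod p)) (ZMod.intCast_surjective) F
      exact ⟨P, 1, by simp, by rw [map_one, one_mul, ← hP]; rfl⟩
    set w := v.extend _ hker hfrac with hw
    -- By Fermat, nonzero constants are roots of unity, and 1 is the only torsion value.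
    have hw0 : ∀ c : ZMod p, c ≠ 0 → w.hom (C c) = 1 := fun c hc => by
      have h1 : w.hom (C c) ^ (p - 1) = 1 := by
        rw [← map_pow, ← C_pow, ZMod.pow_card_sub_one_eq_one hc, C_1, map_one]
      have h2 : p - 1 ≠ 0 := by
        have := hp.out.two_le
        omega
      simpa [h2] using h1
    have hw1 : ∀ n : ℕ, w.hom (n : (ZMod p)[X]) ≤ 1 := fun n => by
      rw [← map_natCast (C : ZMod p →+* (ZMod p)[X])]
      by_cases hn : (n : ZMod p) = 0
      · rw [hn, map_zero, map_zero]; exact zero_le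
      · exact (hw0 _ hn).le
    refine ⟨w.place, ?_, v.place_extend _ hker hfrac⟩
    rw [w.place_toValuation hw1]
    exact krullPlace_mem_trivialLine _ hw0
  · rintro ⟨y, hy, rfl⟩
    obtain ⟨N, rfl, hN⟩ := exists_valuation_of_mem_trivialLine hy
    refine (place_mem_FpPoints_iff ((krullSeminorm N).comap _) hp.out).mpr ?_
    change N (mapRingHom (Int.castRingHom (ZMod p)) p) = 0
    rw [map_natCast, ← map_natCast (C : ZMod p →+* (ZMod p)[X]), ZMod.natCast_self, map_zero,
      map_zero]

end Speh

namespace Speh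

/-! ### Archimedean multiplicative seminorms come from complex points -/

/-- A linear map on a finite-dimensional space is bounded; applying the bound to `x ^ n` and taking
roots removes the constant. -/
theorem norm_le_norm_of_algHom {E F : Type*} [NormedField E] [NormedAlgebra ℝ E] [NormedField F]
    [NormedAlgebra ℝ F] [FiniteDimensional ℝ E] (e : E →ₐ[ℝ] F) (x : E) : ‖e x‖ ≤ ‖x‖ := by
  let L : E →L[ℝ] F := LinearMap.toContinuousLinearMap e.toLinearMap
  have hL : ∀ y, ‖e y‖ ≤ ‖L‖ * ‖y‖ := fun y => L.le_opNorm y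
  obtain ⟨N, hN⟩ := exists_nat_ge ‖L‖
  have := temperedGrowth_nnreal.le_of_pow_le (C N) (x := ‖e x‖₊) (y := ‖x‖₊) fun n => by
    rw [eval_C, ← nnnorm_pow, ← nnnorm_pow, ← map_pow, ← NNReal.coe_le_coe]
    push_cast
    exact (hL _).trans (mul_le_mul_of_nonneg_right hN (norm_nonneg _))
  exact this

theorem norm_algEquiv {E F : Type*} [NormedField E] [NormedAlgebra ℝ E] [NormedField F]
    [NormedAlgebra ℝ F] [FiniteDimensional ℝ F] (e : E ≃ₐ[ℝ] F) (x : E) : ‖e x‖ = ‖x‖ := by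
  have : FiniteDimensional ℝ E := e.symm.toLinearEquiv.finiteDimensional
  refine le_antisymm (norm_le_norm_of_algHom e.toAlgHom x) ?_
  have := norm_le_norm_of_algHom e.symm.toAlgHom (e x)
  simpa using this

/-- The norm is the usual one on `ℚ`, so by completeness the inclusion of `ℚ` extends to an
isometric `ℝ → F`. By Gelfand–Mazur `F` is then `ℝ` or `ℂ` as an algebra, and `norm_algEquiv` makes
the isomorphism isometric. -/
theorem exists_isometric_ringHom_complex {F : Type*} [NormedField F] [CompleteSpace F]
    (hF : ∀ n : ℕ, ‖(n : F)‖ = n) : ∃ g : F →+* ℂ, ∀ x, ‖g x‖ = ‖x‖ := by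
  have h0 : CharZero F := ⟨fun m n h => by
    have := hF m
    rw [h, hF n] at this
    exact_mod_cast this.symm⟩
  have hint : ∀ n : ℤ, ‖(n : F)‖ = |(n : ℝ)| := fun n => by
    obtain ⟨m, rfl | rfl⟩ := n.eq_nat_or_neg <;> simp [hF]
  have hrat : ∀ r : ℚ, ‖(r : F)‖ = |(r : ℝ)| := fun r => by
    rw [← Rat.num_div_den r]
    push_cast
    rw [norm_div, hint, hF, abs_div, Nat.abs_cast]
  have hiso : Isometry (Rat.castHom F) := by
    refine Isometry.of_dist_eq fun x y => ?_
    rw [dist_eq_norm, ← map_sub, Rat.coe_castHom, hrat, Rat.dist_eq]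
    push_cast
    rfl
  have hi : IsUniformInducing (Rat.castHom ℝ) := Rat.isUniformEmbedding_coe_real.isUniformInducing
  have hd : DenseRange (Rat.castHom ℝ) := Rat.isDenseEmbedding_coe_real.dense
  let φ : ℝ →+* F := IsDenseInducing.extendRingHom hi hd hiso.uniformContinuous
  have hφc : Continuous φ :=
    (uniformContinuous_uniformly_extend hi hd hiso.uniformContinuous).continuous
  have hφ : ∀ r : ℚ, φ (r : ℝ) = r := fun r =>
    IsDenseInducing.extend_eq (hi.isDenseInducing hd) hiso.continuous r
  have hnorm : ∀ x : ℝ, ‖φ x‖ = ‖x‖ := by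
    refine isClosed_property hd (isClosed_eq hφc.norm continuous_norm) fun r => ?_
    rw [Rat.coe_castHom, hφ, hrat, Real.norm_eq_abs]
  let _ : Algebra ℝ F := φ.toAlgebra
  let _ : NormedAlgebra ℝ F := ⟨fun r x => by
    rw [Algebra.smul_def, norm_mul]
    exact (congrArg (· * ‖x‖) (hnorm r)).le⟩
  rcases NormedAlgebra.Real.nonempty_algEquiv_or F with ⟨⟨e⟩⟩ | ⟨⟨e⟩⟩
  · refine ⟨(Complex.ofRealHom : ℝ →+* ℂ).comp (e : F →+* ℝ), fun x => ?_⟩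
    rw [← norm_algEquiv e x]
    exact Complex.norm_real _
  · exact ⟨(e : F →+* ℂ), fun x => norm_algEquiv e x⟩

/-- The kernel is prime and `ν` induces an absolute value on the residue field, whose completion
embeds isometrically in `ℂ`. -/
theorem exists_complex_of_natCast {A : Type} [CommRing A] (ν : MulRingSeminorm A)
    (hν : ∀ n : ℕ, ν (n : A) = n) : ∃ g : A →+* ℂ, ∀ a, ν a = ‖g a‖ := by
  let I : Ideal A :=
    { carrier := {a | ν a = 0}
      add_mem' := fun {a b} ha hb => by
        have := map_add_le_add ν a b
        rw [Set.mem_ofPred_eq] at *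
        rw [ha, hb, add_zero] at this
        exact le_antisymm this (apply_nonneg ν _)
      zero_mem' := map_zero ν
      smul_mem' := fun c a ha => by
        rw [Set.mem_ofPred_eq] at *
        rw [smul_eq_mul, map_mul, ha, mul_zero] }
  have hI : ∀ a, a ∈ I ↔ ν a = 0 := fun a => Iff.rfl
  have hprime : I.IsPrime := by
    refine ⟨fun h => ?_, fun {a b} hab => ?_⟩
    · have := (hI 1).mp (h ▸ Submodule.mem_top)
      simp at this
    · rw [hI, map_mul] at hab
      exact mul_eq_zero.mp hab
  let K := FractionRing (A ⧸ I)
  let φ : A →+* K := (algebraMap (A ⧸ I) K).comp (Ideal.Quotient.mk I)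
  have hφ0 : ∀ a, φ a = 0 ↔ a ∈ I := fun a => by
    rw [RingHom.comp_apply, FaithfulSMul.algebraMap_eq_zero_iff, Ideal.Quotient.eq_zero_iff_mem]
  have hz : ∀ a, (realSeminorm ν).hom a = 0 ↔ ν a = 0 := fun a => by
    refine Iff.trans (Real.toNNReal_eq_zero) ?_
    exact ⟨fun h => le_antisymm h (apply_nonneg ν a), fun h => h.le⟩
  have hfrac : ∀ F : K, ∃ a s, (realSeminorm ν).hom s ≠ 0 ∧ φ s * F = φ a := fun F => by
    obtain ⟨a, s, hs, rfl⟩ := IsFractionRing.div_surjective (A := A ⧸ I) F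
    obtain ⟨a, rfl⟩ := Ideal.Quotient.mk_surjective a
    obtain ⟨s, rfl⟩ := Ideal.Quotient.mk_surjective s
    have hs' : φ s ≠ 0 := by
      rw [RingHom.comp_apply, Ne, FaithfulSMul.algebraMap_eq_zero_iff]
      exact nonZeroDivisors.ne_zero hs
    exact ⟨a, s, by rwa [Ne, hz, ← hI, ← hφ0], mul_div_cancel₀ _ hs'⟩
  let w := (realSeminorm ν).extend φ (fun a ha => (hz a).mpr ((hφ0 a).mp ha)) hfrac
  have hw : ∀ a, w.hom (φ a) = (ν a).toNNReal := fun a =>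
    (realSeminorm ν).extend_hom φ (fun a ha => (hz a).mpr ((hφ0 a).mp ha)) hfrac a
  let abv : AbsoluteValue K ℝ :=
    { toFun := fun x => NNReal.toReal (w.hom x)
      map_mul' := fun x y => by
        rw [_root_.map_mul]; exact NNReal.coe_mul _ _
      nonneg' := fun x => NNReal.coe_nonneg _
      eq_zero' := fun x => by
        refine NNReal.coe_eq_zero.trans ?_
        exact map_eq_zero w.hom
      add_le' := fun x y => w.hom_add_le x y }
  let _ : NormedField K := abv.toNormedField
  have hnorm : ∀ a, ‖φ a‖ = ν a := fun a => by
    change NNReal.toReal (w.hom (φ a)) = ν a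
    rw [hw]
    exact Real.coe_toNNReal _ (apply_nonneg ν a)
  obtain ⟨g, hg⟩ := exists_isometric_ringHom_complex (F := UniformSpace.Completion K) fun n => by
    have h1 : (n : UniformSpace.Completion K) = ((n : K) : UniformSpace.Completion K) :=
      (map_natCast (UniformSpace.Completion.coeRingHom (α := K)) n).symm
    rw [h1, UniformSpace.Completion.norm_coe, ← hν n, ← hnorm, map_natCast]
  refine ⟨g.comp (UniformSpace.Completion.coeRingHom.comp φ), fun a => ?_⟩
  rw [RingHom.comp_apply, hg, ← hnorm]
  exact (UniformSpace.Completion.norm_coe _).symm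

/-! ### The real seminorm underlying a bounded archimedean seminorm -/

theorem exists_nat_div_btwn {x y : ℝ} (hx : 0 ≤ x) (h : x < y) :
    ∃ r d : ℕ, 0 < d ∧ x < r / d ∧ (r / d : ℝ) < y := by
  obtain ⟨q, h1, h2⟩ := exists_rat_btwn h
  have hq : 0 < q := by exact_mod_cast hx.trans_lt h1
  have : (q : ℝ) = (q.num.toNat : ℝ) / q.den := by
    have h3 : ((q.num.toNat : ℤ) : ℝ) = q.num := by
      rw [Int.toNat_of_nonneg (Rat.num_nonneg.mpr hq.le)]
    rw [Int.cast_natCast] at h3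
    rw [h3, Rat.cast_def]
  exact ⟨q.num.toNat, q.den, q.pos, this ▸ h1, this ▸ h2⟩

namespace TMSeminorm

section Arch

variable {A : Type u} [CommRing A] {v : TMSeminorm A}

theorem IsArch.natCast_pos (hv : v.IsArch) {n : ℕ} (hn : 0 < n) : 0 < v.hom (n : A) := by
  have := (hv 0 n).not
  by_contra! h
  have := (hv n 0).mp (by simpa using h)
  omega

theorem IsArch.mul_le_mul_iff (hv : v.IsArch) (m n : ℕ) {x : v.R} (hx : x ≠ 0) :
    v.hom (m : A) * x ≤ v.hom (n : A) * x ↔ m ≤ n := by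
  rw [mul_le_mul_iff_left₀ (zero_lt_iff.mpr hx), hv]

variable (v) in
/-- The real seminorm of an archimedean seminorm. -/
noncomputable def archVal (a : A) : ℝ :=
  sInf {x : ℝ | ∃ r d : ℕ, 0 < d ∧ x = r / d ∧ v.hom a * v.hom (d : A) ≤ v.hom (r : A)}

theorem archVal_nonneg (a : A) : 0 ≤ v.archVal a := by
  refine Real.sInf_nonneg ?_
  rintro _ ⟨r, d, _, rfl, _⟩
  positivity

theorem archVal_le {a : A} {r d : ℕ} (hd : 0 < d) (h : v.hom a * v.hom (d : A) ≤ v.hom (r : A)) :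
    v.archVal a ≤ r / d := by
  refine csInf_le ⟨0, ?_⟩ ⟨r, d, hd, rfl, h⟩
  rintro _ ⟨r, d, _, rfl, _⟩
  positivity

theorem IsArch.le_archVal (hv : v.IsArch) {a : A} (ha : ∃ m : ℕ, v.hom a ≤ v.hom (m : A)) {r d : ℕ}
    (hd : 0 < d) (h : v.hom (r : A) ≤ v.hom a * v.hom (d : A)) : (r / d : ℝ) ≤ v.archVal a := by
  obtain ⟨m, hm⟩ := ha
  -- Boundedness of `a` is used here to make the set nonempty; the infimum of the empty set would be
  -- 0.
  refine le_csInf ⟨m, m, 1, one_pos, by simp, by simpa using hm⟩ ?_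
  rintro _ ⟨r', d', hd', rfl, h'⟩
  rw [div_le_div_iff₀ (by positivity) (by positivity)]
  norm_cast
  rw [← hv, Nat.cast_mul, Nat.cast_mul, _root_.map_mul, _root_.map_mul]
  calc v.hom (r : A) * v.hom (d' : A) ≤ v.hom a * v.hom (d : A) * v.hom (d' : A) :=
        mul_le_mul' h le_rfl
    _ = v.hom a * v.hom (d' : A) * v.hom (d : A) := by ring
    _ ≤ _ := mul_le_mul' h' le_rfl

theorem IsArch.hom_mul_le_of_archVal_lt (hv : v.IsArch) {a : A}
    (ha : ∃ m : ℕ, v.hom a ≤ v.hom (m : A)) {r d : ℕ} (hd : 0 < d) (h : v.archVal a < r / d) :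
    v.hom a * v.hom (d : A) ≤ v.hom (r : A) := by
  by_contra! h'
  exact not_lt_of_ge (hv.le_archVal ha hd h'.le) h

theorem le_hom_mul_of_lt_archVal {a : A} {r d : ℕ} (hd : 0 < d) (h : r / d < v.archVal a) :
    v.hom (r : A) ≤ v.hom a * v.hom (d : A) := by
  by_contra! h'
  exact not_lt_of_ge (archVal_le hd h'.le) h

theorem IsArch.archVal_natCast (hv : v.IsArch) (n : ℕ) : v.archVal (n : A) = n := by
  refine le_antisymm ?_ ?_
  · simpa using archVal_le (v := v) (a := (n : A)) (r := n) (d := 1) one_pos (by simp)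
  · simpa using hv.le_archVal (a := (n : A)) ⟨n, le_rfl⟩ (r := n) (d := 1) one_pos (by simp)

theorem archVal_neg (a : A) : v.archVal (-a) = v.archVal a := by
  simp only [archVal, hom_neg]

/-- The addition of the aura only bounds `|a + b|` by `|r| + |s|`, which may exceed `|r + s|`. The
sharper `hom_add_mul_le` is applied to approximating fractions over a common denominator. -/
theorem IsArch.archVal_add (hv : v.IsArch) (hb : ∀ a, ∃ m : ℕ, v.hom a ≤ v.hom (m : A)) (a b : A) :
    v.archVal (a + b) ≤ v.archVal a + v.archVal b := by
  refine le_of_forall_pos_le_add fun ε hε => ?_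
  obtain ⟨r, d, hd, h1, h2⟩ := exists_nat_div_btwn (archVal_nonneg a)
    (lt_add_of_pos_right (v.archVal a) (half_pos hε))
  obtain ⟨s, e, he, h3, h4⟩ := exists_nat_div_btwn (archVal_nonneg b)
    (lt_add_of_pos_right (v.archVal b) (half_pos hε))
  have h5 := hv.hom_mul_le_of_archVal_lt (hb a) hd h1
  have h6 := hv.hom_mul_le_of_archVal_lt (hb b) he h3
  have h7 : v.hom a * v.hom ((d * e : ℕ) : A) ≤ v.hom ((r * e : ℕ) : A) * v.hom (1 : A) := by
    push_cast
    rw [map_one, mul_one, _root_.map_mul, _root_.map_mul, ← mul_assoc]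
    exact mul_le_mul' h5 le_rfl
  have h8 : v.hom b * v.hom ((d * e : ℕ) : A) ≤ v.hom ((s * d : ℕ) : A) * v.hom (1 : A) := by
    push_cast
    rw [map_one, mul_one, _root_.map_mul, _root_.map_mul, mul_comm (v.hom (d : A)), ← mul_assoc]
    exact mul_le_mul' h6 le_rfl
  have h9 := v.hom_add_mul_le (fun m n h => (hv m n).mpr h) h7 h8
  rw [map_one, mul_one] at h9
  have h10 := archVal_le (Nat.mul_pos hd he) h9
  have h11 : (((r * e + s * d : ℕ) : ℝ) / ((d * e : ℕ) : ℝ)) = r / d + s / e := by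
    push_cast
    have : (d : ℝ) ≠ 0 := by positivity
    have : (e : ℝ) ≠ 0 := by positivity
    field_simp
  rw [h11] at h10
  linarith

theorem IsArch.archVal_mul (hv : v.IsArch) (hb : ∀ a, ∃ m : ℕ, v.hom a ≤ v.hom (m : A)) (a b : A) :
    v.archVal (a * b) = v.archVal a * v.archVal b := by
  refine le_antisymm ?_ ?_
  · refine le_mul_of_forall_lt₀ fun x hx y hy => ?_
    obtain ⟨r, d, hd, h1, h2⟩ := exists_nat_div_btwn (archVal_nonneg a) hx
    obtain ⟨s, e, he, h3, h4⟩ := exists_nat_div_btwn (archVal_nonneg b) hy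
    have h5 := mul_le_mul' (hv.hom_mul_le_of_archVal_lt (hb a) hd h1)
      (hv.hom_mul_le_of_archVal_lt (hb b) he h3)
    have h6 : v.hom (a * b) * v.hom ((d * e : ℕ) : A) ≤ v.hom ((r * s : ℕ) : A) := by
      push_cast
      rw [_root_.map_mul, _root_.map_mul, _root_.map_mul]
      refine le_trans (le_of_eq ?_) h5
      ring
    have h7 := archVal_le (Nat.mul_pos hd he) h6
    push_cast at h7
    rw [mul_div_mul_comm] at h7
    exact h7.trans (mul_le_mul h2.le h4.le (by positivity) ((archVal_nonneg a).trans hx.le))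
  · refine mul_le_of_forall_lt_of_nonneg (archVal_nonneg a) (archVal_nonneg _)
      fun x hx0 hx y hy0 hy => ?_
    obtain ⟨r, d, hd, h1, h2⟩ := exists_nat_div_btwn hx0 hx
    obtain ⟨s, e, he, h3, h4⟩ := exists_nat_div_btwn hy0 hy
    have h5 := mul_le_mul' (le_hom_mul_of_lt_archVal hd h2) (le_hom_mul_of_lt_archVal he h4)
    have h6 : v.hom ((r * s : ℕ) : A) ≤ v.hom (a * b) * v.hom ((d * e : ℕ) : A) := by
      push_cast
      rw [_root_.map_mul, _root_.map_mul, _root_.map_mul]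
      refine h5.trans (le_of_eq ?_)
      ring
    have h7 := hv.le_archVal (hb _) (Nat.mul_pos hd he) h6
    push_cast at h7
    rw [mul_div_mul_comm] at h7
    exact (mul_le_mul h1.le h3.le hy0 (by positivity)).trans h7

end Arch

/-! ### Seminorms infinitesimally close to a complex point -/

section ArchAt

variable {A : Type} [CommRing A] {v : TMSeminorm A}

/-- The seminorm `v` is infinitesimally close to the complex point `g`. -/
structure IsArchAt (v : TMSeminorm A) (g : A →+* ℂ) : Prop where
  isArch : v.IsArch
  le_hom : ∀ (a : A) (r d : ℕ), 0 < d → r / d < ‖g a‖ → v.hom (r : A) ≤ v.hom a * v.hom (d : A)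
  hom_le : ∀ (a : A) (r d : ℕ), 0 < d → ‖g a‖ < r / d → v.hom a * v.hom (d : A) ≤ v.hom (r : A)

theorem IsArch.exists_isArchAt (hv : v.IsArch) (hb : ∀ a, ∃ m : ℕ, v.hom a ≤ v.hom (m : A)) :
    ∃ g : A →+* ℂ, v.IsArchAt g := by
  let ν : MulRingSeminorm A :=
    { toFun := v.archVal
      map_zero' := by simpa using hv.archVal_natCast 0
      add_le' := hv.archVal_add hb
      neg' := archVal_neg
      map_one' := by simpa using hv.archVal_natCast 1
      map_mul' := hv.archVal_mul hb }
  obtain ⟨g, hg⟩ := exists_complex_of_natCast ν hv.archVal_natCast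
  have hg : ∀ a, v.archVal a = ‖g a‖ := hg
  exact ⟨g, hv, fun a r d hd h => le_hom_mul_of_lt_archVal hd (by rwa [hg]),
    fun a r d hd h => hv.hom_mul_le_of_archVal_lt (hb a) hd (by rwa [hg])⟩

variable {g : A →+* ℂ}

/-- Two fractions are inserted between the norms: the strict inequality between them is one between
integers, where `v` has the usual order. -/
theorem IsArchAt.hom_lt (h : v.IsArchAt g) {a b : A} (hab : ‖g a‖ < ‖g b‖) :
    v.hom a < v.hom b := by
  obtain ⟨r, d, hd, h1, h2⟩ := exists_nat_div_btwn (norm_nonneg _) hab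
  obtain ⟨s, e, he, h3, h4⟩ := exists_nat_div_btwn (by positivity) h2
  have h5 := h.hom_le a r d hd h1
  have h6 := h.le_hom b s e he h4
  by_contra! hle
  have h7 : v.hom ((s * d : ℕ) : A) ≤ v.hom ((r * e : ℕ) : A) := by
    push_cast
    rw [_root_.map_mul, _root_.map_mul]
    calc v.hom (s : A) * v.hom (d : A) ≤ v.hom b * v.hom (e : A) * v.hom (d : A) :=
          mul_le_mul' h6 le_rfl
      _ ≤ v.hom a * v.hom (e : A) * v.hom (d : A) := mul_le_mul' (mul_le_mul' hle le_rfl) le_rfl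
      _ = v.hom a * v.hom (d : A) * v.hom (e : A) := by ring
      _ ≤ _ := mul_le_mul' h5 le_rfl
  rw [h.isArch] at h7
  rw [div_lt_div_iff₀ (by positivity) (by positivity)] at h3
  norm_cast at h3
  omega

/-- Closeness to `g` directly controls strict inequalities only. When the norms may be equal, a
factor 2 makes the inequality between `n`-th powers strict, and tempered growth removes it again. -/
theorem IsArchAt.hom_le_hom_iff (h : v.IsArchAt g) {a b : A} (hb : g b ≠ 0) :
    v.hom a ≤ v.hom b ↔ ‖g a‖ ≤ ‖g b‖ := by
  refine ⟨fun hle => ?_, fun hle => ?_⟩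
  · by_contra! hlt
    exact not_le_of_gt (h.hom_lt hlt) hle
  · refine v.tempered.le_of_pow_le (C 2) fun n => ?_
    rw [← map_pow, ← map_pow, eval_C]
    have h1 : v.hom (a ^ n) < v.hom (2 * b ^ n) := by
      refine h.hom_lt ?_
      have hpos : 0 < ‖g b‖ ^ n := pow_pos (norm_pos_iff.mpr hb) n
      have := pow_le_pow_left₀ (norm_nonneg _) hle n
      rw [map_pow, norm_pow, _root_.map_mul, map_pow, norm_mul, norm_pow, map_ofNat, RCLike.norm_ofNat]
      linarith
    refine h1.le.trans ?_
    rw [_root_.map_mul]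
    have h2 := v.hom_natCast_le 2
    push_cast at h2 ⊢
    exact mul_le_mul' h2 le_rfl

end ArchAt

end TMSeminorm

end Speh

namespace Speh

namespace TMSeminorm

/-! ### Cofinal archimedean seminorms -/

section ArchLine

variable {A : Type} [CommRing A] {v : TMSeminorm A}

theorem IsArch.one_le_of_ne_zero (hv : v.IsArch) {n : ℤ} (hn : v.hom (n : A) ≠ 0) :
    1 ≤ v.hom (n : A) := by
  rw [hom_intCast_natAbs] at *
  have := (hv 1 n.natAbs).mpr (Nat.one_le_iff_ne_zero.mpr fun h => hn (by rw [h]; simp))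
  simpa using this

theorem IsCofinal.exists_natCast (h : v.IsCofinal) (hv : v.IsArch) (a : A) :
    ∃ m : ℕ, v.hom a ≤ v.hom (m : A) := by
  by_cases ha : v.hom a = 0
  · exact ⟨0, by simp [ha]⟩
  obtain ⟨n, m, hn, hle⟩ := (h a ha).1
  refine ⟨m.natAbs, ?_⟩
  rw [← hom_intCast_natAbs]
  exact (le_mul_of_one_le_left' (hv.one_le_of_ne_zero hn)).trans hle

/-- If `g b = 0`, all integer multiples of `b` have value less than 1, so a nonzero value of `b` is
an infinitesimal that no fraction of integers bounds from below. -/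
theorem IsArchAt.isCofinal_iff {g : A →+* ℂ} (h : v.IsArchAt g) :
    v.IsCofinal ↔ ∀ b, g b = 0 → v.hom b = 0 := by
  constructor
  · intro hc b hb
    by_contra h0
    obtain ⟨n, m, hn, hle⟩ := (hc b h0).2
    have h1 : v.hom (1 : A) ≤ v.hom ((m : A) * b) := by
      rw [map_one, _root_.map_mul]
      exact (h.isArch.one_le_of_ne_zero hn).trans hle
    have h2 : v.hom ((m : A) * b) < v.hom (1 : A) := h.hom_lt (by
      rw [_root_.map_mul, hb]; simp)
    exact not_le_of_gt h2 h1
  · intro hker a ha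
    have hga : g a ≠ 0 := fun h0 => ha (hker a h0)
    constructor
    · obtain ⟨m, hm⟩ := exists_nat_ge ‖g a‖
      rcases m.eq_zero_or_pos with rfl | hm0
      · exact absurd (norm_le_zero_iff.mp (by simpa using hm)) hga
      refine ⟨1, m, by simp, ?_⟩
      rw [← _root_.map_mul, h.hom_le_hom_iff (by simpa using hm0.ne')]
      simpa using hm
    · obtain ⟨m, hm⟩ := exists_nat_gt (1 / ‖g a‖)
      refine ⟨1, m, by simp, ?_⟩
      rw [← _root_.map_mul]
      refine (h.hom_lt ?_).le
      rw [div_lt_iff₀ (norm_pos_iff.mpr hga)] at hm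
      simpa using hm

theorem IsArch.exists_place_eq (hv : v.IsArch) (hc : v.IsCofinal) :
    ∃ g : A →+* ℂ, v.place = (normPlace ℂ).comap g := by
  obtain ⟨g, hg⟩ := hv.exists_isArchAt (hc.exists_natCast hv)
  refine ⟨g, (v.place_eq_normPlace_comap_iff g).mpr fun a b => ?_⟩
  by_cases hb : g b = 0
  · rw [hb, norm_zero, norm_le_zero_iff, (hg.isCofinal_iff.mp hc) b hb, le_zero_iff]
    refine ⟨fun ha => ?_, (hg.isCofinal_iff.mp hc) a⟩
    by_contra hga
    have := hg.hom_lt (a := b) (b := a) (by rw [hb, norm_zero]; exact norm_pos_iff.mpr hga)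
    rw [ha] at this
    exact not_lt_of_ge zero_le this
  · exact hg.hom_le_hom_iff hb

end ArchLine

end TMSeminorm

/-! ### Real points of the affine line -/

theorem complexPoint_eq (g : ℤ[X] →+* ℂ) : complexPoint (g X) = (normPlace ℂ).comap g := by
  have : (aeval (g X)).toRingHom = g := by
    refine Polynomial.ringHom_ext (fun n => ?_) ?_
    · simp
    · exact aeval_X _
  rw [complexPoint, this]

theorem normPlace_complex_comap_mem_RPoints (g : ℤ[X] →+* ℂ) :
    (normPlace ℂ).comap g ∈ RPoints := by
  refine (place_mem_RPoints_iff (complexSeminorm g)).mpr fun m n => ?_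
  rw [complexSeminorm_hom_le]
  simp

theorem normPlace_complex_comap_mem_range_realPlace {A : Type} [CommRing A] (g : A →+* ℂ) :
    (normPlace ℂ).comap g ∈ Set.range (realPlace (A := A)) := by
  let ν : MulRingSeminorm A :=
    { toFun := fun a => ‖g a‖
      map_zero' := by simp
      add_le' := fun a b => by rw [map_add]; exact norm_add_le _ _
      neg' := fun a => by rw [map_neg, norm_neg]
      map_one' := by simp
      map_mul' := fun a b => by rw [map_mul, norm_mul] }
  refine ⟨ν, ?_⟩
  rw [← complexSeminorm_place, eq_comm, TMSeminorm.place_eq_realPlace_iff]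
  intro a b
  rw [complexSeminorm_hom_le]
  rfl

/-- Since `ν 2 > 1`, the values of the powers of 2 are unbounded in `ℝ`. -/
theorem realSeminorm_isCofinal {A : Type} [CommRing A] (ν : MulRingSeminorm A)
    (h : (realSeminorm ν).IsArch) : (realSeminorm ν).IsCofinal := by
  have h2 : 1 < ν ((2 : ℕ) : A) := by
    have := (h 2 1).not
    rw [realSeminorm_hom_le] at this
    simpa using this
  have big : ∀ x : ℝ, ∃ m : ℕ, x < ν (m : A) := fun x => by
    obtain ⟨k, hk⟩ := pow_unbounded_of_one_lt x h2
    exact ⟨2 ^ k, by rw [Nat.cast_pow, map_pow]; exact hk⟩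
  intro a ha
  have ha' : 0 < ν a := by
    by_contra! h0
    exact ha (Real.toNNReal_eq_zero.mpr h0)
  constructor
  · obtain ⟨m, hm⟩ := big (ν a)
    refine ⟨1, m, by simp, ?_⟩
    rw [← map_mul, realSeminorm_hom_le]
    simpa using hm.le
  · obtain ⟨m, hm⟩ := big (1 / ν a)
    refine ⟨1, m, by simp, ?_⟩
    rw [← map_mul, realSeminorm_hom_le]
    rw [div_lt_iff₀ ha'] at hm
    simpa using hm.le

theorem isCofinal_iff_mem_SpehA_of_isArch {v : TMSeminorm ℤ[X]} (hv : v.IsArch) :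
    v.IsCofinal ↔ v.place ∈ SpehA ℤ[X] := by
  constructor
  · intro h
    obtain ⟨g, hg⟩ := hv.exists_place_eq h
    rw [hg]
    exact normPlace_complex_comap_mem_SpehA g
  · intro h
    have h2 : (1 : v.R) < v.hom ((2 : ℤ) : ℤ[X]) := by
      have := (hv 2 1).not
      simpa using this
    exact TMSeminorm.isCofinal_of_mem_SpehA h (zero_lt_one.trans h2).ne' h2.ne'

theorem RPoints_inter_SpehA : RPoints ∩ SpehA ℤ[X] = Set.range complexPoint := by
  ext x
  constructor
  · rintro ⟨hx, hA⟩
    obtain ⟨v, rfl⟩ := TMSeminorm.exists_place x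
    have hv := (place_mem_RPoints_iff v).mp hx
    obtain ⟨g, hg⟩ := hv.exists_place_eq ((isCofinal_iff_mem_SpehA_of_isArch hv).mpr hA)
    exact ⟨g X, by rw [complexPoint_eq, hg]⟩
  · rintro ⟨z, rfl⟩
    exact ⟨normPlace_complex_comap_mem_RPoints _, normPlace_complex_comap_mem_SpehA _⟩

theorem RPoints_inter_range_realPlace :
    RPoints ∩ SpehA ℤ[X] = RPoints ∩ Set.range realPlace := by
  ext x
  constructor
  · rintro ⟨hx, hA⟩
    refine ⟨hx, ?_⟩
    obtain ⟨z, rfl⟩ : x ∈ Set.range complexPoint := RPoints_inter_SpehA ▸ ⟨hx, hA⟩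
    exact normPlace_complex_comap_mem_range_realPlace _
  · rintro ⟨hx, ν, rfl⟩
    refine ⟨hx, ?_⟩
    have hv := (place_mem_RPoints_iff (realSeminorm ν)).mp hx
    exact (isCofinal_iff_mem_SpehA_of_isArch hv).mp (realSeminorm_isCofinal ν hv)

/-! ### Infinitesimal neighbourhoods of algebraic complex points -/

theorem exists_int_poly {L : Type} [Field L] [CharZero L] {F : ℚ[X]} (hF : F ≠ 0) :
    ∃ (P : ℤ[X]) (d : ℚ), d ≠ 0 ∧ P ≠ 0 ∧ mapRingHom (Int.castRingHom ℚ) P = C d * F ∧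
      ∀ z : L, eval₂ (Int.castRingHom L) z P = d * aeval z F := by
  obtain ⟨P, d, hd, h⟩ := exists_integer_multiple F
  have h1 : mapRingHom (Int.castRingHom ℚ) P = C (d : ℚ) * F := by
    rw [← h, map_intCast, map_intCast]
  have h2 : (d : ℚ) ≠ 0 := by exact_mod_cast hd
  refine ⟨P, d, h2, ?_, h1, fun z => ?_⟩
  · rintro rfl
    rw [map_zero] at h1
    exact mul_ne_zero (C_ne_zero.mpr h2) hF h1.symm
  · have h3 := congrArg (aeval z) h1
    rw [map_mul, aeval_C, coe_mapRingHom, aeval_def, eval₂_map] at h3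
    rw [show Int.castRingHom L = (algebraMap ℚ L).comp (Int.castRingHom ℚ) from
      RingHom.ext_int _ _, h3]
    simp

/-- For an algebraic point, a polynomial `π` such that every nonzero polynomial is, up to a nonzero
integer, the product of a power of `π` and of a polynomial that does not vanish at the point. -/
theorem exists_uniformizer {L : Type} [Field L] [CharZero L] (g : ℤ[X] →+* L) {b : ℤ[X]}
    (hb0 : b ≠ 0) (hb : g b = 0) : ∃ π : ℤ[X], g π = 0 ∧ ∀ P : ℤ[X], P ≠ 0 →
      ∃ (n : ℕ) (d : ℤ) (Q : ℤ[X]), d ≠ 0 ∧ g Q ≠ 0 ∧ (d : ℤ[X]) * P = π ^ n * Q := by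
  set z := g X with hz
  have hg : ∀ P, g P = eval₂ (Int.castRingHom L) z P := fun P => by
    have : g = eval₂RingHom (Int.castRingHom L) z :=
      Polynomial.ringHom_ext (fun n => by simp) (by simp [hz])
    conv_lhs => rw [this]
    rfl
  have hinj : Function.Injective (mapRingHom (Int.castRingHom ℚ)) :=
    map_injective _ Int.cast_injective
  have hgQ : ∀ P, g P = aeval z (mapRingHom (Int.castRingHom ℚ) P) := fun P => by
    rw [hg, coe_mapRingHom, aeval_def, eval₂_map]
    congr 1
    exact RingHom.ext_int _ _
  have halg : IsIntegral ℚ z := by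
    refine IsAlgebraic.isIntegral ⟨mapRingHom (Int.castRingHom ℚ) b, ?_, ?_⟩
    · exact fun h => hb0 (hinj (by rw [h, map_zero]))
    · rw [← hgQ, hb]
  -- Over `ℚ`, the uniformizer `π` is `c` times the minimal polynomial of `z`; the factor `(c ^
  -- n)⁻¹` in the definition of `Q` below compensates for `c`.
  obtain ⟨π, c, hc, hπ0, hπ, hπz⟩ := exists_int_poly (L := L) (minpoly.ne_zero halg)
  refine ⟨π, by rw [hg, hπz, minpoly.aeval, mul_zero], fun P hP => ?_⟩
  have hP' : mapRingHom (Int.castRingHom ℚ) P ≠ 0 := fun h => hP (hinj (by rw [h, map_zero]))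
  obtain ⟨n, q, hq, hPq⟩ := WfDvdMonoid.max_power_factor hP' (minpoly.irreducible halg)
  obtain ⟨Q, d, hd⟩ := exists_integer_multiple (C (c ^ n)⁻¹ * q)
  refine ⟨n, d, Q, hd.1, ?_, hinj ?_⟩
  · rw [hgQ, ← hd.2]
    intro h0
    rw [map_mul, map_mul, aeval_C, map_intCast, map_intCast] at h0
    rcases mul_eq_zero.mp h0 with h1 | h1
    · exact hd.1 (by exact_mod_cast h1)
    rcases mul_eq_zero.mp h1 with h2 | h2
    · rw [map_eq_zero] at h2
      exact inv_ne_zero (pow_ne_zero n hc) h2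
    · exact hq (minpoly.dvd ℚ z h2)
  · rw [map_mul, map_mul, map_pow, ← hd.2, hPq, hπ, mul_pow, ← C_pow]
    have : C (c ^ n) * C (c ^ n)⁻¹ = (1 : ℚ[X]) := by
      rw [← C_mul, mul_inv_cancel₀ (pow_ne_zero n hc), C_1]
    linear_combination (-(mapRingHom (Int.castRingHom ℚ) (d : ℤ[X])) * minpoly ℚ z ^ n * q) * this

theorem TMSeminorm.IsArchAt.hom_intCast_ne_zero {A : Type} [CommRing A] {v : TMSeminorm A}
    {g : A →+* ℂ} (hv : v.IsArchAt g) {d : ℤ} (hd : d ≠ 0) : v.hom (d : A) ≠ 0 := by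
  have := (hv.isArch.hom_intCast_le_iff d 0).not
  simpa [hd] using this

/-- A nonzero power of an infinitesimal element determines the order. -/
theorem TMSeminorm.IsArchAt.pow_mul_le_iff {A : Type} [CommRing A] {v : TMSeminorm A}
    {g : A →+* ℂ} (hv : v.IsArchAt g) {π : A} (hπ : g π = 0) (hπ0 : v.hom π ≠ 0) {m n : ℕ} {a b : A}
    (ha : g a ≠ 0) (hb : g b ≠ 0) : v.hom (π ^ m * a) ≤ v.hom (π ^ n * b) ↔
      n < m ∨ n = m ∧ ‖g a‖ ≤ ‖g b‖ := by
  have lt : ∀ (m n : ℕ) (a b : A), n < m → g b ≠ 0 →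
      v.hom (π ^ m * a) < v.hom (π ^ n * b) := by
    intro m n a b h hb
    obtain ⟨k, rfl⟩ := Nat.exists_eq_add_of_lt h
    have h1 : v.hom (π ^ (k + 1) * a) < v.hom b := hv.hom_lt (by
      rw [_root_.map_mul, map_pow, hπ]
      simpa using hb)
    have h2 : π ^ (n + k + 1) * a = π ^ n * (π ^ (k + 1) * a) := by ring
    rw [h2, _root_.map_mul v.hom (π ^ n), _root_.map_mul v.hom (π ^ n)]
    exact mul_lt_mul_of_pos_left h1 (zero_lt_iff.mpr (by rw [map_pow]; exact pow_ne_zero _ hπ0))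
  rcases lt_trichotomy n m with h | rfl | h
  · exact iff_of_true (lt m n a b h hb).le (Or.inl h)
  · rw [_root_.map_mul, _root_.map_mul, mul_le_mul_iff_right₀
      (zero_lt_iff.mpr (by rw [map_pow]; exact pow_ne_zero _ hπ0)), hv.hom_le_hom_iff hb]
    simp
  · exact iff_of_false (not_le_of_gt (lt n m b a h ha)) (by rintro (h1 | ⟨h1, -⟩) <;> omega)

/-- Without cofinality there is a nonzero infinitesimal, so `g X` is algebraic and the uniformizer
has nonzero infinitesimal value. Up to integers every nonzero polynomial is `π ^ n * Q` with `g Q ≠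
0`, and the order is lexicographic in `n` and `‖g Q‖`, data that depend on `g` only. -/
theorem TMSeminorm.IsArchAt.place_eq {v w : TMSeminorm ℤ[X]} {g : ℤ[X] →+* ℂ} (hv : v.IsArchAt g)
    (hw : w.IsArchAt g) (hvc : ¬v.IsCofinal) (hwc : ¬w.IsCofinal) : v.place = w.place := by
  have key : ∀ {v : TMSeminorm ℤ[X]}, v.IsArchAt g → ¬v.IsCofinal →
      ∃ b, g b = 0 ∧ v.hom b ≠ 0 := fun {v} hv hc => by
    rw [hv.isCofinal_iff] at hc
    push Not at hc
    exact hc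
  obtain ⟨b, hb, hb0⟩ := key hv hvc
  have hbne : b ≠ 0 := by rintro rfl; simp at hb0
  obtain ⟨π, hπ, hfact⟩ := exists_uniformizer g hbne hb
  have hπ0 : ∀ {v : TMSeminorm ℤ[X]}, v.IsArchAt g → ¬v.IsCofinal → v.hom π ≠ 0 := by
    intro v hv hc h0
    obtain ⟨b, hb, hb0⟩ := key hv hc
    obtain ⟨n, d, Q, hd, hQ, h⟩ := hfact b (by rintro rfl; simp at hb0)
    have hn : n ≠ 0 := by
      rintro rfl
      have := congrArg g h
      rw [_root_.map_mul, hb, mul_zero, pow_zero, one_mul] at this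
      exact hQ this.symm
    have := congrArg v.hom h
    rw [_root_.map_mul, _root_.map_mul, map_pow, h0, zero_pow hn, zero_mul] at this
    exact mul_ne_zero (hv.hom_intCast_ne_zero hd) hb0 this
  have hne : ∀ {v : TMSeminorm ℤ[X]}, v.IsArchAt g → ¬v.IsCofinal → ∀ P, P ≠ 0 → v.hom P ≠ 0 := by
    intro v hv hc P hP h0
    obtain ⟨n, d, Q, hd, hQ, h⟩ := hfact P hP
    have := congrArg v.hom h
    rw [_root_.map_mul, _root_.map_mul, map_pow, h0, mul_zero] at this
    refine mul_ne_zero (pow_ne_zero n (hπ0 hv hc)) (fun h1 => ?_) this.symm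
    have := hv.hom_lt (a := 0) (b := Q) (by simpa using hQ)
    rw [h1] at this
    exact not_lt_of_ge zero_le this
  rw [place_eq_iff]
  intro a b
  rcases eq_or_ne a 0 with rfl | ha
  · simp
  rcases eq_or_ne b 0 with rfl | hb
  · simp [hne hv hvc a ha, hne hw hwc a ha]
  obtain ⟨m, d, Q, hd, hQ, h⟩ := hfact a ha
  obtain ⟨n, e, S, he, hS, h'⟩ := hfact b hb
  have hge : ∀ {d : ℤ}, d ≠ 0 → g (d : ℤ[X]) ≠ 0 := fun hd => by
    rw [map_intCast]; exact_mod_cast hd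
  have main : ∀ {v : TMSeminorm ℤ[X]}, v.IsArchAt g → ¬v.IsCofinal →
      (v.hom a ≤ v.hom b ↔ n < m ∨ n = m ∧ ‖g (e * Q)‖ ≤ ‖g (d * S)‖) := by
    intro v hv hc
    rw [← hv.pow_mul_le_iff hπ (hπ0 hv hc) (by rw [_root_.map_mul]; exact mul_ne_zero (hge he) hQ)
      (by rw [_root_.map_mul]; exact mul_ne_zero (hge hd) hS)]
    -- Both factorizations are brought to the common multiplier `e * d`, which has nonzero value and
    -- cancels.
    have h1 : π ^ m * (e * Q) = (e * d) * a := by linear_combination (-(e : ℤ[X])) * h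
    have h2 : π ^ n * (d * S) = (e * d) * b := by linear_combination (-(d : ℤ[X])) * h'
    rw [h1, h2, _root_.map_mul v.hom _ a, _root_.map_mul v.hom _ b, mul_le_mul_iff_right₀]
    rw [_root_.map_mul]
    exact zero_lt_iff.mpr (mul_ne_zero (hv.hom_intCast_ne_zero he) (hv.hom_intCast_ne_zero hd))
  rw [main hv hvc, main hw hwc]

end Speh

namespace Speh

/-! ### The infinitesimal neighbourhoods of algebraic points and of infinity -/

section

variable {K : Type} [Field K] (w : AbsoluteValue K ℝ)

theorem LexAura.ofAbs_le_ofAbs {i j : ℤ} {c d : K} (hd : d ≠ 0) :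
    ofAbs w i c ≤ ofAbs w j d ↔ c = 0 ∨ i < j ∨ i = j ∧ w c ≤ w d := by
  by_cases hc : c = 0
  · simp [hc, ofAbs_zero]
  · rw [ofAbs_of_ne _ _ hc, ofAbs_of_ne _ _ hd, mk_le_mk]
    simp only [hc, false_or]
    exact Iff.rfl

theorem LexAura.ofAbs_ne_zero {i : ℤ} {c : K} (hc : c ≠ 0) : ofAbs w i c ≠ 0 := by
  rw [ofAbs_of_ne _ _ hc]
  exact mk_ne_zero _ _

theorem zeroNorm_hom_le_iff (f g : K[X]) : (zeroNorm w).hom f ≤ (zeroNorm w).hom g ↔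
    LexAura.ofAbs w (-(f.natTrailingDegree : ℤ)) f.trailingCoeff ≤
      LexAura.ofAbs w (-(g.natTrailingDegree : ℤ)) g.trailingCoeff := Iff.rfl

theorem inftyNorm_hom (f : K[X]) :
    (inftyNorm w).hom f = LexAura.ofAbs w (f.natDegree : ℤ) f.leadingCoeff := rfl

theorem zeroNorm_hom_lt {f g : K[X]} (h : w (f.coeff 0) < w (g.coeff 0)) :
    (zeroNorm w).hom f < (zeroNorm w).hom g := by
  have hg : g.coeff 0 ≠ 0 := fun h0 => by
    rw [h0, map_zero] at h
    exact absurd h (not_lt.mpr (w.nonneg _))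
  have hg0 : g.natTrailingDegree = 0 := natTrailingDegree_eq_zero.mpr (Or.inr hg)
  refine lt_of_not_ge fun hle => ?_
  rw [zeroNorm_hom_le_iff] at hle
  by_cases hf : f = 0
  · rw [hf, trailingCoeff_zero, LexAura.ofAbs_zero] at hle
    refine LexAura.ofAbs_ne_zero w ?_ (le_zero_iff.mp hle)
    rwa [trailingCoeff, hg0]
  · rw [LexAura.ofAbs_le_ofAbs w (mt trailingCoeff_eq_zero.mp hf), hg0, trailingCoeff, hg0] at hle
    rcases hle with h1 | h1 | ⟨h1, h2⟩
    · exact hg h1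
    · omega
    · rw [trailingCoeff, show f.natTrailingDegree = 0 by omega] at h2
      exact not_le_of_gt h h2

theorem zeroNorm_hom_le {f g : K[X]} (hg : g.coeff 0 ≠ 0) (h : w (f.coeff 0) ≤ w (g.coeff 0)) :
    (zeroNorm w).hom f ≤ (zeroNorm w).hom g := by
  rcases h.lt_or_eq with h | h
  · exact (zeroNorm_hom_lt w h).le
  have hf : f.coeff 0 ≠ 0 := fun h0 => hg (by rwa [h0, map_zero, eq_comm, w.eq_zero] at h)
  have hg0 : g.natTrailingDegree = 0 := natTrailingDegree_eq_zero.mpr (Or.inr hg)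
  have hf0 : f.natTrailingDegree = 0 := natTrailingDegree_eq_zero.mpr (Or.inr hf)
  rw [zeroNorm_hom_le_iff, trailingCoeff, trailingCoeff, hf0, hg0,
    LexAura.ofAbs_le_ofAbs w hg]
  exact Or.inr (Or.inr ⟨rfl, h.le⟩)

theorem zeroNorm_hom_ne_zero {f : K[X]} (hf : f ≠ 0) : (zeroNorm w).hom f ≠ 0 :=
  LexAura.ofAbs_ne_zero w (mt trailingCoeff_eq_zero.mp hf)

/-- A seminorm on `ℤ[X]` representing the restriction of `|.|_{2,a}`. -/
noncomputable def infinitesimalSeminorm (a : K) : TMSeminorm ℤ[X] :=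
  ((zeroNorm w).comap (taylorAlgHom a).toRingHom).comap (mapRingHom (Int.castRingHom K))

/-- A seminorm on `ℤ[X]` representing the restriction of `|.|_{2,∞}`. -/
noncomputable def infinitySeminorm : TMSeminorm ℤ[X] :=
  (inftyNorm w).comap (mapRingHom (Int.castRingHom K))

theorem infinitesimalSeminorm_place (a : K) :
    (infinitesimalSeminorm w a).place = restrictLine K (infinitesimalPlace w a) := rfl

theorem infinitySeminorm_place :
    (infinitySeminorm w).place = restrictLine K (infinityPlace w) := rfl

theorem coeff_zero_taylor_map (a : K) (P : ℤ[X]) :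
    (taylor a (P.map (Int.castRingHom K))).coeff 0 = aeval a P := by
  rw [taylor_coeff_zero, eval_map, aeval_def]
  rfl

theorem infinitesimalSeminorm_hom_lt {a : K} {P Q : ℤ[X]} (h : w (aeval a P) < w (aeval a Q)) :
    (infinitesimalSeminorm w a).hom P < (infinitesimalSeminorm w a).hom Q := by
  refine zeroNorm_hom_lt w ?_
  rw [← coeff_zero_taylor_map, ← coeff_zero_taylor_map] at h
  exact h

theorem infinitesimalSeminorm_hom_le {a : K} {P Q : ℤ[X]} (hQ : aeval a Q ≠ 0)
    (h : w (aeval a P) ≤ w (aeval a Q)) :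
    (infinitesimalSeminorm w a).hom P ≤ (infinitesimalSeminorm w a).hom Q := by
  rw [← coeff_zero_taylor_map] at hQ
  refine zeroNorm_hom_le w hQ ?_
  rw [← coeff_zero_taylor_map, ← coeff_zero_taylor_map] at h
  exact h

variable [CharZero K]

theorem infinitesimalSeminorm_hom_ne_zero (a : K) {P : ℤ[X]} (hP : P ≠ 0) :
    (infinitesimalSeminorm w a).hom P ≠ 0 := by
  refine zeroNorm_hom_ne_zero w ?_
  change taylor a (P.map (Int.castRingHom K)) ≠ 0
  rw [Ne, taylor_eq_zero]
  exact (Polynomial.map_ne_zero_iff (RingHom.injective_int _)).mpr hP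

theorem infinitesimalSeminorm_hom_natCast_le_iff (a : K) (m n : ℕ) :
    (infinitesimalSeminorm w a).hom (m : ℤ[X]) ≤ (infinitesimalSeminorm w a).hom (n : ℤ[X]) ↔
      w m ≤ w n := by
  constructor
  · intro h
    by_contra! h'
    refine not_le_of_gt (infinitesimalSeminorm_hom_lt w (a := a) (P := n) (Q := m) ?_) h
    simpa using h'
  · intro h
    rcases eq_or_ne n 0 with rfl | hn
    · rw [Nat.cast_zero, map_zero] at h
      have : (m : K) = 0 := w.eq_zero.mp (le_antisymm h (w.nonneg _))
      rw [Nat.cast_eq_zero] at this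
      rw [this]
    · exact infinitesimalSeminorm_hom_le w (by simpa using hn) (by simpa using h)

/-- A nonzero integral polynomial that vanishes at `a` has nonzero value, yet each of its integer
multiples lies below every nonzero integer. -/
theorem infinitesimalSeminorm_not_isCofinal {a : K} (ha : IsAlgebraic ℤ a) :
    ¬(infinitesimalSeminorm w a).IsCofinal := by
  intro hc
  obtain ⟨b, hb0, hb⟩ := ha
  obtain ⟨n, m, hn, hle⟩ := (hc b (infinitesimalSeminorm_hom_ne_zero w a hb0)).2
  rw [← _root_.map_mul] at hle
  refine not_lt_of_ge hle (infinitesimalSeminorm_hom_lt w ?_)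
  rw [_root_.map_mul, hb, mul_zero, map_zero]
  refine w.pos ?_
  rintro h0
  refine hn ?_
  rw [map_intCast, Int.cast_eq_zero] at h0
  rw [h0]
  simp

theorem infinitySeminorm_hom (P : ℤ[X]) : (infinitySeminorm w).hom P =
    LexAura.ofAbs w (P.natDegree : ℤ) (P.leadingCoeff : K) := by
  change (inftyNorm w).hom (P.map (Int.castRingHom K)) = _
  rw [inftyNorm_hom, natDegree_map_eq_of_injective (RingHom.injective_int _),
    leadingCoeff_map_of_injective (RingHom.injective_int _), eq_intCast]

theorem infinitySeminorm_hom_le_iff (P Q : ℤ[X]) :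
    (infinitySeminorm w).hom P ≤ (infinitySeminorm w).hom Q ↔
      LexAura.ofAbs w (P.natDegree : ℤ) (P.leadingCoeff : K) ≤
        LexAura.ofAbs w (Q.natDegree : ℤ) (Q.leadingCoeff : K) := by
  rw [infinitySeminorm_hom, infinitySeminorm_hom]
  exact Iff.rfl

theorem infinitySeminorm_hom_natCast_le_iff (m n : ℕ) :
    (infinitySeminorm w).hom (m : ℤ[X]) ≤ (infinitySeminorm w).hom (n : ℤ[X]) ↔ w m ≤ w n := by
  rw [infinitySeminorm_hom_le_iff, ← C_eq_natCast, ← C_eq_natCast, leadingCoeff_C,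
    leadingCoeff_C, natDegree_C, natDegree_C, Int.cast_natCast, Int.cast_natCast]
  rcases eq_or_ne n 0 with rfl | hn
  · rw [Nat.cast_zero (R := K), LexAura.ofAbs_zero, map_zero, le_zero_iff, show w m ≤ 0 ↔ w m = 0 from (w.nonneg _).ge_iff_eq', w.eq_zero]
    refine ⟨fun h => ?_, fun h => by rw [h, LexAura.ofAbs_zero]⟩
    by_contra h0
    exact LexAura.ofAbs_ne_zero w h0 h
  · rw [LexAura.ofAbs_le_ofAbs w (Nat.cast_ne_zero.mpr hn)]
    constructor
    · rintro (h | h | h)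
      · rw [h, map_zero]
        exact w.nonneg _
      · omega
      · exact h.2
    · exact fun h => Or.inr (Or.inr ⟨rfl, h⟩)

/-- Every nonzero integer multiple of `X` has degree 1 and so exceeds all integers. -/
theorem infinitySeminorm_not_isCofinal : ¬(infinitySeminorm w).IsCofinal := by
  intro hc
  have h0 : ∀ {P : ℤ[X]}, P ≠ 0 → (infinitySeminorm w).hom P ≠ 0 := fun {P} hP => by
    rw [infinitySeminorm_hom]
    exact LexAura.ofAbs_ne_zero w (by simpa using hP)
  obtain ⟨n, m, hn, hle⟩ := (hc X (h0 X_ne_zero)).1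
  have hn' : n ≠ 0 := by
    rintro rfl
    simp at hn
  rw [← _root_.map_mul, ← eq_intCast C, ← eq_intCast C] at hle
  by_cases hm : m = 0
  · refine h0 (P := C n * X) (mul_ne_zero (C_ne_zero.mpr hn') X_ne_zero) ?_
    rw [hm, map_zero, map_zero] at hle
    exact le_antisymm hle (IsPosAura.zero_le _)
  · rw [infinitySeminorm_hom_le_iff, leadingCoeff_C, natDegree_C,
      natDegree_C_mul_X _ hn', LexAura.ofAbs_le_ofAbs w (by simpa using hm), leadingCoeff_mul,
      leadingCoeff_X, leadingCoeff_C, mul_one] at hle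
    rcases hle with h | h | h
    · exact hn' (by simpa using h)
    · simp at h
    · simp at h

/-- A seminorm for which `X` is infinitely large, and which is given by the leading terms. -/
theorem TMSeminorm.place_eq_infinityPlace {v : TMSeminorm ℤ[X]}
    (hw : ∀ m n : ℤ, v.hom (m : ℤ[X]) ≤ v.hom (n : ℤ[X]) ↔ w m ≤ w n)
    (hX : ∀ m n : ℤ, n ≠ 0 → v.hom (m : ℤ[X]) < v.hom (n : ℤ[X]) * v.hom X)
    (hlead : ∀ P : ℤ[X], v.hom P = v.hom (P.leadingCoeff : ℤ[X]) * v.hom X ^ P.natDegree) :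
    v.place = restrictLine K (infinityPlace w) := by
  have h0 : ∀ n : ℤ, n ≠ 0 → v.hom (n : ℤ[X]) ≠ 0 := fun n hn h => by
    have := hX 0 n hn
    rw [h, zero_mul] at this
    exact not_lt_of_ge (IsPosAura.zero_le _) this
  have hX0 : v.hom X ≠ 0 := fun h => by
    have := hX 0 1 one_ne_zero
    rw [h, mul_zero] at this
    exact not_lt_of_ge (IsPosAura.zero_le _) this
  have h1 : 1 ≤ v.hom X := by
    have := hX 1 1 one_ne_zero
    rw [Int.cast_one, map_one, one_mul] at this
    exact this.le
  have hlt : ∀ {P Q : ℤ[X]}, Q ≠ 0 → P.natDegree < Q.natDegree → v.hom P < v.hom Q := by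
    intro P Q hQ hd
    rw [hlead P, hlead Q]
    calc v.hom (P.leadingCoeff : ℤ[X]) * v.hom X ^ P.natDegree
        < v.hom (Q.leadingCoeff : ℤ[X]) * v.hom X * v.hom X ^ P.natDegree :=
          (mul_lt_mul_iff_left₀ (zero_lt_iff.mpr (pow_ne_zero _ hX0))).mpr
            (hX _ _ (leadingCoeff_ne_zero.mpr hQ))
      _ = v.hom (Q.leadingCoeff : ℤ[X]) * v.hom X ^ (P.natDegree + 1) := by
          rw [pow_succ', mul_assoc]
      _ ≤ _ := mul_le_mul_right (pow_le_pow_right₀ h1 hd) _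
  rw [← infinitySeminorm_place, place_eq_iff]
  intro P Q
  rw [infinitySeminorm_hom_le_iff]
  by_cases hQ : Q = 0
  · rw [hQ, map_zero, leadingCoeff_zero, Int.cast_zero, LexAura.ofAbs_zero]
    by_cases hP : P = 0
    · simp [hP, LexAura.ofAbs_zero]
    have hP' := leadingCoeff_ne_zero.mpr hP
    refine iff_of_false (fun h => ?_) fun h => ?_
    · rw [hlead P] at h
      exact mul_ne_zero (h0 _ hP') (pow_ne_zero _ hX0) (le_antisymm h (IsPosAura.zero_le _))
    · exact LexAura.ofAbs_ne_zero w (by simpa using hP') (le_antisymm h (IsPosAura.zero_le _))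
  rw [LexAura.ofAbs_le_ofAbs w (by simpa using hQ)]
  by_cases hP : P = 0
  · rw [hP]
    simp
  simp only [Int.cast_eq_zero, leadingCoeff_eq_zero, hP, false_or, Nat.cast_lt, Nat.cast_inj]
  rcases lt_trichotomy P.natDegree Q.natDegree with h | h | h
  · exact iff_of_true (hlt hQ h).le (Or.inl h)
  · rw [hlead P, hlead Q, h, mul_le_mul_iff_left₀ (zero_lt_iff.mpr (pow_ne_zero _ hX0)), hw]
    simp
  · exact iff_of_false (not_le_of_gt (hlt hP h)) (by rintro (h1 | ⟨h1, -⟩) <;> omega)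

end

end Speh

namespace Speh

/-! ### Archimedean seminorms that are not analytic -/

theorem isAlgebraic_int_algebraicClosure (a : AlgebraicClosure ℚ) : IsAlgebraic ℤ a := by
  rw [IsFractionRing.isAlgebraic_iff ℤ ℚ]
  exact (AlgebraicClosure.isAlgebraic ℚ).isAlgebraic a

/-- Elements of a field extension of `ℚ̄` that are algebraic over `ℤ` lie in `ℚ̄`. -/
theorem exists_eq_of_eval_eq_zero {L : Type} [Field L] (σ : AlgebraicClosure ℚ →+* L)
    (g : ℤ[X] →+* L) {b : ℤ[X]} (hb0 : b ≠ 0) (hb : g b = 0) :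
    ∃ a : AlgebraicClosure ℚ, σ a = g X ∧ ∀ P, g P = σ (aeval a P) := by
  have hg : ∀ P, g P = eval₂ (Int.castRingHom L) (g X) P := fun P => by
    have : g = eval₂RingHom (Int.castRingHom L) (g X) :=
      Polynomial.ringHom_ext (fun n => by simp) (by simp)
    conv_lhs => rw [this]
    rfl
  have hroot : IsRoot ((b.map (Int.castRingHom (AlgebraicClosure ℚ))).map σ) (g X) := by
    rw [IsRoot, Polynomial.map_map, eval_map,
      show σ.comp (Int.castRingHom _) = Int.castRingHom L from RingHom.ext_int _ _, ← hg, hb]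
  obtain ⟨a, ha⟩ := (IsAlgClosed.splits _).mem_range_of_isRoot
    ((Polynomial.map_ne_zero_iff (RingHom.injective_int _)).mpr hb0) hroot
  refine ⟨a, ha, fun P => ?_⟩
  rw [hg, ← ha, aeval_def, hom_eval₂]
  congr 1
  exact RingHom.ext_int _ _

theorem exists_ringHom_algebraicClosure (L : Type) [Field L] [IsAlgClosed L] [CharZero L] :
    Nonempty (AlgebraicClosure ℚ →+* L) := by
  have : Algebra.IsAlgebraic ℚ (AlgebraicClosure ℚ) := by
    convert AlgebraicClosure.isAlgebraic ℚ
    · rfl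
    · exact Subsingleton.elim _ _
  exact ⟨(IsAlgClosed.lift : AlgebraicClosure ℚ →ₐ[ℚ] L).toRingHom⟩

/-- The absolute value induced by a complex embedding. -/
noncomputable def complexAbs (σ : AlgebraicClosure ℚ →+* ℂ) : AbsoluteValue (AlgebraicClosure ℚ) ℝ :=
  (NormedField.toAbsoluteValue ℂ).comp σ.injective

theorem complexAbs_apply (σ : AlgebraicClosure ℚ →+* ℂ) (a : AlgebraicClosure ℚ) :
    complexAbs σ a = ‖σ a‖ := rfl

theorem infinitesimalSeminorm_isArch {w : AbsoluteValue (AlgebraicClosure ℚ) ℝ}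
    (hw : w ∈ complexAbsoluteValues) (a : AlgebraicClosure ℚ) :
    (infinitesimalSeminorm w a).IsArch := fun m n => by
  obtain ⟨σ, hσ⟩ := hw
  rw [infinitesimalSeminorm_hom_natCast_le_iff, hσ, hσ, map_natCast, map_natCast]
  simp

theorem infinitySeminorm_isArch {w : AbsoluteValue (AlgebraicClosure ℚ) ℝ}
    (hw : w ∈ complexAbsoluteValues) : (infinitySeminorm w).IsArch := fun m n => by
  obtain ⟨σ, hσ⟩ := hw
  rw [infinitySeminorm_hom_natCast_le_iff, hσ, hσ, map_natCast, map_natCast]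
  simp

theorem infinitesimalSeminorm_isArchAt (σ : AlgebraicClosure ℚ →+* ℂ) (a : AlgebraicClosure ℚ) :
    (infinitesimalSeminorm (complexAbs σ) a).IsArchAt (σ.comp (aeval a).toRingHom) where
  isArch := infinitesimalSeminorm_isArch ⟨σ, complexAbs_apply σ⟩ a
  le_hom P r d hd h := by
    rw [← _root_.map_mul]
    have h1 : (r : ℝ) < ‖σ (aeval a P)‖ * d := (div_lt_iff₀ (by exact_mod_cast hd)).mp h
    refine (infinitesimalSeminorm_hom_lt _ ?_).le
    rw [complexAbs_apply, complexAbs_apply, _root_.map_mul, _root_.map_mul, norm_mul,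
      map_natCast, map_natCast, map_natCast, map_natCast, Complex.norm_natCast,
      Complex.norm_natCast]
    exact h1
  hom_le P r d hd h := by
    rw [← _root_.map_mul]
    have h1 : ‖σ (aeval a P)‖ * d < r := (lt_div_iff₀ (by exact_mod_cast hd)).mp h
    refine (infinitesimalSeminorm_hom_lt _ ?_).le
    rw [complexAbs_apply, complexAbs_apply, _root_.map_mul, _root_.map_mul, norm_mul,
      map_natCast, map_natCast, map_natCast, map_natCast, Complex.norm_natCast,
      Complex.norm_natCast]
    exact h1

/-! ### Dominated terms and leading terms of archimedean seminorms -/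

namespace TMSeminorm

section

variable {A : Type} [CommRing A] {v : TMSeminorm A}

theorem IsArch.hom_natCast_mono (hv : v.IsArch) {m n : ℕ} (h : m ≤ n) :
    v.hom (m : A) ≤ v.hom (n : A) := (hv m n).mpr h

theorem IsArch.exists_hom_sum_le (hv : v.IsArch) {ι : Type*} (s : Finset ι) (f : ι → A) (c : A)
    (h : ∀ i ∈ s, ∃ k : ℕ, v.hom (f i) ≤ v.hom (k : A) * v.hom c) :
    ∃ k : ℕ, v.hom (∑ i ∈ s, f i) ≤ v.hom (k : A) * v.hom c := by
  classical
  induction s using Finset.induction_on with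
  | empty => exact ⟨0, by simp⟩
  | insert i s hi ih =>
    obtain ⟨k, hk⟩ := h i (Finset.mem_insert_self i s)
    obtain ⟨l, hl⟩ := ih fun j hj => h j (Finset.mem_insert_of_mem hj)
    refine ⟨k + l, ?_⟩
    rw [Finset.sum_insert hi]
    have := v.hom_add_mul_le (fun m n => hv.hom_natCast_mono) (a := f i) (b := ∑ j ∈ s, f j)
      (c := c) (d := 1) (r := k) (s := l) (by simpa using hk) (by simpa using hl)
    simpa using this

/-- The sharp triangle inequality gives `|a + b| |m| ≤ |m + 1| |a|` for every `m`. Taking `m = n`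
and `n`-th powers costs only the bounded factor `(1 + 1/n) ^ n`, which tempered growth removes. -/
theorem IsArch.hom_add_le_of_dominated (hv : v.IsArch) {a b : A}
    (h : ∀ m : ℕ, v.hom b * v.hom (m : A) ≤ v.hom a) : v.hom (a + b) ≤ v.hom a := by
  have key : ∀ m : ℕ, v.hom (a + b) * v.hom (m : A) ≤ v.hom ((m + 1 : ℕ) : A) * v.hom a :=
    fun m => v.hom_add_mul_le (fun m n => hv.hom_natCast_mono) (by rw [mul_comm])
      (by simpa using h m)
  -- The constant 3 bounds `(1 + 1/n) ^ n ≤ e`. The exponent 0 is treated separately because of the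
  -- division by `n`.
  refine v.tempered.le_of_pow_le (C 3) fun n => ?_
  rcases Nat.eq_zero_or_pos n with rfl | hn
  · simpa using IsPosAura.natCast_mono (R := v.R) (show 1 ≤ 3 by norm_num)
  have h3 : (n + 1) ^ n ≤ 3 * n ^ n := by
    have hn' : (0 : ℝ) < n := by exact_mod_cast hn
    have h1 : (1 + 1 / (n : ℝ)) ^ n ≤ 3 := by
      calc (1 + 1 / (n : ℝ)) ^ n ≤ Real.exp (1 / n) ^ n := by
            gcongr
            rw [add_comm]
            exact Real.add_one_le_exp _
        _ = Real.exp 1 := by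
            rw [← Real.exp_nat_mul, mul_one_div_cancel hn'.ne']
        _ ≤ 3 := by linarith [Real.exp_one_lt_d9]
    have h2 : ((n : ℝ) + 1) ^ n = (1 + 1 / (n : ℝ)) ^ n * n ^ n := by
      rw [← mul_pow, add_mul, one_div_mul_cancel hn'.ne', one_mul]
    have : ((n : ℝ) + 1) ^ n ≤ 3 * n ^ n := by rw [h2]; gcongr
    exact_mod_cast this
  have hpos : 0 < v.hom (n : A) ^ n := by
    have := hv.natCast_pos hn
    exact zero_lt_iff.mpr (pow_ne_zero _ this.ne')
  rw [← mul_le_mul_iff_left₀ hpos]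
  calc v.hom (a + b) ^ n * v.hom (n : A) ^ n = (v.hom (a + b) * v.hom (n : A)) ^ n := by
        rw [mul_pow]
    _ ≤ (v.hom ((n + 1 : ℕ) : A) * v.hom a) ^ n := pow_le_pow_left₀ zero_le (key n) n
    _ = v.hom (((n + 1) ^ n : ℕ) : A) * v.hom a ^ n := by
        rw [mul_pow, ← map_pow, Nat.cast_pow]
    _ ≤ v.hom ((3 * n ^ n : ℕ) : A) * v.hom a ^ n :=
        mul_le_mul_left (hv.hom_natCast_mono h3) _
    _ = v.hom ((3 : ℕ) : A) * v.hom a ^ n * v.hom (n : A) ^ n := by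
        rw [Nat.cast_mul, _root_.map_mul, Nat.cast_pow, map_pow]
        exact mul_right_comm _ _ _
    _ ≤ _ := by
        rw [eval_C]
        exact mul_le_mul_left (mul_le_mul_left (v.hom_natCast_le 3) _) _

theorem IsArch.hom_add_eq_of_dominated (hv : v.IsArch) {a b : A}
    (h : ∀ m : ℕ, v.hom b * v.hom (m : A) ≤ v.hom a) : v.hom (a + b) = v.hom a := by
  refine le_antisymm (hv.hom_add_le_of_dominated h) ?_
  -- Either `-b` is dominated by `a + b`, and the previous inequality applies to `(a + b) + (-b)`;
  -- or `|a + b| < |m| |b|` for some `m`, hence `|a| ≤ |m + 1| |b|`, against the domination of `(m +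
  -- 2) b` by `a`.
  by_cases hm : ∀ m : ℕ, v.hom (-b) * v.hom (m : A) ≤ v.hom (a + b)
  · have := hv.hom_add_le_of_dominated hm
    rwa [add_neg_cancel_right] at this
  · push Not at hm
    obtain ⟨m, hm⟩ := hm
    rw [hom_neg] at hm
    have hb : v.hom b ≠ 0 := fun h0 => by
      rw [h0, zero_mul] at hm
      exact not_lt_of_ge zero_le hm
    have h1 := v.hom_add_mul_le (fun m n => hv.hom_natCast_mono) (a := a + b) (b := -b) (c := b)
      (d := 1) (r := m) (s := 1) (by simpa [mul_comm] using hm.le) (by simp [hom_neg])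
    rw [add_neg_cancel_right, Nat.cast_one, map_one, mul_one] at h1
    have h2 := (h (m + 2)).trans h1
    rw [mul_comm, hv.mul_le_mul_iff _ _ hb] at h2
    omega

end

variable {v : TMSeminorm ℤ[X]}

theorem IsArch.hom_intCast_ne_zero (hv : v.IsArch) {n : ℤ} (hn : n ≠ 0) : v.hom (n : ℤ[X]) ≠ 0 := by
  have := (hv.hom_intCast_le_iff n 0).not
  simpa [hn] using this

theorem IsArch.exists_hom_le_natCast (hv : v.IsArch) {m : ℕ} (hX : v.hom X ≤ v.hom (m : ℤ[X]))
    (P : ℤ[X]) : ∃ k : ℕ, v.hom P ≤ v.hom (k : ℤ[X]) := by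
  have := hv.exists_hom_sum_le (Finset.range (P.natDegree + 1))
    (fun i => C (P.coeff i) * X ^ i) 1 fun i _ => ⟨(P.coeff i).natAbs * m ^ i, by
      rw [map_one, mul_one, _root_.map_mul, eq_intCast C, hom_intCast_natAbs, Nat.cast_mul,
        _root_.map_mul, map_pow, Nat.cast_pow, map_pow]
      exact mul_le_mul_right (pow_le_pow_left₀ zero_le hX i) _⟩
  rw [← as_sum_range_C_mul_X_pow] at this
  simpa using this

/-- The lower terms together are at most an integer times a smaller power of `X`; since `X` exceeds
all integers, the leading term dominates them. -/
theorem IsArch.hom_eq_leading (hv : v.IsArch) (hX : ∀ m : ℕ, v.hom (m : ℤ[X]) < v.hom X)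
    (P : ℤ[X]) : v.hom P = v.hom (P.leadingCoeff : ℤ[X]) * v.hom X ^ P.natDegree := by
  by_cases hP : P = 0
  · simp [hP]
  have h1X : 1 ≤ v.hom X := by simpa using (hX 1).le
  have h1 : 1 ≤ v.hom (P.leadingCoeff : ℤ[X]) :=
    hv.one_le_of_ne_zero (hv.hom_intCast_ne_zero (leadingCoeff_ne_zero.mpr hP))
  have hlead : v.hom (C P.leadingCoeff * X ^ P.natDegree) =
      v.hom (P.leadingCoeff : ℤ[X]) * v.hom X ^ P.natDegree := by
    rw [_root_.map_mul, map_pow, eq_intCast C]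
  conv_lhs => rw [← eraseLead_add_C_mul_X_pow P, add_comm]
  rw [← hlead]
  refine hv.hom_add_eq_of_dominated fun m => ?_
  rcases eraseLead_natDegree_lt_or_eraseLead_eq_zero P with hd | h0
  swap
  · rw [h0, map_zero, zero_mul]
    exact zero_le
  obtain ⟨k, hk⟩ := hv.exists_hom_sum_le (Finset.range (P.eraseLead.natDegree + 1))
    (fun i => C (P.eraseLead.coeff i) * X ^ i) (X ^ P.eraseLead.natDegree) fun i hi =>
      ⟨(P.eraseLead.coeff i).natAbs, by
        rw [_root_.map_mul, eq_intCast C, hom_intCast_natAbs, map_pow, map_pow]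
        exact mul_le_mul_right
          (pow_le_pow_right₀ h1X (Nat.lt_succ_iff.mp (Finset.mem_range.mp hi))) _⟩
  rw [← as_sum_range_C_mul_X_pow, map_pow] at hk
  calc v.hom P.eraseLead * v.hom (m : ℤ[X])
      ≤ v.hom (k : ℤ[X]) * v.hom X ^ P.eraseLead.natDegree * v.hom (m : ℤ[X]) :=
        mul_le_mul_left hk _
    _ = v.hom ((k * m : ℕ) : ℤ[X]) * v.hom X ^ P.eraseLead.natDegree := by
        rw [Nat.cast_mul, _root_.map_mul]
        exact mul_right_comm _ _ _
    _ ≤ v.hom X * v.hom X ^ P.eraseLead.natDegree := mul_le_mul_left (hX _).le _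
    _ = v.hom X ^ (P.eraseLead.natDegree + 1) := (pow_succ' _ _).symm
    _ ≤ v.hom X ^ P.natDegree := pow_le_pow_right₀ h1X hd
    _ ≤ _ := by
        rw [hlead]
        exact le_mul_of_one_le_left' h1

end TMSeminorm

theorem RPoints_diff_SpehA : RPoints \ SpehA ℤ[X] =
    {x | ∃ w ∈ complexAbsoluteValues,
      (∃ a, x = restrictLine (AlgebraicClosure ℚ) (infinitesimalPlace w a)) ∨
      x = restrictLine (AlgebraicClosure ℚ) (infinityPlace w)} := by
  ext x
  constructor
  · rintro ⟨hx, hA⟩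
    obtain ⟨v, rfl⟩ := TMSeminorm.exists_place x
    have hv := (place_mem_RPoints_iff v).mp hx
    rw [← isCofinal_iff_mem_SpehA_of_isArch hv] at hA
    -- One fixed embedding suffices, since every algebraic complex number is in its image.
    obtain ⟨σ⟩ := exists_ringHom_algebraicClosure ℂ
    refine ⟨complexAbs σ, ⟨σ, complexAbs_apply σ⟩, ?_⟩
    by_cases hX : ∃ m : ℕ, v.hom X ≤ v.hom (m : ℤ[X])
    · obtain ⟨m, hm⟩ := hX
      obtain ⟨g, hg⟩ := hv.exists_isArchAt (hv.exists_hom_le_natCast hm)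
      have h1 := hA
      rw [hg.isCofinal_iff] at h1
      push Not at h1
      obtain ⟨b, hb, hb0⟩ := h1
      obtain ⟨a, -, ha⟩ := exists_eq_of_eval_eq_zero σ g (by rintro rfl; simp at hb0) hb
      obtain rfl : g = σ.comp (aeval a).toRingHom := RingHom.ext ha
      exact Or.inl ⟨a, hg.place_eq (infinitesimalSeminorm_isArchAt σ a) hA
        (infinitesimalSeminorm_not_isCofinal _ (isAlgebraic_int_algebraicClosure a))⟩
    · push Not at hX
      refine Or.inr (TMSeminorm.place_eq_infinityPlace _ (fun m n => ?_) (fun m n hn => ?_)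
        (hv.hom_eq_leading hX))
      · rw [hv.hom_intCast_le_iff, complexAbs_apply, complexAbs_apply, map_intCast, map_intCast,
          Complex.norm_intCast, Complex.norm_intCast]
        norm_cast
      · rw [TMSeminorm.hom_intCast_natAbs]
        exact (hX _).trans_le (le_mul_of_one_le_left'
          (hv.one_le_of_ne_zero (hv.hom_intCast_ne_zero hn)))
  · rintro ⟨w, hw, ⟨a, rfl⟩ | rfl⟩
    · rw [← infinitesimalSeminorm_place]
      have hv := infinitesimalSeminorm_isArch hw a
      refine ⟨(place_mem_RPoints_iff _).mpr hv, ?_⟩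
      rw [← isCofinal_iff_mem_SpehA_of_isArch hv]
      exact infinitesimalSeminorm_not_isCofinal _ (isAlgebraic_int_algebraicClosure a)
    · rw [← infinitySeminorm_place]
      have hv := infinitySeminorm_isArch hw
      refine ⟨(place_mem_RPoints_iff _).mpr hv, ?_⟩
      rw [← isCofinal_iff_mem_SpehA_of_isArch hv]
      exact infinitySeminorm_not_isCofinal _

end Speh

namespace Speh

/-! ### Extension of valuations to algebraically closed fields -/

/-- A valuation on a ring comes from a valuation on its residue field. -/
theorem exists_valuation_residueField {A : Type u} [CommRing A] {Γ : Type u}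
    [LinearOrderedCommGroupWithZero Γ] (v : Valuation A Γ) :
    ∃ (K : Type u) (_ : Field K) (V : Valuation K Γ) (g : A →+* K), (∀ a, V (g a) = v a) ∧
      ∀ x, ∃ a s, g s ≠ 0 ∧ g s * x = g a := by
  have h : nonZeroDivisors (A ⧸ v.supp) ≤ (v.onQuot le_rfl).supp.primeCompl := by
    intro x hx
    rw [Ideal.mem_primeCompl_iff, v.supp_quot_supp]
    exact nonZeroDivisors.ne_zero hx
  refine ⟨FractionRing (A ⧸ v.supp), inferInstance,
    (v.onQuot le_rfl).extendToLocalization h (FractionRing (A ⧸ v.supp)),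
    (algebraMap (A ⧸ v.supp) _).comp (Ideal.Quotient.mk v.supp), fun a => ?_, fun x => ?_⟩
  · rw [RingHom.comp_apply, Valuation.extendToLocalization_apply_map_apply]
    exact congrArg (fun w : Valuation A Γ => w a) (v.onQuot_comap_eq le_rfl)
  · obtain ⟨a, s, hs, rfl⟩ := IsFractionRing.div_surjective (A := A ⧸ v.supp) x
    obtain ⟨a, rfl⟩ := Ideal.Quotient.mk_surjective a
    obtain ⟨s, rfl⟩ := Ideal.Quotient.mk_surjective s
    have h0 : algebraMap (A ⧸ v.supp) (FractionRing (A ⧸ v.supp)) (Ideal.Quotient.mk _ s) ≠ 0 :=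
      IsFractionRing.to_map_ne_zero_of_mem_nonZeroDivisors hs
    exact ⟨a, s, h0, mul_div_cancel₀ _ h0⟩

/-- By Chevalley's theorem the valuation ring of `K` is dominated by a valuation ring `W` of the
algebraic closure. Locality of the inclusion keeps strict inequalities strict, so `W` induces the
given order on `K`. -/
theorem exists_valuation_isAlgClosed {K : Type u} [Field K] {Γ : Type u}
    [LinearOrderedCommGroupWithZero Γ] (v : Valuation K Γ) :
    ∃ (L : Type u) (_ : Field L) (_ : IsAlgClosed L) (Γ' : Type u)
      (_ : LinearOrderedCommGroupWithZero Γ') (V : Valuation L Γ') (g : K →+* L),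
      ∀ a b, V (g a) ≤ V (g b) ↔ v a ≤ v b := by
  obtain ⟨W, hW, hloc⟩ := IsLocalRing.exists_factor_valuationRing
    ((algebraMap K (AlgebraicClosure K)).comp v.valuationSubring.subtype)
  have h1 : ∀ a, v a ≤ 1 → W.valuation (algebraMap K (AlgebraicClosure K) a) ≤ 1 := fun a ha =>
    (W.valuation_le_one_iff _).mpr (hW ⟨a, ha⟩)
  have h2 : ∀ a, v a < 1 → W.valuation (algebraMap K (AlgebraicClosure K) a) < 1 := by
    intro a ha
    refine (h1 a ha.le).lt_of_ne fun heq => ?_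
    have hu : IsUnit (((algebraMap K (AlgebraicClosure K)).comp
        v.valuationSubring.subtype).codRestrict W.toSubring hW ⟨a, ha.le⟩) :=
      (W.valuation_eq_one_iff ⟨_, hW ⟨a, ha.le⟩⟩).mpr heq
    have := (v.valuationSubring.valuation_eq_one_iff ⟨a, ha.le⟩).mp (hloc.map_nonunit _ hu)
    rw [(v.isEquiv_valuation_valuationSubring.symm).eq_one_iff_eq_one] at this
    exact ha.ne this
  refine ⟨AlgebraicClosure K, inferInstance, inferInstance, W.ValueGroup, inferInstance,
    W.valuation, algebraMap K (AlgebraicClosure K), fun a b => ?_⟩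
  by_cases hb : b = 0
  · simp [hb]
  have hb' : W.valuation (algebraMap K (AlgebraicClosure K) b) ≠ 0 := by simpa using hb
  have hvb : v b ≠ 0 := by simpa using hb
  constructor
  · intro h
    by_contra! hlt
    have ha0 : v a ≠ 0 := (zero_le.trans_lt hlt).ne'
    have ha : a ≠ 0 := by simpa using ha0
    have := h2 (b / a) (by rwa [map_div₀, div_lt_one₀ (zero_lt_iff.mpr ha0)])
    rw [map_div₀, map_div₀, div_lt_one₀ (zero_lt_iff.mpr (by simpa using ha))] at this
    exact not_le_of_gt this h
  · intro h
    have := h1 (a / b) (by rwa [map_div₀, div_le_one₀ (zero_lt_iff.mpr hvb)])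
    rwa [map_div₀, map_div₀, div_le_one₀ (zero_lt_iff.mpr hb')] at this

end Speh

namespace Speh

/-! ### Valuations on algebraic extensions of `ℚ` that extend the `p`-adic one -/

/-- The restriction of the valuation to `ℤ` is the `p`-adic valuation. -/
structure ExtendsPadic (p : ℕ) {E : Type u} [CommRing E] {Γ : Type u}
    [LinearOrderedCommGroupWithZero Γ] (U : Valuation E Γ) : Prop where
  ne_zero : U (p : E) ≠ 0
  lt_one : U (p : E) < 1
  map_intCast : ∀ n : ℤ, n ≠ 0 → U (n : E) = U (p : E) ^ padicValInt p n

namespace ExtendsPadic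

variable {p : ℕ} {E : Type u} [Field E] {Γ : Type u}
  [LinearOrderedCommGroupWithZero Γ] {U : Valuation E Γ}

theorem zpow_le_zpow_iff (hU : ExtendsPadic p U) (m n : ℤ) :
    U (p : E) ^ m ≤ U (p : E) ^ n ↔ n ≤ m :=
  zpow_le_zpow_iff_right_of_lt_one₀ (zero_lt_iff.mpr hU.ne_zero) hU.lt_one

theorem zpow_inj (hU : ExtendsPadic p U) {m n : ℤ} (h : U (p : E) ^ m = U (p : E) ^ n) : m = n :=
  le_antisymm ((hU.zpow_le_zpow_iff _ _).mp h.ge) ((hU.zpow_le_zpow_iff _ _).mp h.le)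

/-- In an algebraic relation for `a` at least two terms share the maximal value; comparing them
expresses a power of `U a` by the values of two integers, which are powers of `U p`. -/
theorem exists_pow_eq_zpow (hU : ExtendsPadic p U) {a : E} (ha : a ≠ 0) (halg : IsAlgebraic ℤ a) :
    ∃ (n : ℕ) (m : ℤ), 0 < n ∧ U a ^ n = U (p : E) ^ m := by
  classical
  obtain ⟨b, hb0, hb⟩ := halg
  have hUa : U a ≠ 0 := by simpa using ha
  have hterm : ∀ i ∈ b.support, U ((b.coeff i : E) * a ^ i) =
      U (p : E) ^ (padicValInt p (b.coeff i) : ℤ) * U a ^ i := fun i hi => by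
    rw [map_mul, map_pow, hU.map_intCast _ (mem_support_iff.mp hi), zpow_natCast]
  obtain ⟨i, hi, hmax⟩ := b.support.exists_max_image (fun i => U ((b.coeff i : E) * a ^ i))
    (nonempty_support_iff.mpr hb0)
  have hsum : ∑ i ∈ b.support, (b.coeff i : E) * a ^ i = 0 := by
    rw [← hb, aeval_def, eval₂_eq_sum, Polynomial.sum]
    rfl
  obtain ⟨j, hj, hji, heq⟩ : ∃ j ∈ b.support, j ≠ i ∧
      U ((b.coeff j : E) * a ^ j) = U ((b.coeff i : E) * a ^ i) := by
    by_contra! hne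
    have := U.map_sum_eq_of_lt (f := fun i => (b.coeff i : E) * a ^ i) hi fun j hj => by
      rw [Finset.mem_sdiff, Finset.mem_singleton] at hj
      exact (hmax j hj.1).lt_of_ne (hne j hj.1 hj.2)
    rw [hsum, map_zero, hterm i hi] at this
    exact mul_ne_zero (zpow_ne_zero _ hU.ne_zero) (pow_ne_zero _ hUa) this.symm
  rw [hterm i hi, hterm j hj] at heq
  have key : ∀ {i j : ℕ} {k l : ℤ}, i < j → U (p : E) ^ k * U a ^ j = U (p : E) ^ l * U a ^ i →
      ∃ (n : ℕ) (m : ℤ), 0 < n ∧ U a ^ n = U (p : E) ^ m := by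
    intro i j k l hij h
    obtain ⟨n, rfl⟩ := Nat.exists_eq_add_of_lt hij
    refine ⟨n + 1, l - k, n.succ_pos, ?_⟩
    rw [add_assoc, pow_add, mul_comm (U a ^ i), ← mul_assoc] at h
    have h1 := mul_right_cancel₀ (pow_ne_zero i hUa) h
    rw [zpow_sub₀ hU.ne_zero, eq_div_iff (zpow_ne_zero _ hU.ne_zero), mul_comm, h1]
  rcases hji.lt_or_gt with h | h
  · exact key h heq.symm
  · exact key h heq

theorem map_ratCast (hU : ExtendsPadic p U) {r : ℚ} (hr : r ≠ 0) :
    U (r : E) = U (p : E) ^ padicValRat p r := by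
  have hn : r.num ≠ 0 := Rat.num_ne_zero.mpr hr
  have hd : (r.den : ℤ) ≠ 0 := by exact_mod_cast r.den_ne_zero
  rw [Rat.cast_def, map_div₀, hU.map_intCast _ hn, ← Int.cast_natCast r.den, hU.map_intCast _ hd,
    padicValRat, zpow_sub₀ hU.ne_zero, zpow_natCast, zpow_natCast, padicValInt.of_nat]

/-- The valuation is equivalent to a real absolute value normalized by `|p| = p⁻¹`. -/
theorem exists_absoluteValue [CharZero E] [hp : Fact p.Prime] (hU : ExtendsPadic p U)
    (halg : ∀ a : E, IsAlgebraic ℤ a) :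
    ∃ w : AbsoluteValue E ℝ, (∀ r : ℚ, w r = padicNorm p r) ∧ ∀ a b, w a ≤ w b ↔ U a ≤ U b := by
  classical
  have hex : ∀ a : E, ∃ (n : ℕ) (m : ℤ), a ≠ 0 → 0 < n ∧ U a ^ n = U (p : E) ^ m := fun a => by
    by_cases ha : a = 0
    · exact ⟨0, 0, fun h => absurd ha h⟩
    · obtain ⟨n, m, h⟩ := hU.exists_pow_eq_zpow ha (halg a)
      exact ⟨n, m, fun _ => h⟩
  choose n m hnm using hex
  have hp1 : (1 : ℝ) < p := by exact_mod_cast hp.out.one_lt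
  have hp0 : (0 : ℝ) < p := zero_lt_one.trans hp1
  -- From `U a ^ n = U p ^ m` and `|p| = p⁻¹` the absolute value of `a` has to be `p ^ (-m / n)`.
  -- Below, `hval` shows that it does not depend on the chosen relation.
  let w : E → ℝ := fun a => if a = 0 then 0 else (p : ℝ) ^ (-(m a / n a : ℝ))
  have hw0 : w 0 = 0 := if_pos rfl
  have hwne : ∀ {a}, a ≠ 0 → w a = (p : ℝ) ^ (-(m a / n a : ℝ)) := fun ha => if_neg ha
  have hwpos : ∀ {a}, a ≠ 0 → 0 < w a := fun ha => by rw [hwne ha]; positivity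
  have hle : ∀ a b, w a ≤ w b ↔ U a ≤ U b := by
    intro a b
    by_cases hb : b = 0
    · rw [hb, hw0, map_zero, le_zero_iff (α := Γ), map_eq_zero]
      refine ⟨fun h => ?_, fun h => by rw [h, hw0]⟩
      by_contra ha
      exact not_lt_of_ge h (hwpos ha)
    by_cases ha : a = 0
    · simp [ha, hw0, (hwpos hb).le]
    obtain ⟨hna, hma⟩ := hnm a ha
    obtain ⟨hnb, hmb⟩ := hnm b hb
    have hna' : (0 : ℝ) < n a := by exact_mod_cast hna
    have hnb' : (0 : ℝ) < n b := by exact_mod_cast hnb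
    rw [hwne ha, hwne hb, Real.rpow_le_rpow_left_iff hp1, neg_le_neg_iff,
      div_le_div_iff₀ hnb' hna', ← pow_le_pow_iff_left₀ (a := U a) zero_le zero_le (Nat.mul_pos hna hnb).ne',
      pow_mul, hma, mul_comm (n a), pow_mul, hmb, ← zpow_natCast, ← zpow_natCast, ← zpow_mul,
      ← zpow_mul, hU.zpow_le_zpow_iff]
    exact_mod_cast Iff.rfl
  have hval : ∀ {a : E} {k : ℕ} {l : ℤ}, a ≠ 0 → 0 < k → U a ^ k = U (p : E) ^ l →
      w a = (p : ℝ) ^ (-(l / k : ℝ)) := by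
    intro a k l ha hk h
    obtain ⟨hna, hma⟩ := hnm a ha
    have hna' : (n a : ℝ) ≠ 0 := by exact_mod_cast hna.ne'
    have hk' : (k : ℝ) ≠ 0 := by exact_mod_cast hk.ne'
    have h1 : m a * k = l * n a := by
      refine hU.zpow_inj ?_
      rw [zpow_mul, ← hma, zpow_mul, ← h, zpow_natCast, zpow_natCast, ← pow_mul, ← pow_mul,
        mul_comm]
    have h2 : (m a / n a : ℝ) = l / k := by
      rw [div_eq_div_iff hna' hk']
      exact_mod_cast h1
    rw [hwne ha, h2]
  have hmul : ∀ a b, w (a * b) = w a * w b := by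
    intro a b
    by_cases ha : a = 0
    · simp [ha, hw0]
    by_cases hb : b = 0
    · simp [hb, hw0]
    obtain ⟨hna, hma⟩ := hnm a ha
    obtain ⟨hnb, hmb⟩ := hnm b hb
    have hna' : (n a : ℝ) ≠ 0 := by exact_mod_cast hna.ne'
    have hnb' : (n b : ℝ) ≠ 0 := by exact_mod_cast hnb.ne'
    rw [hval (mul_ne_zero ha hb) (k := n a * n b) (l := m a * n b + m b * n a)
      (Nat.mul_pos hna hnb), hwne ha, hwne hb, ← Real.rpow_add hp0]
    · congr 1
      push_cast
      field_simp
      ring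
    · rw [map_mul, mul_pow, pow_mul, hma, mul_comm (n a), pow_mul, hmb, zpow_add₀ hU.ne_zero,
        zpow_mul, zpow_mul, zpow_natCast, zpow_natCast]
  have hnonneg : ∀ a, 0 ≤ w a := fun a => by
    by_cases ha : a = 0
    · rw [ha, hw0]
    · exact (hwpos ha).le
  refine ⟨⟨⟨w, hmul⟩, hnonneg, fun a => ?_, fun a b => ?_⟩, fun r => ?_, hle⟩
  · refine ⟨fun h => ?_, fun h => by rw [h]; exact hw0⟩
    by_contra ha
    exact (hwpos ha).ne' h
  · change w (a + b) ≤ w a + w b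
    rcases le_max_iff.mp (U.map_add a b) with h | h
    · exact ((hle _ _).mpr h).trans (le_add_of_nonneg_right (hnonneg b))
    · exact ((hle _ _).mpr h).trans (le_add_of_nonneg_left (hnonneg a))
  · change w r = _
    by_cases hr : r = 0
    · simp [hr, hw0]
    rw [hval (a := (r : E)) (k := 1) (l := padicValRat p r) (Rat.cast_ne_zero.mpr hr) one_pos
      (by rw [pow_one, hU.map_ratCast hr]), padicNorm.eq_zpow_of_nonzero hr]
    push_cast
    rw [div_one, ← Int.cast_neg, Real.rpow_intCast]

end ExtendsPadic

end Speh

namespace Speh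

/-! ### `ℚ_p`-points that are not analytic -/

theorem TMSeminorm.IsPadic.hom_intCast_ne_zero {p : ℕ} [Fact p.Prime] {v : TMSeminorm ℤ[X]}
    (hv : v.IsPadic p) {n : ℤ} (hn : n ≠ 0) : v.hom (n : ℤ[X]) ≠ 0 := by
  rw [hv.hom_intCast hn]
  exact pow_ne_zero _ hv.ne_zero

theorem TMSeminorm.IsPadic.hom_intCast_le_one {p : ℕ} {v : TMSeminorm ℤ[X]}
    (hv : v.IsPadic p) (n : ℤ) : v.hom (n : ℤ[X]) ≤ 1 := by
  rw [hom_intCast_natAbs]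
  exact hv.natCast_le_one _

theorem QpPoints_subset_Spev (p : ℕ) [Fact p.Prime] : QpPoints p ⊆ Spev ℤ[X] := by
  intro x hx
  obtain ⟨v, rfl⟩ := TMSeminorm.exists_place x
  have hv := (place_mem_QpPoints_iff v).mp hx
  rw [v.place_toValuation hv.natCast_le_one]
  exact ⟨_, _, _, rfl⟩

theorem isCofinal_iff_mem_SpehA_of_isPadic {p : ℕ} [Fact p.Prime] {v : TMSeminorm ℤ[X]}
    (hv : v.IsPadic p) : v.IsCofinal ↔ v.place ∈ SpehA ℤ[X] :=
  ⟨TMSeminorm.mem_SpehA_of_isCofinal hv.natCast_le_one, fun h =>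
    TMSeminorm.isCofinal_of_mem_SpehA h (c := p) (by simpa using hv.ne_zero)
      (by simpa using hv.lt_one.ne)⟩

section

variable {p : ℕ} [hp : Fact p.Prime] {w : AbsoluteValue (AlgebraicClosure ℚ) ℝ}

theorem padicExtensions_natCast (hw : w ∈ padicExtensions p) (n : ℕ) : w n = padicNorm p n := by
  have := hw n
  rwa [map_natCast] at this

theorem padicExtensions_intCast_le_iff (hw : w ∈ padicExtensions p) {v : TMSeminorm ℤ[X]}
    (hv : v.IsPadic p) (m n : ℤ) : v.hom (m : ℤ[X]) ≤ v.hom (n : ℤ[X]) ↔ w m ≤ w n := by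
  have hint : ∀ n : ℤ, w n = padicNorm p n := fun n => by
    have := hw n
    rwa [map_intCast] at this
  rw [hv.hom_intCast_le_iff, hint, hint, Rat.cast_le]
  by_cases hm : m = 0
  · simp [hm, padicNorm.nonneg]
  by_cases hn : n = 0
  · simp only [hm, hn, false_or, ne_eq, not_true_eq_false, false_and, Int.cast_zero, padicNorm.zero,
      false_iff, not_le]
    exact (padicNorm.nonneg _).lt_of_ne' (padicNorm.nonzero (by exact_mod_cast hm))
  · rw [padicNorm.eq_zpow_of_nonzero (by exact_mod_cast hm),
      padicNorm.eq_zpow_of_nonzero (by exact_mod_cast hn),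
      zpow_le_zpow_iff_right₀ (by exact_mod_cast hp.out.one_lt)]
    simp [hm, hn]

theorem isPadic_of_natCast_le_iff (hw : w ∈ padicExtensions p) {v : TMSeminorm ℤ[X]}
    (hv : ∀ m n : ℕ, v.hom (m : ℤ[X]) ≤ v.hom (n : ℤ[X]) ↔ w m ≤ w n) : v.IsPadic p where
  ne_zero h := by
    have := (hv p 0).mp (by simp [h])
    rw [Nat.cast_zero, map_zero] at this
    exact hp.out.ne_zero (by exact_mod_cast w.eq_zero.mp (this.antisymm (w.nonneg _)))
  lt_one := by
    have := (hv 1 p).not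
    rw [Nat.cast_one, map_one, Nat.cast_one, map_one, not_le, not_le] at this
    rw [this, padicExtensions_natCast hw, padicNorm.padicNorm_p_of_prime]
    have h1 : (1 : ℝ) < p := by exact_mod_cast hp.out.one_lt
    simpa using inv_lt_one_of_one_lt₀ h1
  natCast_le_one n := by
    have := hv n 1
    rw [Nat.cast_one, map_one, Nat.cast_one, map_one] at this
    rw [this, padicExtensions_natCast hw]
    have := padicNorm.of_int (p := p) n
    exact_mod_cast this

end

/-- The leading term dominates if `X` is infinitely large. -/
theorem TMSeminorm.IsPadic.hom_eq_leading {p : ℕ} [Fact p.Prime] {v : TMSeminorm ℤ[X]}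
    (hv : v.IsPadic p) (hX : ∀ m n : ℤ, n ≠ 0 → v.hom (m : ℤ[X]) < v.hom (n : ℤ[X]) * v.hom X)
    (P : ℤ[X]) : v.hom P = v.hom (P.leadingCoeff : ℤ[X]) * v.hom X ^ P.natDegree := by
  by_cases hP : P = 0
  · simp [hP]
  have h1X : 1 ≤ v.hom X := by simpa using (hX 1 1 one_ne_zero).le
  have hX0 : 0 < v.hom X := zero_lt_one.trans_le h1X
  have h := (v.toValuation hv.natCast_le_one).map_sum_eq_of_lt
    (f := fun i => C (P.coeff i) * X ^ i) (Finset.self_mem_range_succ P.natDegree) fun i hi => by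
      rw [Finset.mem_sdiff, Finset.mem_range, Finset.mem_singleton] at hi
      rw [toValuation_apply, toValuation_apply, _root_.map_mul, _root_.map_mul, map_pow, map_pow,
        eq_intCast C, eq_intCast C]
      calc v.hom (P.coeff i : ℤ[X]) * v.hom X ^ i
          < v.hom (P.coeff P.natDegree : ℤ[X]) * v.hom X * v.hom X ^ i :=
            (mul_lt_mul_iff_left₀ (pow_pos hX0 i)).mpr (hX _ _ (leadingCoeff_ne_zero.mpr hP))
        _ = v.hom (P.coeff P.natDegree : ℤ[X]) * v.hom X ^ (i + 1) := by
            rw [pow_succ', mul_assoc]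
        _ ≤ _ := mul_le_mul_right (pow_le_pow_right₀ h1X (by omega)) _
  rw [← as_sum_range_C_mul_X_pow, toValuation_apply, toValuation_apply, _root_.map_mul, map_pow,
    eq_intCast C] at h
  exact h

/-! ### Values of polynomials at an infinitely small element -/

section Infinitesimal

variable {E L : Type} [Field E] [Field L] (σ : E →+* L) {Γ : Type} [LinearOrderedCommGroupWithZero Γ]
  {V : Valuation L Γ} {δ : L} (hδ0 : δ ≠ 0) (hδ : ∀ c : E, c ≠ 0 → V δ < V (σ c))

include hδ0 hδ

/-- A single extra factor `δ` outweighs any quotient of coefficients. Hence the terms of a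
polynomial in `δ` are ordered by degree and the trailing one gives its value. -/
theorem valuation_mul_pow_lt {c d : E} (hd : d ≠ 0) {i j : ℕ} (hij : j < i) :
    V (σ c * δ ^ i) < V (σ d * δ ^ j) := by
  have hV : 0 < V δ := by simpa [zero_lt_iff] using hδ0
  obtain ⟨k, rfl⟩ := Nat.exists_eq_add_of_lt hij
  have h1 : V δ ≤ 1 := by simpa using (hδ 1 one_ne_zero).le
  have h2 : V (σ c) * V δ < V (σ d) := by
    by_cases hc : c = 0
    · simpa [hc, zero_lt_iff] using hd
    have := hδ (d / c) (div_ne_zero hd hc)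
    rw [map_div₀, map_div₀, lt_div_iff₀ (by simpa [zero_lt_iff] using hc), mul_comm] at this
    exact this
  simp only [map_mul, map_pow]
  calc V (σ c) * V δ ^ (j + k + 1) = V (σ c) * V δ * V δ ^ j * V δ ^ k := by
        rw [pow_succ, pow_add]
        simp only [mul_assoc, mul_comm, mul_left_comm]
    _ ≤ V (σ c) * V δ * V δ ^ j := mul_le_of_le_one_right' (pow_le_one₀ zero_le h1)
    _ < _ := (mul_lt_mul_iff_left₀ (pow_pos hV j)).mpr h2

theorem valuation_eval₂_eq_trailing (f : E[X]) :
    V (eval₂ σ δ f) = V (σ f.trailingCoeff * δ ^ f.natTrailingDegree) := by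
  classical
  by_cases hf : f = 0
  · simp [hf]
  rw [eval₂_eq_sum, Polynomial.sum]
  refine V.map_sum_eq_of_lt (f := fun i => σ (f.coeff i) * δ ^ i)
    (natTrailingDegree_mem_support_of_nonzero hf) fun i hi => ?_
  rw [Finset.mem_sdiff, Finset.mem_singleton] at hi
  exact valuation_mul_pow_lt σ hδ0 hδ (mt trailingCoeff_eq_zero.mp hf)
    ((natTrailingDegree_le_of_mem_supp i hi.1).lt_of_ne' hi.2)

theorem valuation_eval₂_le_iff {w : AbsoluteValue E ℝ}
    (hw : ∀ a b, w a ≤ w b ↔ V (σ a) ≤ V (σ b)) (f h : E[X]) :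
    V (eval₂ σ δ f) ≤ V (eval₂ σ δ h) ↔ (zeroNorm w).hom f ≤ (zeroNorm w).hom h := by
  rw [zeroNorm_hom_le_iff, valuation_eval₂_eq_trailing σ hδ0 hδ,
    valuation_eval₂_eq_trailing σ hδ0 hδ]
  have hδV : V δ ≠ 0 := by simpa using hδ0
  by_cases hh : h = 0
  · rw [hh, trailingCoeff_zero, LexAura.ofAbs_zero, le_zero_iff]
    by_cases hf : f = 0
    · simp [hf, LexAura.ofAbs_zero]
    · refine iff_of_false ?_ (LexAura.ofAbs_ne_zero w (mt trailingCoeff_eq_zero.mp hf))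
      simp [hf, hδV]
  have hh' : h.trailingCoeff ≠ 0 := mt trailingCoeff_eq_zero.mp hh
  rw [LexAura.ofAbs_le_ofAbs w hh']
  by_cases hf : f = 0
  · simp [hf]
  have hf' : f.trailingCoeff ≠ 0 := mt trailingCoeff_eq_zero.mp hf
  rcases lt_trichotomy h.natTrailingDegree f.natTrailingDegree with hlt | heq | hlt
  · exact iff_of_true (valuation_mul_pow_lt σ hδ0 hδ hh' hlt).le (Or.inr (Or.inl (by omega)))
  · rw [heq, map_mul, map_mul, mul_le_mul_iff_left₀ (by simpa [zero_lt_iff] using fun h => absurd h hδ0), ← hw]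
    simp [hf]
  · refine iff_of_false (not_le_of_gt (valuation_mul_pow_lt σ hδ0 hδ hf' hlt)) ?_
    rintro (h1 | h1 | h1)
    · exact hf' h1
    · omega
    · omega

end Infinitesimal

/-- A polynomial seminorm for which `X` is bounded and for which there are no infinitesimals is
cofinal. -/
theorem TMSeminorm.IsPadic.isCofinal {p : ℕ} [Fact p.Prime] {v : TMSeminorm ℤ[X]}
    (hv : v.IsPadic p) {k : ℕ} (hX : v.hom (p : ℤ[X]) ^ k * v.hom X ≤ 1)
    (hinf : ∀ P : ℤ[X], v.hom P ≠ 0 → ∃ k : ℕ, v.hom (p : ℤ[X]) ^ k ≤ v.hom P) : v.IsCofinal := by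
  intro a ha
  have hpow : ∀ k : ℕ, v.hom (((p : ℤ) ^ k : ℤ) : ℤ[X]) = v.hom (p : ℤ[X]) ^ k := fun k => by
    rw [Int.cast_pow, map_pow, Int.cast_natCast]
  constructor
  -- Each monomial of degree `i` needs the factor `p ^ (k * i)` to have value at most 1, and the
  -- degree bounds all `i`.
  · refine ⟨(p : ℤ) ^ (k * a.natDegree), 1, ?_, ?_⟩
    · rw [hpow]
      exact pow_ne_zero _ hv.ne_zero
    rw [Int.cast_one, map_one, ← _root_.map_mul]
    have hsum : v.hom ((((p : ℤ) ^ (k * a.natDegree) : ℤ) : ℤ[X]) * a) =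
        v.hom (∑ i ∈ Finset.range (a.natDegree + 1),
          (((p : ℤ) ^ (k * a.natDegree) : ℤ) : ℤ[X]) * (C (a.coeff i) * X ^ i)) := by
      rw [← Finset.mul_sum, ← as_sum_range_C_mul_X_pow]
    rw [hsum, ← v.toValuation_apply hv.natCast_le_one]
    refine (v.toValuation hv.natCast_le_one).map_sum_le fun i hi => ?_
    have hi' : i ≤ a.natDegree := Nat.lt_succ_iff.mp (Finset.mem_range.mp hi)
    rw [toValuation_apply, _root_.map_mul, _root_.map_mul, hpow, eq_intCast C, map_pow]
    calc v.hom (p : ℤ[X]) ^ (k * a.natDegree) * (v.hom (a.coeff i : ℤ[X]) * v.hom X ^ i)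
        ≤ v.hom (p : ℤ[X]) ^ (k * i) * (1 * v.hom X ^ i) :=
          mul_le_mul' (pow_le_pow_of_le_one zero_le hv.lt_one.le
            (Nat.mul_le_mul_left k hi')) (mul_le_mul_left (hv.hom_intCast_le_one _) _)
      _ = (v.hom (p : ℤ[X]) ^ k * v.hom X) ^ i := by rw [one_mul, mul_pow, pow_mul]
      _ ≤ 1 := pow_le_one₀ zero_le hX
  · obtain ⟨k, hk⟩ := hinf a ha
    refine ⟨(p : ℤ) ^ k, 1, ?_, ?_⟩
    · rw [hpow]
      exact pow_ne_zero _ hv.ne_zero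
    · rw [hpow, Int.cast_one, map_one, one_mul]
      exact hk

theorem ExtendsPadic.exists_pow_le {p : ℕ} {E : Type u} [Field E] {Γ : Type u}
    [LinearOrderedCommGroupWithZero Γ] {U : Valuation E Γ} (hU : ExtendsPadic p U) {c : E}
    (hc : c ≠ 0) (halg : IsAlgebraic ℤ c) : ∃ k : ℕ, U (p : E) ^ k ≤ U c := by
  obtain ⟨n, m, hn, h⟩ := hU.exists_pow_eq_zpow hc halg
  -- From `U c ^ n = U p ^ m` with `n ≥ 1`, a value of `c` below `U p ^ |m|` would give `m > |m| n`.
  refine ⟨m.natAbs, ?_⟩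
  by_contra! hlt
  have h1 := pow_lt_pow_left₀ hlt zero_le hn.ne'
  rw [h, ← pow_mul, ← zpow_natCast] at h1
  refine not_le_of_gt h1 ((hU.zpow_le_zpow_iff _ _).mpr ?_)
  push_cast
  calc m ≤ |m| * 1 := by rw [mul_one]; exact le_abs_self m
    _ ≤ |m| * n := mul_le_mul_of_nonneg_left (by exact_mod_cast hn) (abs_nonneg m)

/-- The valuation is realized on an algebraically closed field `L` containing `ℚ̄`, where it induces
a real absolute value `w` on `ℚ̄`. If `X` exceeds all fractions of integers, the leading term
decides; otherwise some `X - a` is infinitely small in `L`. -/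
theorem exists_infinitesimalPlace_eq {p : ℕ} [hp : Fact p.Prime] {v : TMSeminorm ℤ[X]}
    (hv : v.IsPadic p) (hc : ¬v.IsCofinal) : ∃ w ∈ padicExtensions p,
      (∃ a, v.place = restrictLine (AlgebraicClosure ℚ) (infinitesimalPlace w a)) ∨
      v.place = restrictLine (AlgebraicClosure ℚ) (infinityPlace w) := by
  obtain ⟨K, _, V₀, g₀, hg₀, -⟩ := exists_valuation_residueField (v.toValuation hv.natCast_le_one)
  obtain ⟨L, _, _, Γ, _, V, g₁, hg₁⟩ := exists_valuation_isAlgClosed V₀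
  obtain ⟨g, hg⟩ : ∃ g : ℤ[X] →+* L, ∀ a b, V (g a) ≤ V (g b) ↔ v.hom a ≤ v.hom b :=
    ⟨g₁.comp g₀, fun a b => by
      rw [RingHom.comp_apply, RingHom.comp_apply, hg₁, hg₀, hg₀]
      exact Iff.rfl⟩
  have hg0 : ∀ a, V (g a) = 0 ↔ v.hom a = 0 := fun a => by
    have := hg a 0
    rwa [map_zero, map_zero, map_zero, le_zero_iff, le_zero_iff] at this
  have hgeq : ∀ {a b}, v.hom a = v.hom b → V (g a) = V (g b) := fun h =>
    le_antisymm ((hg _ _).mpr h.le) ((hg _ _).mpr h.ge)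
  have hglt : ∀ a b, V (g a) < V (g b) ↔ v.hom a < v.hom b := fun a b => by
    rw [← not_le, hg, not_le]
  have : CharZero L := charZero_of_inj_zero fun n hn => by
    by_contra h0
    have := (hg0 (n : ℤ[X])).mp (by rw [map_natCast, hn, map_zero])
    exact hv.hom_intCast_ne_zero (n := n) (by exact_mod_cast h0) (by simpa using this)
  obtain ⟨σ⟩ := exists_ringHom_algebraicClosure L
  have hσ : ∀ n : ℤ, V.comap σ (n : AlgebraicClosure ℚ) = V (g (n : ℤ[X])) := fun n => by
    rw [Valuation.comap_apply, map_intCast σ, map_intCast g]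
  have hσp : V.comap σ (p : AlgebraicClosure ℚ) = V (g (p : ℤ[X])) := by
    simp
  have hpow : ∀ k : ℕ, V (g (p : ℤ[X])) ^ k = V (g ((p : ℤ[X]) ^ k)) := fun k => by
    rw [map_pow, map_pow]
  have hU : ExtendsPadic p (V.comap σ) :=
    { ne_zero := by
        rw [hσp, Ne, hg0]
        exact hv.ne_zero
      lt_one := by
        rw [hσp]
        have := (hglt p 1).mpr (by simpa using hv.lt_one)
        simpa using this
      map_intCast := fun n hn => by
        rw [hσ, hσp, hpow]
        refine hgeq ?_
        rw [hv.hom_intCast hn, map_pow] }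
  obtain ⟨w, hw, hwle⟩ := hU.exists_absoluteValue isAlgebraic_int_algebraicClosure
  refine ⟨w, hw, ?_⟩
  by_cases hX : ∀ m n : ℤ, n ≠ 0 → v.hom (m : ℤ[X]) < v.hom (n : ℤ[X]) * v.hom X
  · exact Or.inr (TMSeminorm.place_eq_infinityPlace w (padicExtensions_intCast_le_iff hw hv) hX
      (hv.hom_eq_leading hX))
  refine Or.inl ?_
  push Not at hX
  obtain ⟨m, n, hn, hmn⟩ := hX
  rw [hv.hom_intCast hn] at hmn
  -- With `X` bounded, failure of cofinality can only come from a polynomial `P` of nonzero value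
  -- below all powers of `p`.
  have hinf := mt (hv.isCofinal (hmn.trans (hv.hom_intCast_le_one m))) hc
  push Not at hinf
  obtain ⟨P, hP0, hP⟩ := hinf
  have hgeval : ∀ Q : ℤ[X], g Q = eval₂ σ (g X) (Q.map (Int.castRingHom (AlgebraicClosure ℚ))) :=
    fun Q => by
      rw [eval₂_map, show σ.comp (Int.castRingHom _) = Int.castRingHom L from RingHom.ext_int _ _]
      have : g = eval₂RingHom (Int.castRingHom L) (g X) :=
        Polynomial.ringHom_ext (fun n => by simp) (by simp)
      conv_lhs => rw [this]
      rfl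
  set P' := P.map (Int.castRingHom (AlgebraicClosure ℚ)) with hP'
  have hPne : P' ≠ 0 := (Polynomial.map_ne_zero_iff (RingHom.injective_int _)).mpr
    (by rintro rfl; simp at hP0)
  have hprod : g P = σ P'.leadingCoeff * (P'.roots.map fun a => g X - σ a).prod := by
    rw [hgeval, ← hP']
    conv_lhs => rw [(IsAlgClosed.splits P').eq_prod_roots]
    rw [eval₂_mul, eval₂_C, eval₂_multiset_prod, Multiset.map_map]
    simp
  have hgP0 : g P ≠ 0 := fun h => hP0 ((hg0 P).mp (by rw [h, map_zero]))
  -- If every linear factor of `P` were bounded below by a power of `p`, so would be their product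
  -- with the leading coefficient.
  obtain ⟨a, haP, ha⟩ : ∃ a ∈ P'.roots, ∀ k : ℕ, V (g X - σ a) < V.comap σ p ^ k := by
    by_contra! hne
    have hmul : ∀ x y : L, (∃ k : ℕ, V.comap σ p ^ k ≤ V x) → (∃ k : ℕ, V.comap σ p ^ k ≤ V y) →
        ∃ k : ℕ, V.comap σ p ^ k ≤ V (x * y) := by
      rintro x y ⟨k, hk⟩ ⟨l, hl⟩
      exact ⟨k + l, by rw [pow_add, map_mul]; exact mul_le_mul' hk hl⟩
    obtain ⟨k, hk⟩ := hmul _ _ (hU.exists_pow_le (leadingCoeff_ne_zero.mpr hPne)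
      (isAlgebraic_int_algebraicClosure _)) (Multiset.prod_induction
        (fun y => ∃ k : ℕ, V.comap σ p ^ k ≤ V y) (P'.roots.map fun a => g X - σ a) hmul
        ⟨0, by simp⟩ fun y hy => by
          obtain ⟨a, ha, rfl⟩ := Multiset.mem_map.mp hy
          exact hne a ha)
    rw [← hprod, hσp, hpow, hg, map_pow] at hk
    exact not_lt_of_ge hk (hP k)
  have hδ0 : g X - σ a ≠ 0 := fun h0 => hgP0 (by
    rw [hprod, Multiset.prod_eq_zero (Multiset.mem_map.mpr ⟨a, haP, h0⟩), mul_zero])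
  have hδ : ∀ c : AlgebraicClosure ℚ, c ≠ 0 → V (g X - σ a) < V (σ c) := fun c hc => by
    obtain ⟨k, hk⟩ := hU.exists_pow_le hc (isAlgebraic_int_algebraicClosure c)
    exact (ha k).trans_le hk
  refine ⟨a, ?_⟩
  rw [← infinitesimalSeminorm_place, TMSeminorm.place_eq_iff]
  intro Q R
  have htaylor : ∀ Q : ℤ[X], g Q =
      eval₂ σ (g X - σ a) (taylor a (Q.map (Int.castRingHom (AlgebraicClosure ℚ)))) := fun Q => by
    rw [hgeval, taylor_apply, eval₂_comp]
    simp
  rw [← hg, htaylor, htaylor R, valuation_eval₂_le_iff σ hδ0 hδ hwle]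
  exact Iff.rfl

theorem QpPoints_diff_SpehA (p : ℕ) [hp : Fact p.Prime] : QpPoints p \ SpehA ℤ[X] =
    {x | ∃ w ∈ padicExtensions p,
      (∃ a, x = restrictLine (AlgebraicClosure ℚ) (infinitesimalPlace w a)) ∨
      x = restrictLine (AlgebraicClosure ℚ) (infinityPlace w)} := by
  ext x
  constructor
  · rintro ⟨hx, hA⟩
    obtain ⟨v, rfl⟩ := TMSeminorm.exists_place x
    have hv := (place_mem_QpPoints_iff v).mp hx
    rw [← isCofinal_iff_mem_SpehA_of_isPadic hv] at hA
    exact exists_infinitesimalPlace_eq hv hA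
  · rintro ⟨w, hw, ⟨a, rfl⟩ | rfl⟩
    · rw [← infinitesimalSeminorm_place]
      have hv := isPadic_of_natCast_le_iff hw (infinitesimalSeminorm_hom_natCast_le_iff w a)
      refine ⟨(place_mem_QpPoints_iff _).mpr hv, ?_⟩
      rw [← isCofinal_iff_mem_SpehA_of_isPadic hv]
      exact infinitesimalSeminorm_not_isCofinal _ (isAlgebraic_int_algebraicClosure a)
    · rw [← infinitySeminorm_place]
      have hv := isPadic_of_natCast_le_iff hw (infinitySeminorm_hom_natCast_le_iff w)
      refine ⟨(place_mem_QpPoints_iff _).mpr hv, ?_⟩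
      rw [← isCofinal_iff_mem_SpehA_of_isPadic hv]
      exact infinitySeminorm_not_isCofinal _

end Speh

namespace Speh

/-! ### The adic affine line over `ℚ_p`: injectivity of the restriction -/

section AdicLine

variable {p : ℕ} [hp : Fact p.Prime]

theorem C_pow_eq_map (p : ℕ) [Fact p.Prime] (k : ℕ) : C ((p : ℚ_[p]) ^ k) =
    mapRingHom (Int.castRingHom ℚ_[p]) ((p : ℤ[X]) ^ k) := by
  simp

theorem map_pow_mem_discRing (n k : ℕ) :
    mapRingHom (Int.castRingHom ℚ_[p]) ((p : ℤ[X]) ^ k) ∈ discRing p n := by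
  rw [map_pow, map_natCast]
  exact pow_mem (natCast_mem _ p) k

theorem C_mul_X_mem_discRing (n : ℕ) : C ((p : ℚ_[p]) ^ n) * X ∈ discRing p n :=
  Algebra.subset_adjoin (Set.mem_singleton _)

theorem discRing_antitone {m n : ℕ} (h : m ≤ n) : discRing p n ≤ discRing p m := by
  refine Algebra.adjoin_le ?_
  rw [Set.singleton_subset_iff]
  obtain ⟨k, rfl⟩ := Nat.exists_eq_add_of_le h
  rw [pow_add, mul_comm ((p : ℚ_[p]) ^ m), C_mul, mul_assoc, C_pow_eq_map p k]
  exact mul_mem (map_pow_mem_discRing m k) (C_mul_X_mem_discRing _)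

theorem adicDisc_mono {m n : ℕ} (h : m ≤ n) : adicDisc p m ⊆ adicDisc p n := by
  rintro x ⟨Γ, _, v, rfl, hcont, hbdd⟩
  refine ⟨Γ, _, v, rfl, fun f g hf hg => ?_, fun z hz => hbdd z (discRing_antitone h hz)⟩
  obtain ⟨k, hk⟩ := hcont f g hf hg
  exact ⟨k, fun z hz => hk z (discRing_antitone h hz)⟩

variable {Γ : Type} [LinearOrderedCommGroupWithZero Γ] {v : Valuation ℚ_[p][X] Γ}

/-- Continuity with `h = 1` says that powers of `p` fall below every `v f / v g`. The quotient 1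
yields `|p| < 1`, and the quotients `1 / |a|` and `|a|` yield the two halves of cofinality. -/
theorem isPadic_and_isCofinal_of_continuous {u : TMSeminorm ℤ[X]} {n : ℕ}
    (hle : ∀ a b, u.hom a ≤ u.hom b ↔ v (mapRingHom (Int.castRingHom ℚ_[p]) a) ≤
      v (mapRingHom (Int.castRingHom ℚ_[p]) b))
    (hcont : ∀ f g, v f ≠ 0 → v g ≠ 0 →
      ∃ k : ℕ, ∀ h ∈ discRing p n, v (C ((p : ℚ_[p]) ^ k) * h) < v f / v g)
    (hbdd : ∀ h ∈ discRing p n, v h ≤ 1) : u.IsPadic p ∧ u.IsCofinal := by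
  set φ := mapRingHom (Int.castRingHom ℚ_[p]) with hφ
  have h0 : ∀ a, u.hom a = 0 ↔ v (φ a) = 0 := fun a => by
    have := hle a 0
    rwa [map_zero, map_zero, map_zero, le_zero_iff, le_zero_iff] at this
  have hp0 : u.hom (p : ℤ[X]) ≠ 0 := by
    rw [Ne, h0, map_natCast]
    have : IsUnit (p : ℚ_[p][X]) := by
      rw [← C_eq_natCast, isUnit_C]
      exact (Nat.cast_ne_zero.mpr hp.out.ne_zero).isUnit
    exact (this.map v).ne_zero
  have hlt : ∀ a b, u.hom a < u.hom b ↔ v (φ a) < v (φ b) := fun a b => by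
    rw [← not_le, hle, not_le]
  have hsmall : ∀ f g, v f ≠ 0 → v g ≠ 0 → ∃ k : ℕ, v (φ ((p : ℤ[X]) ^ k)) < v f / v g := by
    intro f g hf hg
    obtain ⟨k, hk⟩ := hcont f g hf hg
    refine ⟨k, ?_⟩
    have := hk 1 (one_mem _)
    rwa [mul_one, C_pow_eq_map] at this
  have hpow0 : ∀ k, u.hom (((p : ℤ) ^ k : ℤ) : ℤ[X]) ≠ 0 := fun k => by
    rw [Int.cast_pow, map_pow, Int.cast_natCast]
    exact pow_ne_zero _ hp0
  refine ⟨⟨hp0, ?_, fun m => ?_⟩, fun a ha => ?_⟩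
  · obtain ⟨k, hk⟩ := hsmall 1 1 (by simp) (by simp)
    rw [map_one, div_one, ← map_one v, ← map_one φ, ← hlt, map_pow, map_one] at hk
    by_contra! h1
    exact not_le_of_gt hk (one_le_pow₀ h1)
  · have := hbdd m (natCast_mem _ m)
    rwa [← map_natCast φ, ← map_one v, ← map_one φ, ← hle, map_one] at this
  · rw [Ne, h0] at ha
    constructor
    · obtain ⟨k, hk⟩ := hsmall 1 (φ a) (by simp) ha
      refine ⟨(p : ℤ) ^ k, 1, hpow0 k, ?_⟩
      rw [← _root_.map_mul, hle, Int.cast_one, map_one, map_one, _root_.map_mul, _root_.map_mul,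
        Int.cast_pow, Int.cast_natCast]
      rw [map_one, lt_div_iff₀ (zero_lt_iff.mpr ha)] at hk
      exact hk.le
    · obtain ⟨k, hk⟩ := hsmall (φ a) 1 ha (by simp)
      refine ⟨(p : ℤ) ^ k, 1, hpow0 k, ?_⟩
      rw [Int.cast_one, map_one, one_mul, hle, Int.cast_pow, Int.cast_natCast]
      rw [map_one, div_one] at hk
      exact hk.le

/-- Polynomials over `ℚ_p` are approximated by polynomials over `ℤ`. -/
theorem exists_integral_approximation (n : ℕ) (F : ℚ_[p][X]) : ∃ j : ℕ, ∀ M : ℕ, ∃ P : ℤ[X],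
    ∃ h ∈ discRing p n, mapRingHom (Int.castRingHom ℚ_[p]) ((p : ℤ[X]) ^ j) * F =
      mapRingHom (Int.castRingHom ℚ_[p]) P +
        mapRingHom (Int.castRingHom ℚ_[p]) ((p : ℤ[X]) ^ M) * h := by
  induction F using Polynomial.induction_on' with
  | add F G hF hG =>
    obtain ⟨j, hj⟩ := hF
    obtain ⟨i, hi⟩ := hG
    refine ⟨i + j, fun M => ?_⟩
    obtain ⟨P, f, hf, h1⟩ := hj M
    obtain ⟨Q, g, hg, h2⟩ := hi M
    refine ⟨p ^ i * P + p ^ j * Q, _, add_mem (mul_mem (map_pow_mem_discRing n i) hf)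
      (mul_mem (map_pow_mem_discRing n j) hg), ?_⟩
    rw [pow_add, map_mul, map_add, map_mul, map_mul]
    linear_combination mapRingHom (Int.castRingHom ℚ_[p]) ((p : ℤ[X]) ^ i) * h1 +
      mapRingHom (Int.castRingHom ℚ_[p]) ((p : ℤ[X]) ^ j) * h2
  | monomial i a =>
    obtain ⟨j, hj⟩ : ∃ j : ℕ, ‖(p : ℚ_[p]) ^ j * a‖ ≤ 1 := by
      obtain ⟨j, hj⟩ := exists_pow_lt_of_lt_one (show 0 < (‖a‖ + 1)⁻¹ by positivity)
        (Padic.norm_p_lt_one (p := p))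
      refine ⟨j, ?_⟩
      rw [norm_mul, norm_pow]
      rw [lt_inv_comm₀ (pow_pos (norm_pos_iff.mpr (by exact_mod_cast hp.out.ne_zero)) j)
        (by positivity), lt_inv_comm₀ (by positivity)
        (pow_pos (norm_pos_iff.mpr (by exact_mod_cast hp.out.ne_zero)) j)] at hj
      calc ‖(p : ℚ_[p])‖ ^ j * ‖a‖ ≤ (‖a‖ + 1)⁻¹ * (‖a‖ + 1) := by
            gcongr
            linarith
        _ = 1 := inv_mul_cancel₀ (by positivity)
    refine ⟨j, fun M => ?_⟩
    set z : ℤ_[p] := ⟨_, hj⟩ with hz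
    -- The `n * i` extra digits turn the error into `p ^ M` times a `ℤ_p`-multiple of `(p ^ n X) ^
    -- i`, which lies in `discRing p n`.
    obtain ⟨t, ht⟩ := Ideal.mem_span_singleton.mp (PadicInt.appr_spec (M + n * i) z)
    refine ⟨C (z.appr (M + n * i) : ℤ) * X ^ i, t • (C ((p : ℚ_[p]) ^ n) * X) ^ i,
      Subalgebra.smul_mem _ (pow_mem (C_mul_X_mem_discRing _) i) t, ?_⟩
    have h1 : (p : ℚ_[p]) ^ j * a = (z.appr (M + n * i) : ℚ_[p]) + p ^ (M + n * i) * t := by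
      have := congrArg (fun x : ℤ_[p] => (x : ℚ_[p])) (sub_eq_iff_eq_add.mp ht)
      push_cast at this
      rw [add_comm, ← this]
    rw [← C_pow_eq_map, ← C_pow_eq_map, C_mul_monomial, h1, Algebra.smul_def, mul_pow, ← C_pow,
      ← C_mul_X_pow_eq_monomial, coe_mapRingHom, Polynomial.map_mul, Polynomial.map_pow, map_X,
      map_C, pow_add, pow_mul,
      show algebraMap ℤ_[p] ℚ_[p][X] t = C (t : ℚ_[p]) from rfl]
    simp only [C_add, C_mul, eq_intCast, Int.cast_natCast]
    ring

variable {Γ' : Type} [LinearOrderedCommGroupWithZero Γ'] {v' : Valuation ℚ_[p][X] Γ'} {n : ℕ}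

/-- An integral polynomial `P` approximates `p ^ j * F` with an error divisible by a power `p ^ k`
that is negligible for `v`. That the error is negligible for `v'` too follows by comparing `p ^ k`
with `P`, both integral, where the two orders agree. -/
theorem exists_integral_eq
    (hle : ∀ P Q, v (mapRingHom (Int.castRingHom ℚ_[p]) P) ≤ v (mapRingHom (Int.castRingHom ℚ_[p]) Q) ↔
      v' (mapRingHom (Int.castRingHom ℚ_[p]) P) ≤ v' (mapRingHom (Int.castRingHom ℚ_[p]) Q))
    (hcont : ∀ f g, v f ≠ 0 → v g ≠ 0 →
      ∃ k : ℕ, ∀ h ∈ discRing p n, v (C ((p : ℚ_[p]) ^ k) * h) < v f / v g)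
    (hbdd : ∀ h ∈ discRing p n, v' h ≤ 1) {F : ℚ_[p][X]} (hF : v F ≠ 0) :
    ∃ (j : ℕ) (P : ℤ[X]),
      v (mapRingHom (Int.castRingHom ℚ_[p]) ((p : ℤ[X]) ^ j) * F) =
        v (mapRingHom (Int.castRingHom ℚ_[p]) P) ∧
      v' (mapRingHom (Int.castRingHom ℚ_[p]) ((p : ℤ[X]) ^ j) * F) =
        v' (mapRingHom (Int.castRingHom ℚ_[p]) P) := by
  set φ := mapRingHom (Int.castRingHom ℚ_[p]) with hφ
  obtain ⟨j, hj⟩ := exists_integral_approximation n F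
  have hunit : IsUnit (φ ((p : ℤ[X]) ^ j)) := by
    rw [← C_pow_eq_map, isUnit_C]
    exact (pow_ne_zero _ (Nat.cast_ne_zero.mpr hp.out.ne_zero)).isUnit
  have h0 : v (φ ((p : ℤ[X]) ^ j) * F) ≠ 0 := by
    rw [map_mul]
    exact mul_ne_zero (hunit.map v).ne_zero hF
  obtain ⟨k, hk⟩ := hcont _ 1 h0 (by simp)
  obtain ⟨P, h, hh, heq⟩ := hj k
  rw [map_one, div_one] at hk
  have h1 := hk h hh
  have h2 := hk 1 (one_mem _)
  rw [C_pow_eq_map] at h1 h2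
  rw [mul_one] at h2
  have h3 : v (φ ((p : ℤ[X]) ^ j) * F) = v (φ P) := by
    have : φ P = φ ((p : ℤ[X]) ^ j) * F - φ ((p : ℤ[X]) ^ k) * h := by rw [heq]; ring
    rw [this, v.map_sub_eq_of_lt_left h1]
  refine ⟨j, P, h3, ?_⟩
  have h4 : v' (φ ((p : ℤ[X]) ^ k)) < v' (φ P) := by
    rw [h3] at h2
    rwa [← not_le, ← hle, not_le]
  have h5 : v' (φ ((p : ℤ[X]) ^ k) * h) < v' (φ P) := by
    rw [map_mul]
    exact (mul_le_of_le_one_right' (hbdd h hh)).trans_lt h4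
  rw [heq, v'.map_add_eq_of_lt_left h5]

theorem valuation_le_of_le
    (hle : ∀ P Q, v (mapRingHom (Int.castRingHom ℚ_[p]) P) ≤ v (mapRingHom (Int.castRingHom ℚ_[p]) Q) ↔
      v' (mapRingHom (Int.castRingHom ℚ_[p]) P) ≤ v' (mapRingHom (Int.castRingHom ℚ_[p]) Q))
    (hcont : ∀ f g, v f ≠ 0 → v g ≠ 0 →
      ∃ k : ℕ, ∀ h ∈ discRing p n, v (C ((p : ℚ_[p]) ^ k) * h) < v f / v g)
    (hbdd : ∀ h ∈ discRing p n, v h ≤ 1)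
    (hcont' : ∀ f g, v' f ≠ 0 → v' g ≠ 0 →
      ∃ k : ℕ, ∀ h ∈ discRing p n, v' (C ((p : ℚ_[p]) ^ k) * h) < v' f / v' g)
    (hbdd' : ∀ h ∈ discRing p n, v' h ≤ 1) {F G : ℚ_[p][X]} (hFG : v F ≤ v G) : v' F ≤ v' G := by
  set φ := mapRingHom (Int.castRingHom ℚ_[p]) with hφ
  have hunit : ∀ j, IsUnit (φ ((p : ℤ[X]) ^ j)) := fun j => by
    rw [← C_pow_eq_map, isUnit_C]
    exact (pow_ne_zero _ (Nat.cast_ne_zero.mpr hp.out.ne_zero)).isUnit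
  by_cases hF : v F = 0
  -- For `v F = 0` the approximation is made from the side of `v'`: it gives an integral `P` with `v
  -- P = 0`, hence `v' P = 0`, which forces `v' F = 0`.
  · by_cases hF' : v' F = 0
    · rw [hF']
      exact zero_le
    obtain ⟨j, P, h1, h2⟩ := exists_integral_eq (fun P Q => (hle P Q).symm) hcont' hbdd hF'
    rw [← hφ] at h1 h2
    rw [map_mul v, hF, mul_zero] at h2
    have h3 := (hle P 0).mp (by rw [← h2]; exact zero_le)
    rw [← h1, map_mul, map_zero, map_zero, le_zero_iff] at h3
    exact absurd h3 (mul_ne_zero ((hunit j).map v').ne_zero hF')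
  · have hG : v G ≠ 0 := fun h => hF (le_zero_iff.mp (h ▸ hFG))
    obtain ⟨j, P, h1, h2⟩ := exists_integral_eq hle hcont hbdd' hF
    obtain ⟨i, Q, h3, h4⟩ := exists_integral_eq hle hcont hbdd' hG
    rw [← hφ] at h1 h2 h3 h4
    have h5 : v (φ ((p : ℤ[X]) ^ i * P)) ≤ v (φ ((p : ℤ[X]) ^ j * Q)) := by
      rw [map_mul φ, map_mul φ, map_mul v, map_mul v, ← h1, ← h3, map_mul v, map_mul v,
        mul_left_comm]
      gcongr
    rw [hle, map_mul φ, map_mul φ, map_mul v', map_mul v', ← h2, ← h4, map_mul v',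
      map_mul v', mul_left_comm,
      mul_le_mul_iff_right₀ (zero_lt_iff.mpr ((hunit j).map v').ne_zero),
      mul_le_mul_iff_right₀ (zero_lt_iff.mpr ((hunit i).map v').ne_zero)] at h5
    exact h5

end AdicLine

theorem restrictLine_mapsTo_adicAffineLine (p : ℕ) [hp : Fact p.Prime] :
    Set.MapsTo (restrictLine ℚ_[p]) (adicAffineLine p) (QpPoints p ∩ SpehA ℤ[X]) := by
  rintro x hx
  obtain ⟨n, Γ, _, v, rfl, hcont, hbdd⟩ := Set.mem_iUnion.mp hx
  obtain ⟨u, hu⟩ := TMSeminorm.exists_place (restrictLine ℚ_[p] (krullPlace v))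
  have hle := (u.place_eq_krullPlace_iff (v.comap (mapRingHom (Int.castRingHom ℚ_[p])))).mp hu
  obtain ⟨h1, h2⟩ := isPadic_and_isCofinal_of_continuous hle hcont hbdd
  rw [← hu]
  exact ⟨(place_mem_QpPoints_iff u).mpr h1, TMSeminorm.mem_SpehA_of_isCofinal h1.natCast_le_one h2⟩

theorem restrictLine_injOn_adicAffineLine (p : ℕ) [hp : Fact p.Prime] :
    Set.InjOn (restrictLine ℚ_[p]) (adicAffineLine p) := by
  intro x hx y hy hxy
  obtain ⟨m, hm⟩ := Set.mem_iUnion.mp hx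
  obtain ⟨n, hn⟩ := Set.mem_iUnion.mp hy
  obtain ⟨Γ, _, v, rfl, hcont, hbdd⟩ := adicDisc_mono (le_max_left m n) hm
  obtain ⟨Γ', _, v', rfl, hcont', hbdd'⟩ := adicDisc_mono (le_max_right m n) hn
  have hle := (krullPlace_eq_iff (v.comap (mapRingHom (Int.castRingHom ℚ_[p])))
    (v'.comap (mapRingHom (Int.castRingHom ℚ_[p])))).mp hxy
  rw [krullPlace_eq_iff]
  exact fun F G => ⟨valuation_le_of_le hle hcont hbdd hcont' hbdd',
    valuation_le_of_le (fun P Q => (hle P Q).symm) hcont' hbdd' hcont hbdd⟩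

end Speh

namespace Speh

/-! ### The adic affine line over `ℚ_p`: surjectivity of the restriction -/

/-- The completion of a valued extension of `ℚ` contains `ℚ_p` if the powers of `p` tend to `0`. -/
theorem ExtendsPadic.exists_ringHom_padic {p : ℕ} [hp : Fact p.Prime] {K : Type} [Field K]
    [CharZero K] {Γ : Type} [LinearOrderedCommGroupWithZero Γ] {V : Valuation K Γ}
    (hV : ExtendsPadic p V) (hsmall : ∀ y : K, y ≠ 0 → ∃ k : ℕ, V (p : K) ^ k < V y) :
    ∃ (L : Type) (_ : Field L) (W : Valuation L Γ) (ι : K →+* L) (ψ : ℚ_[p] →+* L),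
      (∀ y, W (ι y) = V y) ∧ (∀ x, ∃ y, W x = V y) ∧ ∀ z : ℤ_[p], W (ψ z) ≤ 1 := by
  let _ : Valued K Γ := Valued.mk' V
  have hVv : ∀ y : K, (Valued.v y : Γ) = V y := fun y => rfl
  let f₀ : WithVal (Rat.padicValuation p) →+* K :=
    (Rat.castHom K).comp (WithVal.equiv (Rat.padicValuation p)).toRingHom
  -- By `hsmall` some `p ^ k` lies in the given neighbourhood, and a rational number divisible by a
  -- higher power of `p` has a value at most that of `p ^ k`.
  have hf₀ : Filter.Tendsto f₀ (𝓝 0) (𝓝 0) := by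
    intro s hs
    obtain ⟨y, hy, hys⟩ := (valued_mem_nhds_zero_iff s).mp hs
    obtain ⟨k, hk⟩ := hsmall y (by simpa using hy)
    refine (valued_mem_nhds_zero_iff _).mpr ⟨(p : WithVal (Rat.padicValuation p)) ^ k, ?_, ?_⟩
    · rw [← WithVal.val_apply_equiv, Ne, Rat.padicValuation_eq_zero_iff, map_pow, map_natCast]
      exact pow_ne_zero _ (Nat.cast_ne_zero.mpr hp.out.ne_zero)
    · intro q hq
      refine hys ?_
      rw [Set.mem_ofPred_eq, ← WithVal.val_apply_equiv, ← WithVal.val_apply_equiv, map_pow,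
        map_natCast, map_pow, Rat.padicValuation_self] at hq
      change V ((WithVal.equiv (Rat.padicValuation p) q : ℚ) : K) < V y
      set r : ℚ := WithVal.equiv (Rat.padicValuation p) q
      by_cases hr : r = 0
      · simpa [hr, zero_lt_iff] using hy
      rw [hV.map_ratCast hr]
      refine lt_of_le_of_lt ?_ hk
      rw [← zpow_natCast, hV.zpow_le_zpow_iff]
      simp only [Rat.padicValuation, Valuation.coe_mk, MonoidWithZeroHom.coe_mk, ZeroHom.coe_mk,
        hr, if_false, ← WithZero.exp_nsmul, WithZero.exp_lt_exp] at hq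
      simp at hq
      exact hq.le
  have hf : UniformContinuous ((UniformSpace.Completion.coeRingHom (α := K)).comp f₀) := by
    refine (UniformSpace.Completion.uniformContinuous_coe K).comp ?_
    refine uniformContinuous_of_tendsto_zero hf₀
  refine ⟨UniformSpace.Completion K, inferInstance, Valued.extensionValuation,
    UniformSpace.Completion.coeRingHom,
    IsDenseInducing.extendRingHom Padic.isUniformInducing_cast_withVal
      Padic.isDenseInducing_cast_withVal.dense hf,
    fun y => Valued.extensionValuation_apply_coe y, fun x => Valued.exists_coe_eq_v x, ?_⟩
  have hc : Continuous (IsDenseInducing.extendRingHom Padic.isUniformInducing_cast_withVal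
      Padic.isDenseInducing_cast_withVal.dense hf) :=
    (uniformContinuous_uniformly_extend Padic.isUniformInducing_cast_withVal
      Padic.isDenseInducing_cast_withVal.dense hf).continuous
  intro z
  -- The valuation ring of the completion is closed and contains the natural numbers, which are
  -- dense in `ℤ_p`.
  refine PadicInt.denseRange_natCast.induction_on (p := fun z : ℤ_[p] =>
    Valued.extensionValuation (IsDenseInducing.extendRingHom Padic.isUniformInducing_cast_withVal
      Padic.isDenseInducing_cast_withVal.dense hf (z : ℚ_[p])) ≤ (1 : Γ)) z ?_ fun n => ?_
  · exact (Valued.isClosed_integer (UniformSpace.Completion K)).preimage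
      (hc.comp continuous_subtype_val)
  · have h1 : ((n : ℤ_[p]) : ℚ_[p]) = n := PadicInt.coe_natCast n
    rw [h1, map_natCast, ← map_natCast (UniformSpace.Completion.coeRingHom (α := K))]
    refine (Valued.extensionValuation_apply_coe (n : K)).trans_le ?_
    by_cases hn : n = 0
    · simp [hn]
    rw [hVv, ← Int.cast_natCast, hV.map_intCast n (by exact_mod_cast hn)]
    exact pow_le_one₀ zero_le hV.lt_one.le

/-- Cofinality makes the powers of `p` tend to 0 in the residue field, so its completion `L`
receives `ℚ_p`. The valuation of `L` is pulled back along `Φ : ℚ_p[X] → L`; it lies in a disc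
because some `p ^ n X` has value at most 1. -/
theorem restrictLine_surjOn_adicAffineLine (p : ℕ) [hp : Fact p.Prime] :
    Set.SurjOn (restrictLine ℚ_[p]) (adicAffineLine p) (QpPoints p ∩ SpehA ℤ[X]) := by
  rintro x ⟨hx, hA⟩
  obtain ⟨v, rfl⟩ := TMSeminorm.exists_place x
  have hv := (place_mem_QpPoints_iff v).mp hx
  have hc := (isCofinal_iff_mem_SpehA_of_isPadic hv).mpr hA
  have hint : ∀ n : ℤ, v.hom (n : ℤ[X]) ≠ 0 →
      v.hom (n : ℤ[X]) = v.hom (p : ℤ[X]) ^ padicValInt p n := fun n hn =>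
    hv.hom_intCast (by rintro rfl; simp at hn)
  have hlow : ∀ a, v.hom a ≠ 0 → ∃ k : ℕ, v.hom (p : ℤ[X]) ^ k ≤ v.hom a := fun a ha => by
    obtain ⟨n, m, hn, hle⟩ := (hc a ha).2
    refine ⟨padicValInt p n, ?_⟩
    rw [← hint n hn]
    exact hle.trans (mul_le_of_le_one_left' (hv.hom_intCast_le_one m))
  have hhigh : ∀ a, v.hom a ≠ 0 → ∃ k : ℕ, v.hom (p : ℤ[X]) ^ k * v.hom a ≤ 1 := fun a ha => by
    obtain ⟨n, m, hn, hle⟩ := (hc a ha).1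
    refine ⟨padicValInt p n, ?_⟩
    rw [← hint n hn]
    exact hle.trans (hv.hom_intCast_le_one m)
  obtain ⟨K, _, V₀, g₀, hg₀, hfrac⟩ :=
    exists_valuation_residueField (v.toValuation hv.natCast_le_one)
  simp only [TMSeminorm.toValuation_apply] at hg₀
  have hV₀int : ∀ n : ℤ, V₀ (n : K) = v.hom (n : ℤ[X]) := fun n => by
    rw [← hg₀, map_intCast g₀]
  have hV₀p : V₀ (p : K) = v.hom (p : ℤ[X]) := by
    simpa using hV₀int p
  have : CharZero K := charZero_of_inj_zero fun n hn => by
    by_contra h0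
    have h1 := hV₀int n
    rw [Int.cast_natCast, hn, map_zero] at h1
    exact hv.hom_intCast_ne_zero (n := n) (by exact_mod_cast h0) h1.symm
  have hV₀ : ExtendsPadic p V₀ :=
    { ne_zero := by rw [hV₀p]; exact hv.ne_zero
      lt_one := by rw [hV₀p]; exact hv.lt_one
      map_intCast := fun n hn => by rw [hV₀int, hV₀p, hv.hom_intCast hn] }
  have hsmall : ∀ y : K, y ≠ 0 → ∃ k : ℕ, V₀ (p : K) ^ k < V₀ y := by
    intro y hy
    obtain ⟨a, s, hs, h⟩ := hfrac y
    have hval : v.hom s * V₀ y = v.hom a := by rw [← hg₀, ← hg₀, ← map_mul, h]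
    have hs0 : v.hom s ≠ 0 := by rw [← hg₀]; simpa using hs
    have hy0 : V₀ y ≠ 0 := by simpa using hy
    have ha0 : v.hom a ≠ 0 := by rw [← hval]; exact mul_ne_zero hs0 hy0
    obtain ⟨k, hk⟩ := hlow a ha0
    obtain ⟨l, hl⟩ := hhigh s hs0
    -- The exponents `k` and `l` bound numerator and denominator; the extra factor `p` makes the
    -- inequality strict.
    refine ⟨k + l + 1, ?_⟩
    rw [hV₀p, ← mul_lt_mul_iff_right₀ (zero_lt_iff.mpr hs0), hval]
    calc v.hom s * v.hom (p : ℤ[X]) ^ (k + l + 1)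
        = v.hom (p : ℤ[X]) ^ k * (v.hom (p : ℤ[X]) ^ l * v.hom s) * v.hom (p : ℤ[X]) := by
          rw [pow_succ, pow_add]
          simp only [mul_comm, mul_left_comm]
      _ ≤ v.hom a * v.hom (p : ℤ[X]) :=
          mul_le_mul_left ((mul_le_of_le_one_right' hl).trans hk) _
      _ < v.hom a * 1 := (mul_lt_mul_iff_right₀ (zero_lt_iff.mpr ha0)).mpr hv.lt_one
      _ = v.hom a := mul_one _
  obtain ⟨L, _, W, ι, ψ, hWι, hWs, hψ⟩ := hV₀.exists_ringHom_padic hsmall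
  set Φ : ℚ_[p][X] →+* L := eval₂RingHom ψ (ι (g₀ X)) with hΦ
  have hΦX : Φ X = ι (g₀ X) := by simp [hΦ]
  have hΦC : ∀ z, Φ (C z) = ψ z := fun z => by simp [hΦ]
  have hΦmap : ∀ P : ℤ[X], Φ (mapRingHom (Int.castRingHom ℚ_[p]) P) = ι (g₀ P) := by
    intro P
    have : Φ.comp (mapRingHom (Int.castRingHom ℚ_[p])) = ι.comp g₀ :=
      Polynomial.ringHom_ext (fun n => by simp) (by simp [hΦX])
    exact RingHom.congr_fun this P
  have hWp : W (ψ p) = V₀ (p : K) := by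
    rw [← hWι, map_natCast ψ, map_natCast ι]
  obtain ⟨n, hn⟩ : ∃ n : ℕ, v.hom (p : ℤ[X]) ^ n * v.hom X ≤ 1 := by
    by_cases h0 : v.hom X = 0
    · exact ⟨0, by simp [h0]⟩
    · exact hhigh X h0
  have hbdd : ∀ h ∈ discRing p n, W.comap Φ h ≤ 1 := by
    intro h hh
    induction hh using Algebra.adjoin_induction with
    | mem y hy =>
      rw [Set.mem_singleton_iff.mp hy, Valuation.comap_apply, map_mul, hΦC, hΦX, map_mul, hWι, hg₀,
        map_pow, map_pow, hWp, hV₀p]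
      exact hn
    | algebraMap z =>
      rw [show algebraMap ℤ_[p] ℚ_[p][X] z = C (z : ℚ_[p]) from rfl, Valuation.comap_apply, hΦC]
      exact hψ z
    | add a b _ _ ha hb => exact ((W.comap Φ).map_add a b).trans (max_le ha hb)
    | mul a b _ _ ha hb => rw [map_mul]; exact mul_le_one' ha hb
  refine ⟨krullPlace (W.comap Φ), Set.mem_iUnion.mpr ⟨n, v.R, inferInstance, W.comap Φ, rfl,
    fun f g hf hg => ?_, hbdd⟩, ?_⟩
  -- Completion does not enlarge the set of values, so continuity reduces to `hsmall` for an element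
  -- of the residue field.
  · obtain ⟨y, hy⟩ := hWs (Φ f / Φ g)
    have hdiv : W.comap Φ f / W.comap Φ g = V₀ y := by
      rw [← hy, map_div₀]
      rfl
    have hy0 : y ≠ 0 := by
      rintro rfl
      rw [map_zero] at hdiv
      exact div_ne_zero hf hg hdiv
    obtain ⟨k, hk⟩ := hsmall y hy0
    refine ⟨k, fun h hh => ?_⟩
    rw [hdiv, map_mul, Valuation.comap_apply, hΦC, map_pow, map_pow, hWp]
    exact (mul_le_of_le_one_right' (hbdd h hh)).trans_lt hk
  · refine ((v.place_eq_krullPlace_iff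
      ((W.comap Φ).comap (mapRingHom (Int.castRingHom ℚ_[p])))).mpr fun a b => ?_).symm
    rw [Valuation.comap_apply, Valuation.comap_apply, Valuation.comap_apply, Valuation.comap_apply,
      hΦmap, hΦmap, hWι, hWι, hg₀, hg₀]

theorem restrictLine_bijOn_adicAffineLine (p : ℕ) [Fact p.Prime] :
    Set.BijOn (restrictLine ℚ_[p]) (adicAffineLine p) (QpPoints p ∩ SpehA ℤ[X]) :=
  ⟨restrictLine_mapsTo_adicAffineLine p, restrictLine_injOn_adicAffineLine p,
    restrictLine_surjOn_adicAffineLine p⟩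

end Speh

theorem mainTheorem4 :
    (∀ x : Speh.SpehM ℤ[X], x ∈ Speh.trivialPoints ∨ (∃ p : ℕ, p.Prime ∧ x ∈ Speh.FpPoints p) ∨
      (∃ (p : ℕ) (_ : Fact p.Prime), x ∈ Speh.QpPoints p) ∨ x ∈ Speh.RPoints) ∧
    (Speh.trivialPoints ⊆ Speh.SpehA ℤ[X] ∧
      Speh.trivialPoints = Speh.restrictLine ℚ '' Speh.trivialLine ℚ) ∧
    (∀ (p : ℕ) [Fact p.Prime],
      Speh.FpPoints p ⊆ Speh.SpehA ℤ[X] ∧ Speh.FpPoints p ⊆ Speh.Spev ℤ[X] ∧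
      Speh.FpPoints p = Speh.restrictLine (ZMod p) '' Speh.trivialLine (ZMod p)) ∧
    (∀ (p : ℕ) [Fact p.Prime],
      Speh.QpPoints p ⊆ Speh.Spev ℤ[X] ∧
      Speh.QpPoints p \ Speh.SpehA ℤ[X] =
        {x | ∃ w ∈ Speh.padicExtensions p,
          (∃ a, x = Speh.restrictLine (AlgebraicClosure ℚ) (Speh.infinitesimalPlace w a)) ∨
          x = Speh.restrictLine (AlgebraicClosure ℚ) (Speh.infinityPlace w)} ∧
      Set.BijOn (Speh.restrictLine ℚ_[p]) (Speh.adicAffineLine p) (Speh.QpPoints p ∩ Speh.SpehA ℤ[X])) ∧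
    (Speh.RPoints \ Speh.SpehA ℤ[X] =
        {x | ∃ w ∈ Speh.complexAbsoluteValues,
          (∃ a, x = Speh.restrictLine (AlgebraicClosure ℚ) (Speh.infinitesimalPlace w a)) ∨
          x = Speh.restrictLine (AlgebraicClosure ℚ) (Speh.infinityPlace w)} ∧
      Speh.RPoints ∩ Speh.SpehA ℤ[X] = Set.range Speh.complexPoint ∧
      Speh.RPoints ∩ Speh.SpehA ℤ[X] = Speh.RPoints ∩ Set.range Speh.realPlace) := by
  refine ⟨Speh.mem_trivial_or_Fp_or_Qp_or_R, ⟨?_, Speh.trivialPoints_eq⟩, fun p _ => ⟨?_, ?_,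
    Speh.FpPoints_eq p⟩, fun p _ => ⟨Speh.QpPoints_subset_Spev p, Speh.QpPoints_diff_SpehA p,
    Speh.restrictLine_bijOn_adicAffineLine p⟩, Speh.RPoints_diff_SpehA, Speh.RPoints_inter_SpehA,
    Speh.RPoints_inter_range_realPlace⟩
  · rw [Speh.trivialPoints_eq]
    exact Speh.restrictLine_trivialLine_subset_SpehA
  · rw [Speh.FpPoints_eq p]
    exact Speh.restrictLine_trivialLine_subset_SpehA
  · rw [Speh.FpPoints_eq p]
    exact Speh.restrictLine_trivialLine_subset_Spev
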